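/- Let $\Bbbk$ be an algebraically closed field and let $\mathfrak D$ be a $\Bbbk$-linear triangulated category. Write $\mathrm{Hom}^i(X,Y)=\mathrm{Hom}(X,Y[i])$. Let $X\mapsto X\langle 1\rangle$ be a Tate twist on $\mathfrak D$, i.e. a $\Bbbk$-linear triangulated autoequivalence such that, for every nonzero object $X$, $X\cong X\langle n\rangle$ only if $n=0$. Let $S$ be a partially ordered set such that $\{t\in S: t\le s\}$ is finite for every $s\in S$. Let $\{\nabla_s\}_{s\in S}$ be a graded quasi-exceptional set in $\mathfrak D$, i.e. a family of objects such that 1. if $s\not\ge t$, then $\mathrm{Hom}^i(\nabla_s,\nabla_t\langle n\rangle)=0$ for all $i,n\in\mathbb Z$; 2. $\mathrm{Hom}^i(\nabla_s,\nabla_s\langle n\rangle)=0$ for all $i<0$ and $n\in\mathbb Z$; $\mathrm{Hom}(\nabla_s,\nabla_s)$ is one-dimensional; and $\mathrm{Hom}(\nabla_s,\nabla_s\langle n\rangle)=0$ for $n\neq 0$; 3. $\mathrm{Hom}^i(\nabla_s,\nabla_s\langle n\rangle)=0$ for all $i>0$ and $n\ge 0$; 4. the objects $\nabla_s\langle n\rangle$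 generate $\mathfrak D$ as a triangulated category. Assume that it is dualizable with dual set $\{\Delta_s\}_{s\in S}$: there are morphisms $\iota_s:\Delta_s\to\nabla_s$ whose cone lies in the full triangulated subcategory generated by the $\nabla_t\langle n\rangle$ with $t<s$ and $n\in\mathbb Z$, and $\mathrm{Hom}^i(\Delta_s,\nabla_t\langle n\rangle)=0$ for all $i,n\in\mathbb Z$ whenever $s>t$. Assume that it is abelianesque: $\mathrm{Hom}^i(\nabla_s,\nabla_t\langle n\rangle)=\mathrm{Hom}^i(\Delta_s,\Delta_t\langle n\rangle)=0$ for all $s,t\in S$, $n\in\mathbb Z$ and $i<0$. Then there is a $t$-structure on $\mathfrak D$ with $$\mathfrak D^{\le 0}=\{X:\mathrm{Hom}(X,\nabla_s\langle n\rangle[d])=0\ \text{for all } s,n \text{ and all } d<0\},$$ $$\mathfrak D^{\ge 0}=\{X:\mathrm{Hom}(\Delta_s\langle n\rangle[d],X)=0\ \text{for all } s,n \text{ and all } d>0\}.$$ Let $\mathfrak A$ be its heart, and let $\Sigma_s\langle n\rangle$ be the image in $\mathfrak A$ of $\iota_s\langle n\rangle:\Delta_s\langle n\rangle\to\nabla_s\langle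 n\rangle$. For $\Xi\subset S\times\mathbb Z$ let ${}^{\Xi}\mathfrak A$ be the Serre subcategory of $\mathfrak A$ generated by the $\Sigma_s\langle n\rangle$ with $(s,n)\in\Xi$, and let $\mathfrak A_{\le s}$ be the one generated by all $\Sigma_t\langle n\rangle$ with $t\le s$ and $n\in\mathbb Z$. An object of $\mathfrak A$ is called $s$-quasistandard (resp. $s$-quasicostandard) if it has a finite filtration whose subquotients are isomorphic to objects $\Delta_s\langle n\rangle$ (resp. $\nabla_s\langle n\rangle$), $n\in\mathbb Z$. Assume the effaceability property: * for every $s$, every $d>0$, every $s$-quasistandard $X$ and every morphism $f:X[-d]\to\Delta_s$ there are $Y\in\mathfrak A_{\le s}$ and an injective map $g:\Delta_s\hookrightarrow Y$ in $\mathfrak A$ with $g\circ f=0$; * for every $s$, every $d>0$, every $s$-quasicostandard $X$ and every morphism $f:\nabla_s\to X[d]$ there are $Y\in\mathfrak A_{\le s}$ and a surjective map $h:Y\twoheadrightarrow\nabla_s$ in $\mathfrak A$ with $f\circ h=0$. Call $\Xi\subset S\times\mathbb Z$ convex if $\Delta_s\langle n\rangle,\nabla_s\langle n\rangle\in{}^{\Xi}\mathfrak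 A$ for every $(s,n)\in\Xi$ and if, for every $s$, the set $\{n:(s,n)\in\Xi\}$ is a (possibly empty or infinite) interval of $\mathbb Z$. For $\mathfrak B={}^{\Xi}\mathfrak A$ or $\mathfrak B=\mathfrak A$, a realization functor is a triangulated functor $D^{\mathrm b}(\mathfrak B)\to\mathfrak D$ whose restriction to $\mathfrak B$ is isomorphic to the inclusion $\mathfrak B\hookrightarrow\mathfrak D$. Then for every convex $\Xi\subset S\times\mathbb Z$, every realization functor $D^{\mathrm b}({}^{\Xi}\mathfrak A)\to\mathfrak D$ is fully faithful. Moreover, every realization functor $D^{\mathrm b}(\mathfrak A)\to\mathfrak D$ is an equivalence of categories. -/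

import Mathlib

open CategoryTheory Limits Pretriangulated Triangulated ZeroObject

noncomputable section

namespace QuasiExc

/-! ### The heart of a t-structure is an abelian category -/

theorem isClosedUnderFiniteProducts_of_biprod {C : Type*} [Category* C] [Preadditive C]
    [HasZeroObject C] [HasFiniteProducts C] [HasBinaryBiproducts C]
    (P : ObjectProperty C) [P.ContainsZero] [P.IsClosedUnderIsomorphisms]
    (h : ∀ X Y : C, P X → P Y → P (X ⊞ Y)) : P.IsClosedUnderFiniteProducts := by
  have : P.IsClosedUnderBinaryProducts :=
    { limitsOfShape_le := by
        rintro X ⟨p⟩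
        refine P.prop_of_iso ?_ (h _ _ (p.prop_diag_obj ⟨.left⟩) (p.prop_diag_obj ⟨.right⟩))
        exact (biprod.isoProd _ _).trans
          ((HasLimit.isoOfNatIso (diagramIsoPair p.diag).symm).trans
            (limit.isoLimitCone ⟨_, p.isLimit⟩)) }
  exact ObjectProperty.IsClosedUnderFiniteProducts.mk'

section Heart

variable {D : Type*} [Category* D] [Preadditive D] [HasZeroObject D] [HasShift D ℤ]
  [∀ n : ℤ, (shiftFunctor D n).Additive] [Pretriangulated D] (t : TStructure D)

/-- The heart of a t-structure, as a category. -/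
abbrev HeartCat : Type _ := t.heart.FullSubcategory

theorem heart_mem (X : D) (h₁ : t.IsLE X 0) (h₂ : t.IsGE X 0) : t.heart X :=
  (t.mem_heart_iff X).2 ⟨h₁, h₂⟩

instance isLE_heartCat (X : HeartCat t) : t.IsLE X.obj 0 := ((t.mem_heart_iff _).1 X.property).1

instance isGE_heartCat (X : HeartCat t) : t.IsGE X.obj 0 := ((t.mem_heart_iff _).1 X.property).2

instance heart_containsZero : t.heart.ContainsZero where
  exists_zero := ⟨0, isZero_zero D, heart_mem t 0 inferInstance inferInstance⟩

instance heart_finiteProducts : t.heart.IsClosedUnderFiniteProducts :=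
  isClosedUnderFiniteProducts_of_biprod _ fun X Y hX hY => by
    rw [t.mem_heart_iff] at hX hY
    exact heart_mem t _
      (t.isLE₂ _ (binaryBiproductTriangle_distinguished X Y) 0 hX.1 hY.1)
      (t.isGE₂ _ (binaryBiproductTriangle_distinguished X Y) 0 hX.2 hY.2)

theorem heart_hom_shift_neg ⦃X Y : HeartCat t⦄ ⦃n : ℤ⦄
    (f : t.heart.ι.obj X ⟶ (t.heart.ι.obj Y)⟦n⟧) (hn : n < 0) : f = 0 := by
  dsimp at f ⊢
  have : t.IsGE ((Y.obj)⟦n⟧) (-n) := t.isGE_shift Y.obj 0 n (-n)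
  exact t.zero f 0 (-n)

theorem heart_admissible : AbelianSubcategory.admissibleMorphism t.heart.ι = ⊤ := by
  ext X₁ X₂ f₁
  simp only [MorphismProperty.top_apply, iff_true]
  intro X₃ f₂ f₃ hT
  have hT' := rot_of_distTriang _ hT
  have hLE : t.IsLE X₃ 0 := t.isLE₂ _ hT' 0 (inferInstanceAs (t.IsLE X₂.obj 0))
    (by
      have : t.IsLE (X₁.obj⟦(1 : ℤ)⟧) (-1) := t.isLE_shift X₁.obj 0 1 (-1)
      exact t.isLE_of_le (X₁.obj⟦(1 : ℤ)⟧) (-1) 0)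
  have hGE : t.IsGE X₃ (-1) := t.isGE₂ _ hT' (-1)
    (t.isGE_of_ge X₂.obj (-1) 0)
    (t.isGE_shift X₁.obj 0 1 (-1))
  obtain ⟨K, Q, hK, hQ, a, b, c, hT₂⟩ := t.exists_triangle X₃ (-1) 0 (by simp)
  have hK' : t.IsLE K (-1) := ⟨hK⟩
  have hQ' : t.IsGE Q 0 := ⟨hQ⟩
  have hQ₂ : t.IsLE Q 0 := t.isLE₂ _ (rot_of_distTriang _ hT₂) 0 hLE (by
      have : t.IsLE (K⟦(1 : ℤ)⟧) (-2) := t.isLE_shift K (-1) 1 (-2)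
      exact t.isLE_of_le (K⟦(1 : ℤ)⟧) (-2) 0)
  have hK₂ : t.IsGE K (-1) := t.isGE₂ _ (inv_rot_of_distTriang _ hT₂) (-1) (by
      have : t.IsGE (Q⟦(-1 : ℤ)⟧) 1 := t.isGE_shift Q 0 (-1) 1
      exact t.isGE_of_ge (Q⟦(-1 : ℤ)⟧) (-1) 1) hGE
  have e : (K⟦(-1 : ℤ)⟧)⟦(1 : ℤ)⟧ ≅ K := (shiftFunctorCompIsoId D (-1 : ℤ) 1 (by simp)).app K
  refine ⟨⟨K⟦(-1 : ℤ)⟧, heart_mem t _ (t.isLE_shift K (-1) (-1) 0) (t.isGE_shift K (-1) (-1) 0)⟩,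
    ⟨Q, heart_mem t _ hQ₂ hQ'⟩, e.hom ≫ a, b, c ≫ e.inv⟦(1 : ℤ)⟧', ?_⟩
  refine isomorphic_distinguished _ hT₂ _
    (Triangle.isoMk _ _ e (Iso.refl _) (Iso.refl _) ?_ ?_ ?_)
  · exact Category.comp_id _
  · exact (Category.comp_id _).trans (Category.id_comp _).symm
  · change (c ≫ e.inv⟦(1 : ℤ)⟧') ≫ e.hom⟦(1 : ℤ)⟧' = 𝟙 _ ≫ c
    rw [Category.assoc, ← Functor.map_comp, e.inv_hom_id, CategoryTheory.Functor.map_id, Category.comp_id,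
      Category.id_comp]

instance heartAbelian [IsTriangulated D] : Abelian (HeartCat t) :=
  AbelianSubcategory.abelian t.heart.ι (heart_hom_shift_neg t) (heart_admissible t)

end Heart

section Serre
variable {A : Type*} [Category* A] [Abelian A]

/-- The Serre subcategory generated by a class of objects: the smallest Serre class
that contains it. -/
def serreHull (P : ObjectProperty A) : ObjectProperty A := fun X =>
  ∀ Q : ObjectProperty A, Q.IsSerreClass → P ≤ Q → Q X

instance serreHull_isSerreClass (P : ObjectProperty A) : (serreHull P).IsSerreClass where
  exists_zero := ⟨0, isZero_zero A, fun Q _ _ => Q.prop_zero⟩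
  prop_of_mono f _ h := fun Q hQ hP => Q.prop_of_mono f (h Q hQ hP)
  prop_of_epi f _ h := fun Q hQ hP => Q.prop_of_epi f (h Q hQ hP)
  prop_X₂_of_shortExact hS h₁ h₃ := fun Q hQ hP =>
    Q.prop_X₂_of_shortExact hS (h₁ Q hQ hP) (h₃ Q hQ hP)

instance serre_finiteProducts (Q : ObjectProperty A) [Q.IsSerreClass] :
    Q.IsClosedUnderFiniteProducts :=
  isClosedUnderFiniteProducts_of_biprod Q fun X Y hX hY =>
    Q.prop_X₂_of_shortExact (ShortComplex.Splitting.ofHasBinaryBiproduct X Y).shortExact hX hY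


/-- `HasFiltration P X`: the object `X` has a finite filtration `0 = X₀ ⊂ X₁ ⊂ ⋯ ⊂ Xₖ = X`
all of whose subquotients `Xᵢ / Xᵢ₋₁` satisfy `P`. -/
inductive HasFiltration (P : ObjectProperty A) : A → Prop
  | zero (X : A) (hX : IsZero X) : HasFiltration P X
  | step (K : ShortComplex A) (hK : K.ShortExact) (h₁ : HasFiltration P K.X₁) (h₃ : P K.X₃) :
      HasFiltration P K.X₂

end Serre

/-! ### Tate twists and quasi-exceptional sets -/

section Triang

variable {D : Type*} [Category* D] [Preadditive D] [HasZeroObject D] [HasShift D ℤ]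
  [∀ n : ℤ, (shiftFunctor D n).Additive] [Pretriangulated D]

/-- The smallest strictly full triangulated subcategory that contains a given class of
objects. -/
def triangHull (P : ObjectProperty D) : ObjectProperty D := fun X =>
  ∀ Q : ObjectProperty D, Q.IsTriangulated → Q.IsClosedUnderIsomorphisms → P ≤ Q → Q X

/-- A Tate twist on a `k`-linear triangulated category: a `k`-linear triangulated
autoequivalence `X ↦ X⟨1⟩` such that no nonzero object `X` is isomorphic to `X⟨n⟩`
with `n ≠ 0`. -/
structure TateTwist (k : Type*) [Field k] (D : Type*) [Category* D] [Preadditive D]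
    [HasZeroObject D] [HasShift D ℤ] [∀ n : ℤ, (shiftFunctor D n).Additive] [Pretriangulated D]
    [Linear k D] where
  /-- the autoequivalence `X ↦ X⟨1⟩` -/
  equiv : D ≌ D
  /-- compatibility of the twist with the shift -/
  commShift : equiv.functor.CommShift ℤ
  isTriangulated : equiv.functor.IsTriangulated
  linear : equiv.functor.Linear k
  faithful (X : D) (hX : ¬ IsZero X) (n : ℤ)
    (e : Nonempty (X ≅ (equiv ^ n).functor.obj X)) : n = 0

variable {k : Type*} [Field k] [Linear k D]

/-- The functor `X ↦ X⟨n⟩`. -/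
abbrev TateTwist.tw (T : TateTwist k D) (n : ℤ) : D ⥤ D := (T.equiv ^ n).functor

variable (T : TateTwist k D)

/-- `HomVanish T X Y i n` says that `Homⁱ(X, Y⟨n⟩) = 0`. The graded space of morphisms of
degree `i` from `X` to `Y` vanishes if this holds for all `n`. -/
def HomVanish (X Y : D) (i n : ℤ) : Prop :=
  ∀ f : X ⟶ ((T.tw n).obj Y)⟦i⟧, f = 0

variable {S : Type*} [PartialOrder S]

/-- The triangulated subcategory generated by the `∇ₜ⟨n⟩` with `t < s`. -/
def belowCat (nabla : S → D) (s : S) : ObjectProperty D :=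
  triangHull fun X => ∃ (u : S) (n : ℤ), u < s ∧ X = (T.tw n).obj (nabla u)

/-- Graded quasi-exceptional sets. -/
structure IsQuasiExceptional (nabla : S → D) : Prop where
  order (s u : S) (h : ¬ u ≤ s) (i n : ℤ) : HomVanish T (nabla s) (nabla u) i n
  self_neg (s : S) (i : ℤ) (hi : i < 0) (n : ℤ) : HomVanish T (nabla s) (nabla s) i n
  self_zero (s : S) : Module.finrank k (nabla s ⟶ nabla s) = 1
  self_zero_twist (s : S) (n : ℤ) (hn : n ≠ 0) : ∀ f : nabla s ⟶ (T.tw n).obj (nabla s), f = 0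
  mixed (s : S) (i : ℤ) (hi : 0 < i) (n : ℤ) (hn : 0 ≤ n) : HomVanish T (nabla s) (nabla s) i n
  generate : triangHull (fun X => ∃ (s : S) (n : ℤ), X = (T.tw n).obj (nabla s)) = ⊤

/-- A family `{∇ₛ}`, a second family `{Δₛ}`, and morphisms `ιₛ : Δₛ ⟶ ∇ₛ`. -/
structure DualPair (D : Type*) [Category* D] (S : Type*) where
  /-- the objects `∇ₛ` -/
  nabla : S → D
  /-- the objects `Δₛ` -/
  delta : S → D
  /-- the morphisms `ιₛ` -/
  iota (s : S) : delta s ⟶ nabla s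

/-- `{∇ₛ}` is dualizable, with dual set `{Δₛ}` and structure morphisms `ιₛ`. -/
structure IsDual (E : DualPair D S) : Prop where
  cone (s : S) : ∃ (C : D) (g : E.nabla s ⟶ C) (h : C ⟶ (E.delta s)⟦(1 : ℤ)⟧),
    Triangle.mk (E.iota s) g h ∈ distTriang D ∧ belowCat T E.nabla s C
  vanish (s u : S) (h : u < s) (i n : ℤ) : HomVanish T (E.delta s) (E.nabla u) i n

/-- The abelianesque condition. -/
structure IsAbelianesque (E : DualPair D S) : Prop where
  nabla (s u : S) (i : ℤ) (hi : i < 0) (n : ℤ) : HomVanish T (E.nabla s) (E.nabla u) i n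
  delta (s u : S) (i : ℤ) (hi : i < 0) (n : ℤ) : HomVanish T (E.delta s) (E.delta u) i n

/-! ### The t-structure of a quasi-exceptional set -/

/-- `t` is the t-structure of the quasi-exceptional set: `D^{≤ 0}` consists of the `X` with
`Hom(X, ∇ₛ⟨n⟩[d]) = 0` for all `s`, `n` and all `d < 0`, and `D^{≥ 0}` of the `X` with
`Hom(Δₛ⟨n⟩[d], X) = 0` for all `s`, `n` and all `d > 0`. -/
structure IsAssociated (E : DualPair D S) (t : TStructure D) : Prop where
  le_zero (X : D) : t.le 0 X ↔ ∀ (s : S) (n d : ℤ), d < 0 →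
    ∀ f : X ⟶ ((T.tw n).obj (E.nabla s))⟦d⟧, f = 0
  ge_zero (X : D) : t.ge 0 X ↔ ∀ (s : S) (n d : ℤ), 0 < d →
    ∀ f : ((T.tw n).obj (E.delta s))⟦d⟧ ⟶ X, f = 0

variable [IsTriangulated D] (E : DualPair D S) (t : TStructure D)

/-- `IsSigma T E t s n Z` says that `Z` is (a model of) the simple object `Σₛ⟨n⟩` of the heart,
the image of `ιₛ⟨n⟩ : Δₛ⟨n⟩ ⟶ ∇ₛ⟨n⟩`. -/
def IsSigma (s : S) (n : ℤ) : ObjectProperty (HeartCat t) := fun Z =>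
  ∃ (hd : t.heart ((T.tw n).obj (E.delta s))) (hn : t.heart ((T.tw n).obj (E.nabla s)))
    (p : (⟨_, hd⟩ : HeartCat t) ⟶ Z) (i : Z ⟶ (⟨_, hn⟩ : HeartCat t)),
    Epi p ∧ Mono i ∧ p.hom ≫ i.hom = (T.tw n).map (E.iota s)

/-- The Serre subcategory of the heart generated by the `Σₛ⟨n⟩` with `(s, n) ∈ Ξ`. -/
def serreXi (Xi : Set (S × ℤ)) : ObjectProperty (HeartCat t) :=
  serreHull fun Z => ∃ p ∈ Xi, IsSigma T E t p.1 p.2 Z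

instance serreXi_isSerreClass (Xi : Set (S × ℤ)) : (serreXi T E t Xi).IsSerreClass :=
  serreHull_isSerreClass _

/-- The Serre subcategory attached to `Ξ`, as a category. It is abelian. -/
abbrev SerreXiCat (Xi : Set (S × ℤ)) : Type _ := (serreXi T E t Xi).FullSubcategory

/-- The inclusion of the Serre subcategory attached to `Ξ` into `D`. -/
abbrev serreXiInclusion (Xi : Set (S × ℤ)) : SerreXiCat T E t Xi ⥤ D :=
  (serreXi T E t Xi).ι ⋙ t.heart.ι

/-- Convex subsets of `S × ℤ`. -/
structure IsConvex (Xi : Set (S × ℤ)) : Prop where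
  delta_mem (s : S) (n : ℤ) (h : (s, n) ∈ Xi) :
    ∃ hd : t.heart ((T.tw n).obj (E.delta s)), serreXi T E t Xi ⟨_, hd⟩
  nabla_mem (s : S) (n : ℤ) (h : (s, n) ∈ Xi) :
    ∃ hn : t.heart ((T.tw n).obj (E.nabla s)), serreXi T E t Xi ⟨_, hn⟩
  interval (s : S) : {n : ℤ | (s, n) ∈ Xi}.OrdConnected

/-- `s`-quasistandard objects: those filtered by objects `Δₛ⟨n⟩`. -/
def IsQuasistandard (s : S) : HeartCat t → Prop :=
  HasFiltration fun X => ∃ n : ℤ, Nonempty (X.obj ≅ (T.tw n).obj (E.delta s))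

/-- `s`-quasicostandard objects: those filtered by objects `∇ₛ⟨n⟩`. -/
def IsQuasicostandard (s : S) : HeartCat t → Prop :=
  HasFiltration fun X => ∃ n : ℤ, Nonempty (X.obj ≅ (T.tw n).obj (E.nabla s))

/-- The effaceability property. The subcategory in which `Y` lies is generated by the
`Σᵤ⟨n⟩` with `u ≤ s`. -/
structure IsEffaceable : Prop where
  standard (s : S) (hd : t.heart (E.delta s)) (X : HeartCat t) (hX : IsQuasistandard T E t s X)
    (d : ℤ) (h : 0 < d) (f : X.obj⟦-d⟧ ⟶ E.delta s) :
    ∃ (Y : HeartCat t) (g : (⟨_, hd⟩ : HeartCat t) ⟶ Y),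
      serreXi T E t {p | p.1 ≤ s} Y ∧ Mono g ∧ f ≫ g.hom = 0
  costandard (s : S) (hn : t.heart (E.nabla s)) (X : HeartCat t)
    (hX : IsQuasicostandard T E t s X) (d : ℤ) (h : 0 < d) (f : E.nabla s ⟶ X.obj⟦d⟧) :
    ∃ (Y : HeartCat t) (g : Y ⟶ (⟨_, hn⟩ : HeartCat t)),
      serreXi T E t {p | p.1 ≤ s} Y ∧ Epi g ∧ g.hom ≫ f = 0

end Triang

/-! ### Realization functors -/

section Realization

variable (B : Type*) [Category* B] [Abelian B] [HasDerivedCategory B]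

/-- The functor from an abelian category to its bounded derived category that sends an object
to the complex concentrated in degree `0`. -/
def singleBounded : B ⥤ DerivedCategory.Bounded B :=
  (DerivedCategory.TStructure.t (C := B)).bounded.lift (DerivedCategory.singleFunctor B 0)
    fun _ => ⟨⟨0, inferInstance⟩, ⟨0, inferInstance⟩⟩

variable {B} {D : Type*} [Category* D] [Preadditive D] [HasZeroObject D] [HasShift D ℤ]
  [∀ n : ℤ, (shiftFunctor D n).Additive] [Pretriangulated D]

/-- A realization functor for the inclusion `F : B ⥤ D` of an abelian subcategory in a
triangulated category: a triangulated functor from the bounded derived category of `B` to `D`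
whose restriction to `B` is `F`. When `F` is the inclusion of (a Serre subcategory of) the heart
of a t-structure, it is automatically t-exact. -/
structure RealizationFunctor (F : B ⥤ D) where
  /-- the underlying functor -/
  functor : DerivedCategory.Bounded B ⥤ D
  /-- compatibility with the shifts -/
  commShift : functor.CommShift ℤ
  isTriangulated : functor.IsTriangulated
  /-- the restriction to `B` is the inclusion -/
  restrictIso : singleBounded B ⋙ functor ≅ F

end Realization

end QuasiExc

end

set_option linter.unusedSectionVars false
set_option linter.unusedVariables false

noncomputable section

namespace QuasiExc

section Orth

variable {D : Type*} [Category* D] [Preadditive D] [HasZeroObject D] [HasShift D ℤ]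
  [∀ n : ℤ, (shiftFunctor D n).Additive]

/-- Every morphism from `X` to `Y` is zero. -/
def Orth (X Y : D) : Prop := ∀ f : X ⟶ Y, f = 0

theorem Orth.of_iso {X X' Y Y' : D} (h : Orth X Y) (e : X ≅ X') (e' : Y ≅ Y') : Orth X' Y' := by
  intro f
  rw [← cancel_epi e.hom, ← cancel_mono e'.inv, comp_zero, zero_comp]
  exact h _

theorem Orth.of_isZero_left {X Y : D} (h : IsZero X) : Orth X Y := fun _ => h.eq_of_src _ _

theorem Orth.of_isZero_right {X Y : D} (h : IsZero Y) : Orth X Y := fun _ => h.eq_of_tgt _ _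

theorem Orth.shift {X Y : D} (h : Orth X Y) (a : ℤ) : Orth (X⟦a⟧) (Y⟦a⟧) := by
  intro f
  obtain ⟨g, rfl⟩ := (shiftFunctor D a).map_surjective f
  rw [h g, Functor.map_zero]

/-- The canonical isomorphism `X⟦a⟧⟦b⟧ ≅ X⟦c⟧` when `a + b = c`. -/
def shiftAddIso (X : D) (a b c : ℤ) (h : a + b = c) : X⟦a⟧⟦b⟧ ≅ X⟦c⟧ :=
  ((shiftFunctorAdd' D a b c h).app X).symm

/-- The canonical isomorphism `X⟦0⟧ ≅ X`. -/
def shiftZeroIso (X : D) : X⟦(0 : ℤ)⟧ ≅ X := (shiftFunctorZero D ℤ).app X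

theorem Orth.shift_shift {X Y : D} {c : ℤ} (h : Orth X (Y⟦c⟧)) (a b : ℤ) (hc : c + a = b) :
    Orth (X⟦a⟧) (Y⟦b⟧) :=
  (h.shift a).of_iso (Iso.refl _) (shiftAddIso _ _ _ _ hc)

theorem Orth.shift_left {X Y : D} {c : ℤ} (h : Orth X (Y⟦c⟧)) (a : ℤ) (hc : c + a = 0) :
    Orth (X⟦a⟧) Y :=
  (h.shift_shift a 0 hc).of_iso (Iso.refl _) (shiftZeroIso _)

theorem Orth.shift_right {X Y : D} {c : ℤ} (h : Orth (X⟦c⟧) Y) (a : ℤ) (hc : c + a = 0) :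
    Orth X (Y⟦a⟧) :=
  (h.shift a).of_iso ((shiftAddIso _ _ _ _ hc).trans (shiftZeroIso _)) (Iso.refl _)

variable [Pretriangulated D]

/-! Forms of the basic facts on distinguished triangles in which the triangle is given by its
three morphisms. -/

section Tri

variable {A X B Y : D} {f : A ⟶ X} {g : X ⟶ B} {h : B ⟶ A⟦(1 : ℤ)⟧}

theorem tri_rot (hT : Triangle.mk f g h ∈ distTriang D) :
    Triangle.mk g h (-f⟦(1 : ℤ)⟧') ∈ distTriang D := rot_of_distTriang _ hT

theorem tri_desc (hT : Triangle.mk f g h ∈ distTriang D) (φ : X ⟶ Y) (hφ : f ≫ φ = 0) :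
    ∃ ψ : B ⟶ Y, φ = g ≫ ψ := Triangle.yoneda_exact₂ _ hT φ hφ

theorem tri_desc₃ (hT : Triangle.mk f g h ∈ distTriang D) (φ : B ⟶ Y) (hφ : g ≫ φ = 0) :
    ∃ ψ : A⟦(1 : ℤ)⟧ ⟶ Y, φ = h ≫ ψ := Triangle.yoneda_exact₃ _ hT φ hφ

theorem tri_lift (hT : Triangle.mk f g h ∈ distTriang D) (φ : Y ⟶ X) (hφ : φ ≫ g = 0) :
    ∃ ψ : Y ⟶ A, φ = ψ ≫ f := Triangle.coyoneda_exact₂ _ hT φ hφ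

theorem tri_lift₃ (hT : Triangle.mk f g h ∈ distTriang D) (φ : Y ⟶ B) (hφ : φ ≫ h = 0) :
    ∃ ψ : Y ⟶ X, φ = ψ ≫ g := Triangle.coyoneda_exact₃ _ hT φ hφ

theorem tri_lift₁ (hT : Triangle.mk f g h ∈ distTriang D) (φ : Y ⟶ A⟦(1 : ℤ)⟧)
    (hφ : φ ≫ f⟦(1 : ℤ)⟧' = 0) :
    ∃ ψ : Y ⟶ B, φ = ψ ≫ h := Triangle.coyoneda_exact₁ _ hT φ hφ

theorem tri_comp₁₂ (hT : Triangle.mk f g h ∈ distTriang D) : f ≫ g = 0 :=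
  comp_distTriang_mor_zero₁₂ _ hT

theorem tri_comp₂₃ (hT : Triangle.mk f g h ∈ distTriang D) : g ≫ h = 0 :=
  comp_distTriang_mor_zero₂₃ _ hT

theorem tri_comp₃₁ (hT : Triangle.mk f g h ∈ distTriang D) : h ≫ f⟦(1 : ℤ)⟧' = 0 :=
  comp_distTriang_mor_zero₃₁ _ hT

theorem tri_of_iso (hT : Triangle.mk f g h ∈ distTriang D) {A' X' B' : D} {f' : A' ⟶ X'}
    {g' : X' ⟶ B'} {h' : B' ⟶ A'⟦(1 : ℤ)⟧} (a : A' ≅ A) (x : X' ≅ X) (b : B' ≅ B)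
    (h₁ : f' ≫ x.hom = a.hom ≫ f) (h₂ : g' ≫ b.hom = x.hom ≫ g)
    (h₃ : h' ≫ a.hom⟦(1 : ℤ)⟧' = b.hom ≫ h) : Triangle.mk f' g' h' ∈ distTriang D :=
  isomorphic_distinguished _ hT _ (Triangle.isoMk _ _ a x b h₁ h₂ h₃)

theorem tri_iso₁ (hT : Triangle.mk f g h ∈ distTriang D) {A' : D} (e : A ≅ A') :
    Triangle.mk (e.inv ≫ f) g (h ≫ e.hom⟦(1 : ℤ)⟧') ∈ distTriang D :=
  tri_of_iso hT e.symm (Iso.refl _) (Iso.refl _) (by simp) (by simp)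
    (by simp [← Functor.map_comp])

theorem tri_iso₂ (hT : Triangle.mk f g h ∈ distTriang D) {X' : D} (e : X ≅ X') :
    Triangle.mk (f ≫ e.hom) (e.inv ≫ g) h ∈ distTriang D :=
  tri_of_iso hT (Iso.refl _) e.symm (Iso.refl _) (by simp) (by simp) (by simp)

theorem tri_iso₃ (hT : Triangle.mk f g h ∈ distTriang D) {B' : D} (e : B ≅ B') :
    Triangle.mk f (g ≫ e.hom) (e.inv ≫ h) ∈ distTriang D :=
  tri_of_iso hT (Iso.refl _) (Iso.refl _) e.symm (by simp) (by simp) (by simp)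

theorem tri_invRot (hT : Triangle.mk f g h ∈ distTriang D) :
    ∃ (u : B⟦(-1 : ℤ)⟧ ⟶ A) (v : X ⟶ B⟦(-1 : ℤ)⟧⟦(1 : ℤ)⟧),
      Triangle.mk u f v ∈ distTriang D :=
  ⟨_, _, inv_rot_of_distTriang _ hT⟩

theorem tri_shift (hT : Triangle.mk f g h ∈ distTriang D) (n : ℤ) :
    ∃ w : B⟦n⟧ ⟶ A⟦n⟧⟦(1 : ℤ)⟧, Triangle.mk (f⟦n⟧') (g⟦n⟧') w ∈ distTriang D := by
  have := Triangle.shift_distinguished _ hT n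
  have h' : ∃ w : B⟦n⟧ ⟶ A⟦n⟧⟦(1 : ℤ)⟧,
      Triangle.mk (n.negOnePow • f⟦n⟧') (n.negOnePow • g⟦n⟧') w ∈ distTriang D := ⟨_, this⟩
  obtain ⟨w, hw⟩ := h'
  refine ⟨w, tri_of_iso hw (Iso.refl _) (n.negOnePow • Iso.refl _) (Iso.refl _) ?_ ?_ ?_⟩
  · simp
  · simp [smul_smul]
  · simp

theorem Orth.ext_left (hT : Triangle.mk f g h ∈ distTriang D) (hA : Orth A Y) (hB : Orth B Y) :
    Orth X Y := by
  intro φ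
  obtain ⟨ψ, rfl⟩ := tri_desc hT φ (hA _)
  rw [hB ψ, comp_zero]

theorem Orth.ext_right (hT : Triangle.mk f g h ∈ distTriang D) (hA : Orth Y A) (hB : Orth Y B) :
    Orth Y X := by
  intro φ
  obtain ⟨ψ, rfl⟩ := tri_lift hT φ (hB _)
  rw [hA ψ, zero_comp]

end Tri

end Orth

section ExtW

variable {D : Type*} [Category* D] [Preadditive D] [HasZeroObject D] [HasShift D ℤ]
  [∀ n : ℤ, (shiftFunctor D n).Additive] [Pretriangulated D]

/-- The closure of a class of objects under extensions: the objects that are obtained from zero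
objects by finitely many extensions by objects of the class. -/
inductive ExtW (P : ObjectProperty D) : D → Prop
  | zero (X : D) (hX : IsZero X) : ExtW P X
  | step {A X B : D} (f : A ⟶ X) (g : X ⟶ B) (h : B ⟶ A⟦(1 : ℤ)⟧)
      (hT : Triangle.mk f g h ∈ distTriang D) (hA : ExtW P A) (hB : P B) : ExtW P X

/-- `ExtW P` as an object property. -/
abbrev extW (P : ObjectProperty D) : ObjectProperty D := ExtW P

local notation P " ∗ " Q => ObjectProperty.extensionProduct P Q

instance extW_closedUnderIso (P : ObjectProperty D) : (extW P).IsClosedUnderIsomorphisms where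
  of_iso := by
    intro X Y e hX
    induction hX with
    | zero X hX => exact .zero _ (hX.of_iso e.symm)
    | @step A X B f g h hT hA hB ih =>
      exact .step _ _ _ (tri_iso₂ hT e) hA hB

instance extW_containsZero (P : ObjectProperty D) : (extW P).ContainsZero where
  exists_zero := ⟨0, isZero_zero D, .zero _ (isZero_zero D)⟩

theorem le_extW (P : ObjectProperty D) : P ≤ extW P := fun X hX =>
  .step (A := 0) 0 (𝟙 X) 0 (contractible_distinguished₁ X) (.zero _ (isZero_zero D)) hX

theorem extensionProduct_le_extW (P : ObjectProperty D) : (extW P ∗ P) ≤ extW P := by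
  rintro X ⟨A, B, f, g, h, hT, hA, hB⟩
  exact .step f g h hT hA hB

theorem extensionProduct_mono {P P' Q Q' : ObjectProperty D} (h : P ≤ P') (h' : Q ≤ Q') :
    (P ∗ Q) ≤ (P' ∗ Q') :=
  (ObjectProperty.monotone_extensionProduct_left _ h).trans
    (ObjectProperty.monotone_extensionProduct_right _ h')

theorem extensionProduct_isZero_right {P : ObjectProperty D} [P.IsClosedUnderIsomorphisms]
    {A X B : D} {f : A ⟶ X} {g : X ⟶ B} {h : B ⟶ A⟦(1 : ℤ)⟧}
    (hT : Triangle.mk f g h ∈ distTriang D) (hA : P A) (hB : IsZero B) : P X := by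
  have : IsIso f := (Triangle.isZero₃_iff_isIso₁ _ hT).1 hB
  exact P.prop_of_iso (asIso f) hA

theorem extensionProduct_isZero_left {P : ObjectProperty D} [P.IsClosedUnderIsomorphisms]
    {A X B : D} {f : A ⟶ X} {g : X ⟶ B} {h : B ⟶ A⟦(1 : ℤ)⟧}
    (hT : Triangle.mk f g h ∈ distTriang D) (hB : P B) (hA : IsZero A) : P X := by
  have : IsIso g := (Triangle.isZero₁_iff_isIso₂ _ hT).1 hA
  exact P.prop_of_iso (asIso g).symm hB

theorem extW_extensionProduct [IsTriangulated D] (P : ObjectProperty D) :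
    (extW P ∗ extW P) ≤ extW P := by
  rintro X ⟨A, B, f, g, h, hT, hA, hB⟩
  induction hB generalizing X A with
  | zero B hB => exact extensionProduct_isZero_right (P := extW P) hT hA hB
  | @step B' B q u v w hT' hB' hq ih =>
    have : (extW P ∗ ((extW P ⊓ fun Y => Nonempty (Y ≅ B')) ∗ P)) X :=
      ⟨A, B, f, g, h, hT, hA, ⟨B', q, u, v, w, hT', ⟨hB', ⟨Iso.refl _⟩⟩, hq⟩⟩
    rw [← ObjectProperty.extensionProduct_assoc] at this
    obtain ⟨Y, q', a, b, c, hT₂, ⟨A₂, B₂, a', b', c', hT₃, hA₂, hB₂, ⟨e⟩⟩, hq'⟩ := this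
    refine .step a b c hT₂ ?_ hq'
    exact ih Y A₂ _ _ _ (tri_iso₃ hT₃ e) hA₂

instance extW_closed₂ [IsTriangulated D] (P : ObjectProperty D) :
    (extW P).IsTriangulatedClosed₂ :=
  .mk' fun T hT h₁ h₃ => extW_extensionProduct P _ ⟨_, _, _, _, _, hT, h₁, h₃⟩

theorem extW_le {P Q : ObjectProperty D} [Q.IsTriangulatedClosed₂] [Q.IsClosedUnderIsomorphisms]
    [Q.ContainsZero] (h : P ≤ Q) : extW P ≤ Q := by
  intro X hX
  induction hX with
  | zero X hX => exact Q.prop_of_isZero hX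
  | step f g k hT hA hB ih => exact Q.ext_of_isTriangulatedClosed₂ _ hT ih (h _ hB)

theorem extW_mono {P Q : ObjectProperty D} (h : P ≤ Q) : extW P ≤ extW Q := by
  intro X hX
  induction hX with
  | zero X hX => exact .zero _ hX
  | step f g k hT hA hB ih => exact .step f g k hT ih (h _ hB)

theorem extW_le_extW [IsTriangulated D] {P Q : ObjectProperty D} (h : P ≤ extW Q) :
    extW P ≤ extW Q := extW_le h

instance extW_shift (P : ObjectProperty D) [P.IsStableUnderShift ℤ] :
    (extW P).IsStableUnderShift ℤ where
  isStableUnderShiftBy a := ⟨fun X hX => by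
    change ExtW P (X⟦a⟧)
    induction hX with
    | zero X hX => exact .zero _ ((shiftFunctor D a).map_isZero hX)
    | step f g k hT hA hB ih =>
      exact .step _ _ _ (Triangle.shift_distinguished _ hT a) ih (P.le_shift a _ hB)⟩

instance extW_isTriangulated [IsTriangulated D] (P : ObjectProperty D) [P.IsStableUnderShift ℤ] :
    (extW P).IsTriangulated where

theorem tri_split {A X B : D} {f : A ⟶ X} {g : X ⟶ B}
    (hT : Triangle.mk f g 0 ∈ distTriang D) :
    ∃ (u : B ⟶ X) (v : X ⟶ A), Triangle.mk u v 0 ∈ distTriang D := by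
  obtain ⟨e, -, -⟩ := exists_iso_binaryBiproduct_of_distTriang _ hT rfl
  exact ⟨_, _, tri_iso₂ (binaryBiproductTriangle_distinguished B A)
    ((biprod.braiding B A).trans (show X ≅ A ⊞ B from e).symm)⟩

theorem extensionProduct_comm_of_orth {P Q : ObjectProperty D}
    (h : ∀ X Y, P X → Q Y → Orth X (Y⟦(1 : ℤ)⟧)) : (Q ∗ P) ≤ (P ∗ Q) := by
  rintro X ⟨A, B, f, g, k, hT, hA, hB⟩
  obtain rfl := h _ _ hB hA k
  obtain ⟨u, v, hT'⟩ := tri_split hT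
  exact ⟨_, _, _, _, _, hT', hB, hA⟩

theorem extW_extensionProduct_swap [IsTriangulated D] {P Q : ObjectProperty D} [P.ContainsZero]
    (h : (Q ∗ P) ≤ (P ∗ Q)) : (extW Q ∗ P) ≤ (P ∗ extW Q) := by
  rintro X ⟨A, B, f, g, k, hT, hA, hB⟩
  induction hA generalizing X B with
  | zero A hA =>
    have : IsIso g := (Triangle.isZero₁_iff_isIso₂ _ hT).1 hA
    exact ObjectProperty.prop_of_iso _ (asIso g).symm
      (ObjectProperty.le_extensionProduct_left _ _ hB)
  | @step A' A q u v w hT' hA' hq ih =>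
    have : (((extW Q ⊓ fun Y => Nonempty (Y ≅ A')) ∗ Q) ∗ P) X :=
      ⟨A, B, f, g, k, hT, ⟨A', q, u, v, w, hT', ⟨hA', ⟨Iso.refl _⟩⟩, hq⟩, hB⟩
    rw [ObjectProperty.extensionProduct_assoc] at this
    have := extensionProduct_mono le_rfl h _ this
    rw [← ObjectProperty.extensionProduct_assoc] at this
    have key : ((extW Q ⊓ fun Y => Nonempty (Y ≅ A')) ∗ P) ≤ (P ∗ extW Q) := by
      rintro Y ⟨A₂, B₂, a, b, c, hT₂, ⟨hA₂, ⟨e⟩⟩, hB₂⟩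
      exact ih Y B₂ _ _ _ (tri_iso₁ hT₂ e) hB₂
    have := extensionProduct_mono key (le_refl Q) _ this
    rw [ObjectProperty.extensionProduct_assoc] at this
    exact extensionProduct_mono le_rfl (extensionProduct_le_extW Q) _ this

/-- Sorting: if extensions of `P` by `Q` can be rewritten as extensions of `Q` by `P`, then
iterated extensions of objects of `P` and `Q` can be sorted. -/
theorem extW_sup_le [IsTriangulated D] {P Q : ObjectProperty D} [P.ContainsZero]
    (h : (Q ∗ P) ≤ (P ∗ Q)) : extW (P ⊔ Q) ≤ (extW P ∗ extW Q) := by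
  intro X hX
  induction hX with
  | zero X hX =>
    exact ObjectProperty.le_extensionProduct_left _ _ (.zero _ hX)
  | step f g k hT hA hB ih =>
    rcases hB with hB | hB
    · have : ((extW P ∗ extW Q) ∗ P) _ := ⟨_, _, f, g, k, hT, ih, hB⟩
      rw [ObjectProperty.extensionProduct_assoc] at this
      have := extensionProduct_mono le_rfl (extW_extensionProduct_swap h) _ this
      rw [← ObjectProperty.extensionProduct_assoc] at this
      exact extensionProduct_mono (extensionProduct_le_extW P) le_rfl _ this
    · have : ((extW P ∗ extW Q) ∗ Q) _ := ⟨_, _, f, g, k, hT, ih, hB⟩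
      rw [ObjectProperty.extensionProduct_assoc] at this
      exact extensionProduct_mono le_rfl (extensionProduct_le_extW Q) _ this

theorem ExtW.orth_left {P : ObjectProperty D} {X Y : D} (hX : ExtW P X)
    (h : ∀ A, P A → Orth A Y) : Orth X Y := by
  induction hX with
  | zero X hX => exact .of_isZero_left hX
  | step f g k hT hA hB ih => exact .ext_left hT ih (h _ hB)

theorem ExtW.orth_right {P : ObjectProperty D} {X Y : D} (hX : ExtW P X)
    (h : ∀ A, P A → Orth Y A) : Orth Y X := by
  induction hX with
  | zero X hX => exact .of_isZero_right hX
  | step f g k hT hA hB ih => exact .ext_right hT ih (h _ hB)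

/-- The class of zero objects together with the objects isomorphic to a member of a family. -/
def familyProp {ι : Type*} (X : ι → D) (I : Set ι) : ObjectProperty D := fun Y =>
  IsZero Y ∨ ∃ i ∈ I, Nonempty (Y ≅ X i)

instance familyProp_containsZero {ι : Type*} (X : ι → D) (I : Set ι) :
    (familyProp X I).ContainsZero where
  exists_zero := ⟨0, isZero_zero D, .inl (isZero_zero D)⟩

instance familyProp_iso {ι : Type*} (X : ι → D) (I : Set ι) :
    (familyProp X I).IsClosedUnderIsomorphisms where
  of_iso := by
    rintro Y Z e (h | ⟨i, hi, ⟨e'⟩⟩)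
    · exact .inl (h.of_iso e.symm)
    · exact .inr ⟨i, hi, ⟨e.symm.trans e'⟩⟩

theorem familyProp_mem {ι : Type*} (X : ι → D) {I : Set ι} {i : ι} (hi : i ∈ I) :
    familyProp X I (X i) := .inr ⟨i, hi, ⟨Iso.refl _⟩⟩

theorem familyProp_le {ι : Type*} {X : ι → D} {I : Set ι} {P : ObjectProperty D}
    [P.IsClosedUnderIsomorphisms] [P.ContainsZero] (h : ∀ i ∈ I, P (X i)) :
    familyProp X I ≤ P := by
  rintro Y (hY | ⟨i, hi, ⟨e⟩⟩)
  · exact P.prop_of_isZero hY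
  · exact P.prop_of_iso e.symm (h i hi)

theorem familyProp_mono {ι : Type*} (X : ι → D) {I J : Set ι} (h : I ⊆ J) :
    familyProp X I ≤ familyProp X J :=
  familyProp_le fun _ hi => familyProp_mem X (h hi)

theorem familyProp_union {ι : Type*} (X : ι → D) (I J : Set ι) :
    familyProp X (I ∪ J) ≤ familyProp X I ⊔ familyProp X J := by
  rintro Y (hY | ⟨i, hi | hi, e⟩)
  · exact .inl (.inl hY)
  · exact .inl (.inr ⟨i, hi, e⟩)
  · exact .inr (.inr ⟨i, hi, e⟩)

/-- Extensions of members of two families can be swapped when the connecting morphisms vanish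
or are isomorphisms. -/
theorem familyProp_swap {ι κ : Type*} {X : ι → D} {I : Set ι} {Y : κ → D} {J : Set κ}
    (h : ∀ i ∈ I, ∀ j ∈ J, ∀ f : X i ⟶ (Y j)⟦(1 : ℤ)⟧, f = 0 ∨ IsIso f) :
    (familyProp Y J ∗ familyProp X I) ≤ (familyProp X I ∗ familyProp Y J) := by
  rintro Z ⟨A, B, f, g, k, hT, hA, hB⟩
  suffices k = 0 ∨ IsIso k by
    rcases this with rfl | hk
    · obtain ⟨u, v, hT'⟩ := tri_split hT
      exact ⟨_, _, _, _, _, hT', hB, hA⟩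
    · exact ObjectProperty.le_extensionProduct_left _ _
        (.inl ((Triangle.isZero₂_iff_isIso₃ _ hT).2 hk))
  rcases hA with hA | ⟨j, hj, ⟨e⟩⟩
  · exact .inl (((shiftFunctor D (1 : ℤ)).map_isZero hA).eq_of_tgt _ _)
  rcases hB with hB | ⟨i, hi, ⟨e'⟩⟩
  · exact .inl (hB.eq_of_src _ _)
  rcases h i hi j hj (e'.inv ≫ k ≫ e.hom⟦1⟧') with h0 | h0
  · left
    rwa [← cancel_epi e'.inv, ← cancel_mono (e.hom⟦(1 : ℤ)⟧'), comp_zero, zero_comp,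
      Category.assoc]
  · right
    have : k = e'.hom ≫ (e'.inv ≫ k ≫ e.hom⟦1⟧') ≫ e.inv⟦(1 : ℤ)⟧' := by
      simp [← Functor.map_comp]
    rw [this]
    infer_instance

end ExtW

theorem isLowerSet_diff_maximal {S : Type*} [PartialOrder S] {F : Set S} (hF : IsLowerSet F)
    {s : S} (hs : ∀ u ∈ F, ¬ s < u) : IsLowerSet (F \ {s}) := by
  rintro a b hba ⟨ha, has⟩
  refine ⟨hF hba ha, fun hb => ?_⟩
  rcases hba.lt_or_eq with h | h
  · exact hs a ha (by rwa [← show b = s from hb])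
  · exact has (h ▸ hb)

theorem finite_lowerSet_induction {S : Type*} [PartialOrder S] {motive : Set S → Prop}
    (empty : motive ∅)
    (step : ∀ (F : Set S) (s : S), F.Finite → IsLowerSet F → s ∈ F → (∀ u ∈ F, ¬ s < u) →
      motive (F \ {s}) → motive F)
    (F : Set S) (hF : F.Finite) (hF' : IsLowerSet F) : motive F := by
  induction h : F.ncard generalizing F with
  | zero =>
    rw [Set.ncard_eq_zero hF] at h
    exact h ▸ empty
  | succ n ih =>
    have hne : F.Nonempty := (Set.ncard_pos hF).1 (by lia)
    obtain ⟨s, hs⟩ := hF.exists_maximal hne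
    have hmax : ∀ u ∈ F, ¬ s < u := fun u hu hlt => hlt.not_ge (hs.2 hu hlt.le)
    refine step F s hF hF' hs.1 hmax (ih _ (hF.subset Set.sdiff_subset)
      (isLowerSet_diff_maximal hF' hmax) ?_)
    · rw [Set.ncard_sdiff_singleton_of_mem hs.1, h]
      rfl

instance familyProp_shift {D : Type*} [Category* D] [Preadditive D] [HasZeroObject D]
    [HasShift D ℤ] [∀ n : ℤ, (shiftFunctor D n).Additive] {S : Type*} (X : S → ℤ → D)
    (F : Set S) : (familyProp (fun p : S × ℤ × ℤ => (X p.1 p.2.1)⟦p.2.2⟧)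
      {p | p.1 ∈ F}).IsStableUnderShift ℤ where
  isStableUnderShiftBy a := ⟨by
    rintro Y (hY | ⟨⟨s, n, i⟩, hp, ⟨e⟩⟩)
    · exact .inl ((shiftFunctor D a).map_isZero hY)
    · exact .inr ⟨⟨s, n, i + a⟩, hp,
        ⟨((shiftFunctor D a).mapIso e).trans (shiftAddIso _ _ _ _ rfl)⟩⟩⟩

section Std

variable (D : Type*) [Category* D] [Preadditive D] [HasZeroObject D] [HasShift D ℤ]
  [∀ n : ℤ, (shiftFunctor D n).Additive] [Pretriangulated D] (S : Type*) [PartialOrder S]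

/-- Two families `nab s n` and `del s n` of objects with the vanishing properties of the twists
`∇ₛ⟨n⟩` and `Δₛ⟨n⟩` of an abelianesque dualizable graded quasi-exceptional set. -/
structure StdSystem where
  /-- the costandard objects -/
  nab : S → ℤ → D
  /-- the standard objects -/
  del : S → ℤ → D
  /-- the comparison morphisms -/
  io (s : S) (n : ℤ) : del s n ⟶ nab s n
  finite_Iic (s : S) : (Set.Iic s).Finite
  order (s u : S) (h : ¬ u ≤ s) (n m i : ℤ) : Orth (nab s n) ((nab u m)⟦i⟧)
  nab_neg (s u : S) (n m i : ℤ) (hi : i < 0) : Orth (nab s n) ((nab u m)⟦i⟧)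
  del_neg (s u : S) (n m i : ℤ) (hi : i < 0) : Orth (del s n) ((del u m)⟦i⟧)
  nab_zero (s : S) (n m : ℤ) (h : n ≠ m) : Orth (nab s n) (nab s m)
  nab_isIso (s : S) (n : ℤ) (f : nab s n ⟶ nab s n) : f = 0 ∨ IsIso f
  nab_not_isZero (s : S) (n : ℤ) : ¬ IsZero (nab s n)
  mixed (s : S) (n m i : ℤ) (hi : 0 < i) (h : n ≤ m) : Orth (nab s n) ((nab s m)⟦i⟧)
  del_vanish (s u : S) (h : u < s) (n m i : ℤ) : Orth (del s n) ((nab u m)⟦i⟧)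
  cone (s : S) (n : ℤ) : ∃ (C : D) (g : nab s n ⟶ C) (h : C ⟶ (del s n)⟦(1 : ℤ)⟧),
    Triangle.mk (io s n) g h ∈ distTriang D ∧
    ExtW (familyProp (fun p : S × ℤ × ℤ => (nab p.1 p.2.1)⟦p.2.2⟧) {p | p.1 < s}) C
  generate (X : D) :
    ExtW (familyProp (fun p : S × ℤ × ℤ => (nab p.1 p.2.1)⟦p.2.2⟧) Set.univ) X

variable {D S} (W : StdSystem D S)

namespace StdSystem

local notation P " ∗ " Q => ObjectProperty.extensionProduct P Q

/-- The shifts of the costandard objects. -/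
def nabF (p : S × ℤ × ℤ) : D := (W.nab p.1 p.2.1)⟦p.2.2⟧

/-- The triangulated subcategory generated by the costandard objects indexed by `F`. -/
abbrev DF (F : Set S) : ObjectProperty D := extW (familyProp W.nabF {p | p.1 ∈ F})

instance nabF_shift (F : Set S) : (familyProp W.nabF {p | p.1 ∈ F}).IsStableUnderShift ℤ :=
  familyProp_shift W.nab F

theorem nab_mem_DF {F : Set S} {s : S} (hs : s ∈ F) (n i : ℤ) : W.DF F ((W.nab s n)⟦i⟧) :=
  le_extW _ _ (.inr ⟨⟨s, n, i⟩, hs, ⟨Iso.refl _⟩⟩)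

theorem nab_mem_DF' {F : Set S} {s : S} (hs : s ∈ F) (n : ℤ) : W.DF F (W.nab s n) :=
  (W.DF F).prop_of_iso (shiftZeroIso _) (W.nab_mem_DF hs n 0)

theorem DF_mono {F G : Set S} (h : F ⊆ G) : W.DF F ≤ W.DF G :=
  extW_mono (familyProp_mono _ fun _ hp => h hp)

theorem orth_nab {s u : S} (h : ¬ u ≤ s) (n m i j : ℤ) :
    Orth ((W.nab s n)⟦i⟧) ((W.nab u m)⟦j⟧) :=
  (W.order s u h n m (j - i)).shift_shift _ _ (by lia)

theorem DF_orth_nab {F : Set S} {X : D} (hX : W.DF F X) {s : S} (hs : ∀ u ∈ F, ¬ s ≤ u)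
    (n j : ℤ) : Orth X ((W.nab s n)⟦j⟧) := by
  refine hX.orth_left ?_
  rintro A (hA | ⟨⟨u, m, i⟩, hp, ⟨e⟩⟩)
  · exact .of_isZero_left hA
  · exact (W.orth_nab (hs u hp) _ _ _ _).of_iso e.symm (Iso.refl _)

theorem exists_cone (s : S) (n : ℤ) : ∃ (C : D) (g : W.nab s n ⟶ C)
    (h : C ⟶ (W.del s n)⟦(1 : ℤ)⟧), Triangle.mk (W.io s n) g h ∈ distTriang D ∧
      W.DF (Set.Iio s) C := W.cone s n

theorem orth_del_nab {s u : S} (h : s ≠ u) (n m i : ℤ) :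
    Orth (W.del s n) ((W.nab u m)⟦i⟧) := by
  by_cases hus : u < s
  · exact W.del_vanish s u hus n m i
  · have hus' : ¬ u ≤ s := fun hle => hus (lt_of_le_of_ne hle (Ne.symm h))
    obtain ⟨C, g, k, hT, hC⟩ := W.exists_cone s n
    obtain ⟨a, b, hT'⟩ := tri_invRot hT
    refine Orth.ext_left hT' ?_ (W.order s u hus' n m i)
    exact (W.DF_orth_nab hC (fun v hv huv => hus' (huv.trans (le_of_lt hv))) m (i + 1)).shift_shift
      _ _ (by lia)

theorem del_orth_DF {F : Set S} {X : D} (hX : W.DF F X) {s : S} (hs : s ∉ F) (n i : ℤ) :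
    Orth ((W.del s n)⟦i⟧) X := by
  refine hX.orth_right ?_
  rintro A (hA | ⟨⟨u, m, j⟩, hp, ⟨e⟩⟩)
  · exact .of_isZero_right hA
  · refine Orth.of_iso ?_ (Iso.refl _) e.symm
    exact (W.orth_del_nab (fun h : s = u => hs (h ▸ hp)) n m (j - i)).shift_shift _ _ (by lia)

theorem del_orth_DF' {F : Set S} {X : D} (hX : W.DF F X) {s : S} (hs : s ∉ F) (n : ℤ) :
    Orth (W.del s n) X := (W.del_orth_DF hX hs n 0).of_iso (shiftZeroIso _) (Iso.refl _)

/-- Morphisms `del s n ⟶ nab s m⟦i⟧` factor through `io`. -/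
theorem io_fac (s : S) (n m i : ℤ) (f : W.del s n ⟶ (W.nab s m)⟦i⟧) :
    ∃ f' : W.nab s n ⟶ (W.nab s m)⟦i⟧, f = W.io s n ≫ f' := by
  obtain ⟨C, g, k, hT, hC⟩ := W.exists_cone s n
  obtain ⟨a, b, hT'⟩ := tri_invRot hT
  refine tri_desc hT' f ?_
  exact (W.DF_orth_nab hC (fun v hv => not_le_of_gt hv) m (i + 1)).shift_shift _ _ (by lia) _

theorem orth_del_nab_of_orth {s : S} {n m i : ℤ} (h : Orth (W.nab s n) ((W.nab s m)⟦i⟧)) :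
    Orth (W.del s n) ((W.nab s m)⟦i⟧) := by
  intro f
  obtain ⟨f', rfl⟩ := W.io_fac s n m i f
  rw [h f', comp_zero]

theorem orth_del_nab_neg (s u : S) (n m i : ℤ) (hi : i < 0) :
    Orth (W.del s n) ((W.nab u m)⟦i⟧) := by
  by_cases h : s = u
  · subst h
    exact W.orth_del_nab_of_orth (W.nab_neg _ _ _ _ _ hi)
  · exact W.orth_del_nab h _ _ _

theorem nab_hom_shift (s : S) (n m i j : ℤ) (hij : j + 1 ≤ i)
    (f : (W.nab s n)⟦i⟧ ⟶ ((W.nab s m)⟦j⟧)⟦(1 : ℤ)⟧) : f = 0 ∨ IsIso f := by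
  rcases hij.lt_or_eq with h | h
  · left
    exact ((W.nab_neg s s n m (j + 1 - i) (by lia)).shift_shift i (j + 1) (by lia)).of_iso
      (Iso.refl _) (shiftAddIso _ _ _ _ rfl).symm f
  · by_cases hnm : n = m
    · subst hnm
      obtain ⟨g, hg⟩ := (shiftFunctor D i).map_surjective
        (f ≫ (shiftAddIso (W.nab s n) _ _ _ h).hom)
      have hf : f = (shiftFunctor D i).map g ≫ (shiftAddIso (W.nab s n) _ _ _ h).inv := by
        rw [hg]; simp
      rw [hf]
      rcases W.nab_isIso s n g with rfl | hg
      · left; simp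
      · right; infer_instance
    · left
      exact ((W.nab_zero s n m hnm).shift i).of_iso (Iso.refl _) (shiftAddIso _ _ _ _ h).symm f

variable [IsTriangulated D]

/-- Shifts of the costandard objects of index `s`. -/
def nabS (s : S) (p : ℤ × ℤ) : D := (W.nab s p.1)⟦p.2⟧

/-- Shifts of the standard objects of index `s`. -/
def delS (s : S) (p : ℤ × ℤ) : D := (W.del s p.1)⟦p.2⟧

/-- Shifts of the standard objects. -/
def delF (p : S × ℤ × ℤ) : D := (W.del p.1 p.2.1)⟦p.2.2⟧

section Step

variable {F : Set S} {s : S}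

theorem DF_swap_nabS (hs : ∀ u ∈ F, ¬ s ≤ u) (I : Set (ℤ × ℤ)) :
    (familyProp (W.nabS s) I ∗ W.DF F) ≤ (W.DF F ∗ familyProp (W.nabS s) I) := by
  refine extensionProduct_comm_of_orth fun X Y hX hY => ?_
  rcases hY with hY | ⟨p, hp, ⟨e⟩⟩
  · exact .of_isZero_right ((shiftFunctor D (1 : ℤ)).map_isZero hY)
  · refine (W.DF_orth_nab hX hs p.1 (p.2 + 1)).of_iso (Iso.refl _) ?_
    exact (shiftAddIso _ _ _ _ rfl).symm.trans ((shiftFunctor D (1 : ℤ)).mapIso e.symm)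

theorem DF_swap_delS (hs : s ∉ F) (I : Set (ℤ × ℤ)) :
    (W.DF F ∗ familyProp (W.delS s) I) ≤ (familyProp (W.delS s) I ∗ W.DF F) := by
  refine extensionProduct_comm_of_orth fun X Y hX hY => ?_
  rcases hX with hX | ⟨p, hp, ⟨e⟩⟩
  · exact .of_isZero_left hX
  · exact (W.del_orth_DF ((W.DF F).le_shift 1 _ hY) hs p.1 p.2).of_iso e.symm (Iso.refl _)

/-- Iterated extensions of objects of `DF F` and of costandard objects of index `s` can be
sorted. -/
theorem extW_DF_nabS (hs : ∀ u ∈ F, ¬ s ≤ u) (I : Set (ℤ × ℤ)) :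
    extW (W.DF F ⊔ familyProp (W.nabS s) I) ≤ (W.DF F ∗ extW (familyProp (W.nabS s) I)) :=
  (extW_sup_le (W.DF_swap_nabS hs I)).trans (extensionProduct_mono (extW_le le_rfl) le_rfl)

theorem extW_DF_delS (hs : s ∉ F) (I : Set (ℤ × ℤ)) :
    extW (familyProp (W.delS s) I ⊔ W.DF F) ≤ (extW (familyProp (W.delS s) I) ∗ W.DF F) :=
  (extW_sup_le (W.DF_swap_delS hs I)).trans (extensionProduct_mono le_rfl (extW_le le_rfl))

theorem nabS_le (hF : Set.Iio s ⊆ F) (I : Set (ℤ × ℤ)) :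
    familyProp (W.nabS s) I ≤ (familyProp (W.delS s) I ∗ W.DF F) := by
  rintro X (hX | ⟨p, hp, ⟨e⟩⟩)
  · exact ObjectProperty.le_extensionProduct_left _ _ (.inl hX)
  · refine ObjectProperty.prop_of_iso _ e.symm ?_
    obtain ⟨C, g, k, hT, hC⟩ := W.exists_cone s p.1
    obtain ⟨w, hT'⟩ := tri_shift hT p.2
    exact ⟨_, _, _, _, _, hT', familyProp_mem (W.delS s) hp,
      W.DF_mono hF _ ((W.DF _).le_shift p.2 _ hC)⟩

theorem delS_le (hF : Set.Iio s ⊆ F) (I : Set (ℤ × ℤ)) :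
    familyProp (W.delS s) I ≤ (W.DF F ∗ familyProp (W.nabS s) I) := by
  rintro X (hX | ⟨p, hp, ⟨e⟩⟩)
  · exact ObjectProperty.le_extensionProduct_right _ _ (.inl hX)
  · refine ObjectProperty.prop_of_iso _ e.symm ?_
    obtain ⟨C, g, k, hT, hC⟩ := W.exists_cone s p.1
    obtain ⟨a, b, hT₁⟩ := tri_invRot hT
    obtain ⟨w, hT'⟩ := tri_shift hT₁ p.2
    exact ⟨_, _, _, _, _, hT',
      W.DF_mono hF _ ((W.DF _).le_shift p.2 _ ((W.DF _).le_shift (-1) _ hC)),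
      familyProp_mem (W.nabS s) hp⟩

end Step

theorem sup_le_extW (P Q : ObjectProperty D) : (extW P ∗ extW Q) ≤ extW (P ⊔ Q) :=
  (extensionProduct_mono (extW_mono le_sup_left) (extW_mono le_sup_right)).trans
    (extW_extensionProduct _)

theorem extensionProduct_le_extW_sup (P Q : ObjectProperty D) : (P ∗ Q) ≤ extW (P ⊔ Q) :=
  (extensionProduct_mono (le_extW _) (le_extW _)).trans (sup_le_extW P Q)

theorem DF_le_sup {F : Set S} (s : S) :
    W.DF F ≤ extW (W.DF (F \ {s}) ⊔ familyProp (W.nabS s) Set.univ) := by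
  refine extW_mono ?_
  rintro X (hX | ⟨⟨u, n, i⟩, hp, ⟨e⟩⟩)
  · exact .inr (.inl hX)
  · by_cases h : u = s
    · subst h
      exact .inr (.inr ⟨⟨n, i⟩, trivial, ⟨e⟩⟩)
    · exact .inl (le_extW _ _ (.inr ⟨⟨u, n, i⟩, ⟨hp, h⟩, ⟨e⟩⟩))

theorem Iio_subset_diff {F : Set S} (hF : IsLowerSet F) {s : S} (hs : s ∈ F) :
    Set.Iio s ⊆ F \ {s} := fun u hu => ⟨hF (le_of_lt hu) hs, ne_of_lt hu⟩

theorem not_le_of_maximal {F : Set S} {s : S} (hs : ∀ u ∈ F, ¬ s < u) :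
    ∀ u ∈ F \ {s}, ¬ s ≤ u := fun u hu hle =>
  hs u hu.1 (lt_of_le_of_ne hle fun h => hu.2 h.symm)

theorem del_mem_DF {F : Set S} (hF : IsLowerSet F) {s : S} (hs : s ∈ F) (n i : ℤ) :
    W.DF F ((W.del s n)⟦i⟧) := by
  obtain ⟨A, B, f, g, h, hT, hA, hB⟩ := W.delS_le (le_refl (Set.Iio s)) Set.univ _
    (familyProp_mem (W.delS s) (Set.mem_univ (n, i)))
  refine (W.DF F).ext_of_isTriangulatedClosed₂ _ hT (W.DF_mono (fun u hu => ?_) _ hA) ?_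
  · exact hF (le_of_lt hu) hs
  · exact familyProp_le (P := W.DF F) (fun p _ => W.nab_mem_DF hs p.1 p.2) _ hB

/-- Nonnegative shifts of standard objects of index in `F`, closed under extensions. -/
abbrev lePart (F : Set S) : ObjectProperty D :=
  extW (familyProp W.delF {p | p.1 ∈ F ∧ 0 ≤ p.2.2})

/-- Negative shifts of costandard objects of index in `F`, closed under extensions. -/
abbrev gePart (F : Set S) : ObjectProperty D :=
  extW (familyProp W.nabF {p | p.1 ∈ F ∧ p.2.2 < 0})

theorem gePart_le_DF (F : Set S) : W.gePart F ≤ W.DF F :=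
  extW_mono (familyProp_mono _ fun _ hp => hp.1)

theorem lePart_le_DF {F : Set S} (hF : IsLowerSet F) : W.lePart F ≤ W.DF F :=
  extW_le (familyProp_le fun p hp => W.del_mem_DF hF hp.1 p.2.1 p.2.2)

theorem DF_step {F : Set S} {s : S} (hF : IsLowerSet F) (hs : s ∈ F) (hmax : ∀ u ∈ F, ¬ s < u) :
    W.DF F ≤ (extW (familyProp (W.delS s) {p | 0 ≤ p.2}) ∗
      (W.DF (F \ {s}) ∗ extW (familyProp (W.nabS s) {p | p.2 < 0}))) := by
  have h₁ : W.DF F ≤ (W.DF (F \ {s}) ∗ extW (familyProp (W.nabS s) Set.univ)) :=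
    (W.DF_le_sup s).trans (W.extW_DF_nabS (not_le_of_maximal hmax) _)
  have h₂ : extW (familyProp (W.nabS s) Set.univ) ≤
      (extW (familyProp (W.nabS s) {p | 0 ≤ p.2}) ∗
        extW (familyProp (W.nabS s) {p | p.2 < 0})) := by
    refine (extW_mono ?_).trans (extW_sup_le (familyProp_swap ?_))
    · refine (familyProp_mono _ ?_).trans (familyProp_union _ _ _)
      intro p _
      exact (le_or_gt 0 p.2)
    · intro p hp q hq f
      exact W.nab_hom_shift s p.1 q.1 p.2 q.2 (by
        have h₁ : 0 ≤ p.2 := hp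
        have h₂ : q.2 < 0 := hq
        lia) f
  have h₃ : (W.DF (F \ {s}) ∗ extW (familyProp (W.nabS s) {p | 0 ≤ p.2})) ≤
      (extW (familyProp (W.delS s) {p | 0 ≤ p.2}) ∗ W.DF (F \ {s})) := by
    refine le_trans ?_ (W.extW_DF_delS (fun h => h.2 rfl) _)
    refine le_trans (extensionProduct_mono ((le_extW _).trans (extW_mono le_sup_right)) ?_)
      (extW_extensionProduct _)
    exact extW_le_extW ((W.nabS_le (Iio_subset_diff hF hs) _).trans
      (extensionProduct_le_extW_sup _ _))
  refine h₁.trans ((extensionProduct_mono le_rfl h₂).trans ?_)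
  rw [← ObjectProperty.extensionProduct_assoc, ← ObjectProperty.extensionProduct_assoc]
  exact extensionProduct_mono h₃ le_rfl

theorem DF_le_trunc (F : Set S) (hF : F.Finite) (hF' : IsLowerSet F) :
    W.DF F ≤ (W.lePart F ∗ W.gePart F) := by
  refine finite_lowerSet_induction (motive := fun F => W.DF F ≤ (W.lePart F ∗ W.gePart F))
    ?_ ?_ F hF hF'
  · intro X hX
    have : IsZero X := by
      rw [IsZero.iff_id_eq_zero]
      refine ExtW.orth_left hX ?_ _
      rintro A (hA | ⟨p, hp, -⟩)
      · exact .of_isZero_left hA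
      · exact hp.elim
    exact ObjectProperty.le_extensionProduct_left _ _ (.zero _ this)
  · intro F s hF hF' hs hmax ih
    have h₁ : extW (familyProp (W.delS s) {p | 0 ≤ p.2}) ≤ W.lePart F :=
      extW_mono (familyProp_le fun p hp => .inr ⟨⟨s, p⟩, ⟨hs, hp⟩, ⟨Iso.refl _⟩⟩)
    have h₂ : extW (familyProp (W.nabS s) {p | p.2 < 0}) ≤ W.gePart F :=
      extW_mono (familyProp_le fun p hp => .inr ⟨⟨s, p⟩, ⟨hs, hp⟩, ⟨Iso.refl _⟩⟩)
    have h₃ : W.lePart (F \ {s}) ≤ W.lePart F :=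
      extW_mono (familyProp_mono _ fun p hp => ⟨hp.1.1, hp.2⟩)
    have h₄ : W.gePart (F \ {s}) ≤ W.gePart F :=
      extW_mono (familyProp_mono _ fun p hp => ⟨hp.1.1, hp.2⟩)
    refine (W.DF_step hF' hs hmax).trans
      ((extensionProduct_mono h₁ (extensionProduct_mono (ih.trans
        (extensionProduct_mono h₃ h₄)) h₂)).trans ?_)
    rw [ObjectProperty.extensionProduct_assoc, ← ObjectProperty.extensionProduct_assoc]
    exact extensionProduct_mono (extW_extensionProduct _) (extW_extensionProduct _)

theorem exists_finite_DF (X : D) : ∃ F : Set S, F.Finite ∧ IsLowerSet F ∧ W.DF F X := by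
  have hX := W.generate X
  induction hX with
  | zero X hX => exact ⟨∅, Set.finite_empty, isLowerSet_empty, .zero _ hX⟩
  | step f g h hT hA hB ih =>
    obtain ⟨F, hF, hF', hA'⟩ := ih
    rcases hB with hB | ⟨p, -, ⟨e⟩⟩
    · exact ⟨F, hF, hF', extensionProduct_isZero_right (P := W.DF F) hT hA' hB⟩
    · refine ⟨F ∪ Set.Iic p.1, hF.union (W.finite_Iic _), hF'.union (isLowerSet_Iic _), ?_⟩
      refine (W.DF _).ext_of_isTriangulatedClosed₂ _ hT
        (W.DF_mono Set.subset_union_left _ hA') ?_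
      exact (W.DF _).prop_of_iso e.symm
        (W.nab_mem_DF (F := F ∪ Set.Iic p.1) (.inr le_rfl) p.2.1 p.2.2)

theorem lePart_orth_nab {F : Set S} {X : D} (hX : W.lePart F X) (s : S) (n d : ℤ) (hd : d < 0) :
    Orth X ((W.nab s n)⟦d⟧) := by
  refine ExtW.orth_left hX ?_
  rintro A (hA | ⟨⟨u, m, i⟩, ⟨-, hp⟩, ⟨e⟩⟩)
  · exact .of_isZero_left hA
  · change 0 ≤ i at hp
    exact ((W.orth_del_nab_neg u s m n (d - i) (by lia)).shift_shift i d (by lia)).of_iso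
      e.symm (Iso.refl _)

theorem del_orth_gePart {F : Set S} {X : D} (hX : W.gePart F X) (s : S) (n d : ℤ) (hd : 0 ≤ d) :
    Orth ((W.del s n)⟦d⟧) X := by
  refine ExtW.orth_right hX ?_
  rintro A (hA | ⟨⟨u, m, i⟩, ⟨-, hp⟩, ⟨e⟩⟩)
  · exact .of_isZero_right hA
  · change i < 0 at hp
    exact ((W.orth_del_nab_neg s u n m (i - d) (by lia)).shift_shift d i (by lia)).of_iso
      (Iso.refl _) e.symm

/-- The t-structure attached to the system. -/
def tStructure : TStructure D where
  le n := fun X => ∀ (s : S) (m d : ℤ), d < -n → Orth X ((W.nab s m)⟦d⟧)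
  ge n := fun X => ∀ (s : S) (m d : ℤ), -n < d → Orth ((W.del s m)⟦d⟧) X
  le_isClosedUnderIsomorphisms n := ⟨fun e h s m d hd => (h s m d hd).of_iso e (Iso.refl _)⟩
  ge_isClosedUnderIsomorphisms n := ⟨fun e h s m d hd => (h s m d hd).of_iso (Iso.refl _) e⟩
  le_shift n a n' h X hX := fun s m d hd =>
    (hX s m (d - a) (by lia)).shift_shift _ _ (by lia)
  ge_shift n a n' h X hX := fun s m d hd =>
    (hX s m (d - a) (by lia)).shift a |>.of_iso (shiftAddIso _ _ _ _ (by lia)) (Iso.refl _)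
  zero' X Y f hX hY := by
    obtain ⟨F, hF, hF', hYF⟩ := W.exists_finite_DF Y
    obtain ⟨A, B, u, v, w, hT, hA, hB⟩ := W.DF_le_trunc F hF hF' Y hYF
    have hu : u = 0 := by
      refine ExtW.orth_left hA ?_ u
      rintro A (hA | ⟨⟨s, m, i⟩, ⟨-, hp⟩, ⟨e⟩⟩)
      · exact .of_isZero_left hA
      · change 0 ≤ i at hp
        exact (hY s m i (by lia)).of_iso e.symm (Iso.refl _)
    have hfv : f ≫ v = 0 := by
      refine ExtW.orth_right hB ?_ _
      rintro A (hA | ⟨⟨s, m, i⟩, ⟨-, hp⟩, ⟨e⟩⟩)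
      · exact .of_isZero_right hA
      · change i < 0 at hp
        exact (hX s m i (by lia)).of_iso (Iso.refl _) e.symm
    obtain ⟨g, rfl⟩ := tri_lift hT f hfv
    rw [hu, comp_zero]
  le_zero_le := fun X hX s m d hd => hX s m d (by lia)
  ge_one_le := fun X hX s m d hd => hX s m d (by lia)
  exists_triangle_zero_one X := by
    obtain ⟨F, hF, hF', hXF⟩ := W.exists_finite_DF X
    obtain ⟨A, B, u, v, w, hT, hA, hB⟩ := W.DF_le_trunc F hF hF' X hXF
    exact ⟨A, B, fun s m d hd => W.lePart_orth_nab hA s m d (by lia),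
      fun s m d hd => W.del_orth_gePart hB s m d (by lia), u, v, w, hT⟩

end StdSystem

end Std

section HeartTri

variable {D : Type*} [Category* D] [Preadditive D] [HasZeroObject D] [HasShift D ℤ]
  [∀ n : ℤ, (shiftFunctor D n).Additive] [Pretriangulated D] [IsTriangulated D]
  (t : TStructure D)

variable {t}

theorem heart_exists_tri_of_epi {X B : HeartCat t} (g : X ⟶ B) [Epi g] :
    ∃ (A : HeartCat t) (f : A ⟶ X) (δ : B.obj ⟶ A.obj⟦(1 : ℤ)⟧),
      Triangle.mk f.hom g.hom δ ∈ distTriang D :=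
  AbelianSubcategory.exists_distinguished_triangle_of_epi (heart_hom_shift_neg t)
    (heart_admissible t) g

theorem heart_shortExact_of_tri {A X B : HeartCat t} {f : A ⟶ X} {g : X ⟶ B}
    {δ : B.obj ⟶ A.obj⟦(1 : ℤ)⟧} (hT : Triangle.mk f.hom g.hom δ ∈ distTriang D) :
    ∃ w : f ≫ g = 0, (ShortComplex.mk f g w).ShortExact := by
  have w : f ≫ g = 0 := ObjectProperty.hom_ext _ (tri_comp₁₂ hT)
  have hk := AbelianSubcategory.isLimitKernelForkOfDistTriang (ι := t.heart.ι)
    (heart_hom_shift_neg t) f g δ hT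
  have hc := AbelianSubcategory.isColimitCokernelCoforkOfDistTriang (ι := t.heart.ι)
    (heart_hom_shift_neg t) f g δ hT
  exact ⟨w,
    { exact := ShortComplex.exact_of_f_is_kernel (.mk f g w) hk
      mono_f := mono_of_isLimit_fork hk
      epi_g := epi_of_isColimit_cofork hc }⟩

theorem heart_tri_of_shortExact {K : ShortComplex (HeartCat t)} (hK : K.ShortExact) :
    ∃ δ : K.X₃.obj ⟶ K.X₁.obj⟦(1 : ℤ)⟧, Triangle.mk K.f.hom K.g.hom δ ∈ distTriang D := by
  have := hK.epi_g
  have := hK.mono_f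
  obtain ⟨A, f, δ, hT⟩ := heart_exists_tri_of_epi K.g
  obtain ⟨w, hw⟩ := heart_shortExact_of_tri hT
  have := hw.mono_f
  let a : K.X₁ ⟶ A := hw.exact.lift K.f K.zero
  let b : A ⟶ K.X₁ := hK.exact.lift f w
  have ha : a ≫ f = K.f := hw.exact.lift_f _ _
  have hb : b ≫ K.f = f := hK.exact.lift_f _ _
  let e : A ≅ K.X₁ := ⟨b, a, by
      rw [← cancel_mono f, Category.assoc, ha, hb, Category.id_comp], by
      rw [← cancel_mono K.f, Category.assoc, hb, ha, Category.id_comp]⟩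
  have := tri_iso₁ hT (t.heart.ι.mapIso e)
  have he : (t.heart.ι.mapIso e).inv ≫ f.hom = K.f.hom := by
    change (a ≫ f).hom = _
    rw [ha]
  rw [he] at this
  exact ⟨_, this⟩

theorem heart_exists_tri_of_mono {A X : HeartCat t} (f : A ⟶ X) [Mono f] :
    ∃ (B : HeartCat t) (g : X ⟶ B) (δ : B.obj ⟶ A.obj⟦(1 : ℤ)⟧),
      Triangle.mk f.hom g.hom δ ∈ distTriang D := by
  have hK : (ShortComplex.mk f (cokernel.π f) (cokernel.condition f)).ShortExact :=
    { exact := ShortComplex.exact_cokernel f }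
  obtain ⟨δ, hT⟩ := heart_tri_of_shortExact hK
  exact ⟨_, _, _, hT⟩

theorem heart_epi_of_tri {A X B : HeartCat t} {f : A ⟶ X} {g : X ⟶ B}
    {δ : B.obj ⟶ A.obj⟦(1 : ℤ)⟧} (hT : Triangle.mk f.hom g.hom δ ∈ distTriang D) : Epi g :=
  (heart_shortExact_of_tri hT).choose_spec.epi_g

theorem heart_mono_of_tri {A X B : HeartCat t} {f : A ⟶ X} {g : X ⟶ B}
    {δ : B.obj ⟶ A.obj⟦(1 : ℤ)⟧} (hT : Triangle.mk f.hom g.hom δ ∈ distTriang D) : Mono f :=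
  (heart_shortExact_of_tri hT).choose_spec.mono_f

theorem serre_ext_of_tri (Q : ObjectProperty (HeartCat t)) [Q.IsSerreClass] {A X B : HeartCat t}
    {f : A ⟶ X} {g : X ⟶ B} {δ : B.obj ⟶ A.obj⟦(1 : ℤ)⟧}
    (hT : Triangle.mk f.hom g.hom δ ∈ distTriang D) (hA : Q A) (hB : Q B) : Q X := by
  obtain ⟨w, hw⟩ := heart_shortExact_of_tri hT
  exact Q.prop_X₂_of_shortExact hw hA hB

theorem heart_ext {A X B : D} {f : A ⟶ X} {g : X ⟶ B} {δ : B ⟶ A⟦(1 : ℤ)⟧}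
    (hT : Triangle.mk f g δ ∈ distTriang D) (hA : t.heart A) (hB : t.heart B) : t.heart X := by
  rw [t.mem_heart_iff] at *
  exact ⟨t.isLE₂ _ hT 0 hA.1 hB.1, t.isGE₂ _ hT 0 hA.2 hB.2⟩

theorem heart_isZero_iff (X : HeartCat t) : IsZero X ↔ IsZero X.obj := by
  rw [IsZero.iff_id_eq_zero, IsZero.iff_id_eq_zero]
  exact ⟨fun h => congrArg (fun f => f.hom) h, fun h => ObjectProperty.hom_ext _ h⟩

/-- The objects of `D` that belong to the heart and there satisfy `P`. -/
def heartProp (P : ObjectProperty (HeartCat t)) : ObjectProperty D := fun X =>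
  ∃ h : t.heart X, P ⟨X, h⟩

theorem hasFiltration_iff_extW (P : ObjectProperty (HeartCat t)) (X : HeartCat t) :
    HasFiltration P X ↔ ExtW (heartProp P) X.obj := by
  constructor
  · intro h
    induction h with
    | zero X hX => exact .zero _ ((heart_isZero_iff X).1 hX)
    | step K hK h₁ h₃ ih =>
      obtain ⟨δ, hT⟩ := heart_tri_of_shortExact hK
      exact .step _ _ _ hT ih ⟨K.X₃.property, h₃⟩
  · intro h
    obtain ⟨X, hX⟩ := X
    change ExtW (heartProp P) X at h
    suffices ∃ hX : t.heart X, HasFiltration P ⟨X, hX⟩ from this.choose_spec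
    clear hX
    induction h with
    | zero X hX => exact ⟨t.heart.prop_of_isZero hX, .zero _ ((heart_isZero_iff _).2 hX)⟩
    | @step A X B f g δ hT hA hB ih =>
      obtain ⟨hA', hfA⟩ := ih
      obtain ⟨hB', hPB⟩ := hB
      have hX := heart_ext hT hA' hB'
      let f' : (⟨A, hA'⟩ : HeartCat t) ⟶ ⟨X, hX⟩ := ObjectProperty.homMk f
      let g' : (⟨X, hX⟩ : HeartCat t) ⟶ ⟨B, hB'⟩ := ObjectProperty.homMk g
      obtain ⟨w, hw⟩ := heart_shortExact_of_tri (f := f') (g := g') (δ := δ) hT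
      exact ⟨hX, .step _ hw hfA hPB⟩

theorem extW_heart {P : ObjectProperty D} (hP : P ≤ t.heart) : extW P ≤ t.heart := by
  intro X hX
  induction hX with
  | zero X hX => exact t.heart.prop_of_isZero hX
  | step f g δ hT hA hB ih => exact heart_ext hT ih (hP _ hB)

theorem extW_serre (Q : ObjectProperty (HeartCat t)) [Q.IsSerreClass] {P : ObjectProperty D}
    (hP : ∀ X, P X → heartProp Q X) {X : D} (hX : ExtW P X) : heartProp Q X := by
  induction hX with
  | zero X hX =>
    exact ⟨t.heart.prop_of_isZero hX, Q.prop_of_isZero ((heart_isZero_iff _).2 hX)⟩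
  | @step A X B f g δ hT hA hB ih =>
    obtain ⟨hA', hQA⟩ := ih
    obtain ⟨hB', hQB⟩ := hP _ hB
    have hX := heart_ext hT hA' hB'
    let f' : (⟨A, hA'⟩ : HeartCat t) ⟶ ⟨X, hX⟩ := ObjectProperty.homMk f
    let g' : (⟨X, hX⟩ : HeartCat t) ⟶ ⟨B, hB'⟩ := ObjectProperty.homMk g
    exact ⟨hX, serre_ext_of_tri Q (f := f') (g := g') (δ := δ) hT hQA hQB⟩

end HeartTri

section Filtration

variable {A : Type*} [Category* A] [Abelian A] {P : ObjectProperty A}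

theorem HasFiltration.of_iso {X Y : A} (h : HasFiltration P X) (e : X ≅ Y) :
    HasFiltration P Y := by
  cases h with
  | zero X hX => exact .zero _ (hX.of_iso e.symm)
  | step K hK h₁ h₃ =>
    refine .step (ShortComplex.mk (K.f ≫ e.hom) (e.inv ≫ K.g) (by simp)) ?_ h₁ h₃
    exact ShortComplex.shortExact_of_iso
      (ShortComplex.isoMk (S₁ := K) (Iso.refl _) e (Iso.refl _) (by simp) (by simp)) hK

theorem HasFiltration.of_mono (hs : ∀ X, P X → Simple X) {X N : A} (h : HasFiltration P X)
    (j : N ⟶ X) [Mono j] [P.IsClosedUnderIsomorphisms] : HasFiltration P N := by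
  induction h generalizing N with
  | zero X hX =>
    exact .zero _ (IsZero.of_mono j hX)
  | step K hK h₁ h₃ ih =>
    have := hK.mono_f
    have := hs _ h₃
    by_cases hj : j ≫ K.g = 0
    · let l := hK.exact.lift j hj
      have hl : l ≫ K.f = j := hK.exact.lift_f _ _
      have : Mono (l ≫ K.f) := by rw [hl]; infer_instance
      have : Mono l := mono_of_mono l K.f
      exact ih l
    · have : Epi (j ≫ K.g) := epi_of_nonzero_to_simple hj
      let l : kernel (j ≫ K.g) ⟶ K.X₁ := hK.exact.lift (kernel.ι _ ≫ j) (by simp)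
      have hl : l ≫ K.f = kernel.ι _ ≫ j := hK.exact.lift_f _ _
      have : Mono (l ≫ K.f) := by rw [hl]; infer_instance
      have : Mono l := mono_of_mono l K.f
      exact .step (ShortComplex.mk (kernel.ι (j ≫ K.g)) (j ≫ K.g) (by simp))
        { exact := ShortComplex.exact_kernel _ } (ih l) h₃

theorem HasFiltration.of_epi (hs : ∀ X, P X → Simple X) {X M : A} (h : HasFiltration P X)
    (q : X ⟶ M) [Epi q] [P.IsClosedUnderIsomorphisms] : HasFiltration P M := by
  induction h generalizing M with
  | zero X hX => exact .zero _ (IsZero.of_epi q hX)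
  | step K hK h₁ h₃ ih =>
    have := hK.epi_g
    have := hs _ h₃
    have h₁' : HasFiltration P (Abelian.image (K.f ≫ q)) :=
      ih (Abelian.factorThruImage (K.f ≫ q))
    let c := cokernel.π (K.f ≫ q)
    let d : K.X₃ ⟶ cokernel (K.f ≫ q) := hK.exact.desc (q ≫ c) (by
      rw [← Category.assoc]; exact cokernel.condition _)
    have hd : K.g ≫ d = q ≫ c := hK.exact.g_desc _ _
    have : Epi (K.g ≫ d) := by rw [hd]; exact epi_comp _ _
    have : Epi d := epi_of_epi K.g d
    have hI : (ShortComplex.mk (Abelian.image.ι (K.f ≫ q)) c (kernel.condition _)).ShortExact :=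
      { exact := ShortComplex.exact_kernel _ }
    by_cases hd0 : d = 0
    · have hz : IsZero (cokernel (K.f ≫ q)) := by
        rw [IsZero.iff_id_eq_zero, ← cancel_epi d, hd0, zero_comp, zero_comp]
      have : IsIso (Abelian.image.ι (K.f ≫ q)) := by
        have : Epi (Abelian.image.ι (K.f ≫ q)) :=
          hI.exact.epi_f (hz.eq_of_tgt _ _)
        exact isIso_of_mono_of_epi _
      exact h₁'.of_iso (asIso (Abelian.image.ι (K.f ≫ q)))
    · have : IsIso d := isIso_of_epi_of_nonzero hd0
      exact .step _ hI h₁' (P.prop_of_iso (asIso d) h₃)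

end Filtration

section

variable {D : Type*} [Category* D] [Preadditive D] [HasZeroObject D] [HasShift D ℤ]
  [∀ n : ℤ, (shiftFunctor D n).Additive] [Pretriangulated D] [IsTriangulated D]
  {S : Type*} [PartialOrder S]

namespace StdSystem

local notation P " ∗ " Q => ObjectProperty.extensionProduct P Q

variable (W : StdSystem D S) (t : TStructure D)

/-- `t` is the t-structure attached to the system. -/
structure Assoc : Prop where
  le_zero (X : D) : t.le 0 X ↔ ∀ (s : S) (n d : ℤ), d < 0 → Orth X ((W.nab s n)⟦d⟧)
  ge_zero (X : D) : t.ge 0 X ↔ ∀ (s : S) (n d : ℤ), 0 < d → Orth ((W.del s n)⟦d⟧) X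

variable {W t}

namespace Assoc

variable (ht : W.Assoc t)

include ht

theorem isLE_iff (X : D) : t.IsLE X 0 ↔ ∀ (s : S) (n d : ℤ), d < 0 →
    Orth X ((W.nab s n)⟦d⟧) := by
  rw [← t.le_iff_isLE, ht.le_zero]

theorem isGE_iff (X : D) : t.IsGE X 0 ↔ ∀ (s : S) (n d : ℤ), 0 < d →
    Orth ((W.del s n)⟦d⟧) X := by
  rw [← t.ge_iff_isGE, ht.ge_zero]

theorem nab_heart (s : S) (n : ℤ) : t.heart (W.nab s n) := by
  refine heart_mem t _ ((ht.isLE_iff _).2 fun u m d hd => W.nab_neg _ _ _ _ _ hd)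
    ((ht.isGE_iff _).2 fun u m d hd => ?_)
  exact (W.orth_del_nab_neg u s m n (-d) (by lia)).shift_left d (by lia)

theorem del_heart (s : S) (n : ℤ) : t.heart (W.del s n) := by
  refine heart_mem t _ ((ht.isLE_iff _).2 fun u m d hd => W.orth_del_nab_neg _ _ _ _ _ hd)
    ((ht.isGE_iff _).2 fun u m d hd => ?_)
  exact (W.del_neg u s m n (-d) (by lia)).shift_left d (by lia)

/-- The costandard object of index `(s, n)` in the heart. -/
abbrev nabH (s : S) (n : ℤ) : HeartCat t := ⟨_, ht.nab_heart s n⟩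

/-- The standard object of index `(s, n)` in the heart. -/
abbrev delH (s : S) (n : ℤ) : HeartCat t := ⟨_, ht.del_heart s n⟩

theorem lePart_isLE {F : Set S} {X : D} (hX : W.lePart F X) : t.IsLE X 0 :=
  (ht.isLE_iff X).2 fun s n d hd => W.lePart_orth_nab hX s n d hd

theorem gePart_isGE {F : Set S} {X : D} (hX : W.gePart F X) : t.IsGE X 1 := by
  have : t.IsGE (X⟦(1 : ℤ)⟧) 0 := (ht.isGE_iff _).2 fun s n d hd =>
    ((W.del_orth_gePart hX s n (d - 1) (by lia)).shift 1).of_iso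
      (shiftAddIso _ _ _ _ (by lia)) (Iso.refl _)
  exact t.isGE_of_shift X 1 1 0

/-- The subcategories `DF F` are stable under truncation. -/
theorem DF_trunc {F : Set S} (hF : F.Finite) (hF' : IsLowerSet F) {A X B : D} {f : A ⟶ X}
    {g : X ⟶ B} {h : B ⟶ A⟦(1 : ℤ)⟧} (hT : Triangle.mk f g h ∈ distTriang D) (hX : W.DF F X)
    (n m : ℤ) (hnm : n + 1 = m) (hA : t.IsLE A n) (hB : t.IsGE B m) :
    W.DF F A ∧ W.DF F B := by
  obtain ⟨A', B', u, v, w, hT', hA', hB'⟩ :=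
    W.DF_le_trunc F hF hF' _ ((W.DF F).le_shift n _ hX)
  have h₁ : t.IsLE A' 0 := ht.lePart_isLE hA'
  have h₂ : t.IsGE B' 1 := ht.gePart_isGE hB'
  obtain ⟨x, hT₂⟩ := tri_shift hT n
  obtain ⟨e, -⟩ := t.triangle_iso_exists hT' hT₂ (Iso.refl _) 0 1 h₁ h₂
    (t.isLE_shift A n n 0) (t.isGE_shift B m n 1)
  have e₁ : A' ≅ A⟦n⟧ := Triangle.π₁.mapIso e
  have e₃ : B' ≅ B⟦n⟧ := Triangle.π₃.mapIso e
  have key : ∀ Y : D, W.DF F (Y⟦n⟧) → W.DF F Y := fun Y hY =>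
    (W.DF F).prop_of_iso ((shiftAddIso Y n (-n) 0 (by lia)).trans (shiftZeroIso Y))
      ((W.DF F).le_shift (-n) _ hY)
  exact ⟨key _ ((W.DF F).prop_of_iso e₁ (W.lePart_le_DF hF' _ hA')),
    key _ ((W.DF F).prop_of_iso e₃ (W.gePart_le_DF F _ hB'))⟩

/-- If the cone of a morphism `p ≫ i` of the heart lies in `DF F`, so do its kernel and its
cokernel. -/
theorem DF_ker_coker {F : Set S} (hF : F.Finite) (hF' : IsLowerSet F) {X I Y K Q : HeartCat t}
    {k : K ⟶ X} {p : X ⟶ I} {i : I ⟶ Y} {q : Y ⟶ Q} {δ₁ : I.obj ⟶ K.obj⟦(1 : ℤ)⟧}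
    {δ₂ : Q.obj ⟶ I.obj⟦(1 : ℤ)⟧} (h₁ : Triangle.mk k.hom p.hom δ₁ ∈ distTriang D)
    (h₂ : Triangle.mk i.hom q.hom δ₂ ∈ distTriang D) {C : D} {φ : X.obj ⟶ Y.obj}
    (hφ : p.hom ≫ i.hom = φ) {a : Y.obj ⟶ C} {b : C ⟶ X.obj⟦(1 : ℤ)⟧}
    (hT : Triangle.mk φ a b ∈ distTriang D) (hC : W.DF F C) :
    W.DF F K.obj ∧ W.DF F Q.obj := by
  have O := someOctahedron hφ (tri_rot h₁) h₂ hT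
  obtain ⟨hK, hQ⟩ := ht.DF_trunc hF hF' O.mem hC (-1) 0 (by lia)
    (t.isLE_shift K.obj 0 1 (-1)) inferInstance
  exact ⟨(W.DF F).prop_of_iso ((shiftAddIso K.obj 1 (-1) 0 (by lia)).trans (shiftZeroIso _))
    ((W.DF F).le_shift (-1) _ hK), hQ⟩

end Assoc

theorem io_ne_zero (s : S) (n : ℤ) : W.io s n ≠ 0 := by
  intro h
  obtain ⟨C, g, k, hT, hC⟩ := W.exists_cone s n
  obtain ⟨r, hr⟩ := tri_desc hT (𝟙 _) (by rw [h, zero_comp])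
  have : r = 0 := (W.DF_orth_nab hC (fun u hu => not_le_of_gt hu) n 0).of_iso (Iso.refl _)
    (shiftZeroIso _) r
  rw [this, comp_zero] at hr
  exact W.nab_not_isZero s n ((IsZero.iff_id_eq_zero _).2 hr)

theorem DF_Iio_orth_nab {s : S} {C : D} (hC : W.DF (Set.Iio s) C) (n i : ℤ) :
    Orth C ((W.nab s n)⟦i⟧) :=
  W.DF_orth_nab hC (fun u hu => not_le_of_gt hu) n i

theorem del_orth_DF_Iio {s : S} {C : D} (hC : W.DF (Set.Iio s) C) (n : ℤ) :
    Orth (W.del s n) C :=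
  W.del_orth_DF' hC (fun h => lt_irrefl s h) n

/-- Morphisms `X ⟶ nab s n` lift to `del s n` when `X` is left orthogonal to the lower part. -/
theorem exists_lift_io {X : D} {s : S} {n : ℤ} (hX : ∀ C, W.DF (Set.Iio s) C → Orth X C)
    (f : X ⟶ W.nab s n) : ∃ f' : X ⟶ W.del s n, f' ≫ W.io s n = f := by
  obtain ⟨C, g, k, hT, hC⟩ := W.exists_cone s n
  obtain ⟨f', hf'⟩ := tri_lift hT f (hX C hC _)
  exact ⟨f', hf'.symm⟩

theorem io_cancel {X : D} {s : S} {n : ℤ} (hX : ∀ C, W.DF (Set.Iio s) C → Orth X C)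
    (f : X ⟶ W.del s n) (hf : f ≫ W.io s n = 0) : f = 0 := by
  obtain ⟨C, g, k, hT, hC⟩ := W.exists_cone s n
  obtain ⟨a, b, hT'⟩ := tri_invRot hT
  obtain ⟨f', rfl⟩ := tri_lift hT' f hf
  rw [hX _ ((W.DF _).le_shift (-1) _ hC) f', zero_comp]

theorem io_cancel_shift {X : D} {s : S} {n i : ℤ} (hX : ∀ C, W.DF (Set.Iio s) C → Orth X C)
    (f : X ⟶ (W.del s n)⟦i⟧) (hf : f ≫ (W.io s n)⟦i⟧' = 0) : f = 0 := by
  obtain ⟨C, g, k, hT, hC⟩ := W.exists_cone s n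
  obtain ⟨a, b, hT'⟩ := tri_invRot hT
  obtain ⟨w, hT₂⟩ := tri_shift hT' i
  obtain ⟨f', rfl⟩ := tri_lift hT₂ f hf
  rw [hX _ ((W.DF _).le_shift i _ ((W.DF _).le_shift (-1) _ hC)) f', zero_comp]

theorem del_nab_fac (s : S) (n m : ℤ) (f : W.del s n ⟶ W.nab s m) :
    ∃ f' : W.nab s n ⟶ W.nab s m, f = W.io s n ≫ f' := by
  obtain ⟨f', hf'⟩ := W.io_fac s n m 0 (f ≫ (shiftZeroIso _).inv)
  exact ⟨f' ≫ (shiftZeroIso _).hom, by rw [← Category.assoc, ← hf']; simp⟩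

theorem orth_del_nab_zero {s u : S} {n m : ℤ} (h : (s, n) ≠ (u, m)) :
    Orth (W.del s n) (W.nab u m) := by
  by_cases hsu : s = u
  · subst hsu
    intro f
    obtain ⟨f', rfl⟩ := del_nab_fac s n m f
    rw [W.nab_zero s n m (fun h' => h (by rw [h'])) f', comp_zero]
  · exact (W.orth_del_nab hsu n m 0).of_iso (Iso.refl _) (shiftZeroIso _)

/-- A nonzero morphism `del s n ⟶ nab s n` is `io` up to an automorphism of `del s n`. -/
theorem exists_iso_comp_io (s : S) (n : ℤ) (f : W.del s n ⟶ W.nab s n) (hf : f ≠ 0) :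
    ∃ e : W.del s n ≅ W.del s n, f = e.hom ≫ W.io s n := by
  obtain ⟨f', rfl⟩ := del_nab_fac s n n f
  have : IsIso f' := by
    rcases W.nab_isIso s n f' with rfl | h
    · exact (hf comp_zero).elim
    · exact h
  have ho : ∀ C, W.DF (Set.Iio s) C → Orth (W.del s n) C := fun C hC => del_orth_DF_Iio hC n
  obtain ⟨a, ha⟩ := exists_lift_io ho (W.io s n ≫ f')
  obtain ⟨b, hb⟩ := exists_lift_io ho (W.io s n ≫ inv f')
  refine ⟨⟨a, b, ?_, ?_⟩, ha.symm⟩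
  · rw [← sub_eq_zero]
    refine io_cancel ho _ ?_
    rw [Preadditive.sub_comp, Category.assoc, hb, ← Category.assoc, ha]
    simp
  · rw [← sub_eq_zero]
    refine io_cancel ho _ ?_
    rw [Preadditive.sub_comp, Category.assoc, ha, ← Category.assoc, hb]
    simp

theorem del_isIso (s : S) (n : ℤ) (f : W.del s n ⟶ W.del s n) (hf : f ≠ 0) : IsIso f := by
  have ho : ∀ C, W.DF (Set.Iio s) C → Orth (W.del s n) C := fun C hC => del_orth_DF_Iio hC n
  obtain ⟨e, he⟩ := exists_iso_comp_io s n (f ≫ W.io s n) (fun h => hf (io_cancel ho f h))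
  have : f = e.hom := by
    rw [← sub_eq_zero]
    refine io_cancel ho _ ?_
    rw [Preadditive.sub_comp, he, sub_self]
  rw [this]
  infer_instance

theorem orth_del_of_orth_nab {s : S} {n m i : ℤ} (h : Orth (W.nab s n) ((W.nab s m)⟦i⟧)) :
    Orth (W.del s n) ((W.del s m)⟦i⟧) := fun f =>
  io_cancel_shift (fun C hC => del_orth_DF_Iio hC n) f (W.orth_del_nab_of_orth h _)

theorem del_zero {s : S} {n m : ℤ} (h : n ≠ m) : Orth (W.del s n) (W.del s m) := fun f =>
  io_cancel (fun C hC => del_orth_DF_Iio hC n) f (orth_del_nab_zero (by simpa using h) _)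

/-! ### The simple objects of the heart -/

variable (W t) in
/-- `Z` is an image of `io s n` in the heart. -/
def Sig (s : S) (n : ℤ) : ObjectProperty (HeartCat t) := fun Z =>
  ∃ (hd : t.heart (W.del s n)) (hn : t.heart (W.nab s n))
    (p : (⟨_, hd⟩ : HeartCat t) ⟶ Z) (i : Z ⟶ (⟨_, hn⟩ : HeartCat t)),
    Epi p ∧ Mono i ∧ p.hom ≫ i.hom = W.io s n

variable (W t) in
/-- The images of the morphisms `io s n` with `(s, n) ∈ Ξ`. -/
def sigs (Xi : Set (S × ℤ)) : ObjectProperty (HeartCat t) := fun Z =>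
  ∃ p ∈ Xi, W.Sig t p.1 p.2 Z

theorem Sig.of_iso {s : S} {n : ℤ} {Z Z' : HeartCat t} (h : W.Sig t s n Z) (e : Z ≅ Z') :
    W.Sig t s n Z' := by
  obtain ⟨hd, hn, p, i, hp, hi, hpi⟩ := h
  refine ⟨hd, hn, p ≫ e.hom, e.inv ≫ i, epi_comp _ _, mono_comp _ _, ?_⟩
  rw [← hpi]
  change ((p ≫ e.hom) ≫ e.inv ≫ i).hom = (p ≫ i).hom
  simp

instance sigs_iso (Xi : Set (S × ℤ)) : (W.sigs t Xi).IsClosedUnderIsomorphisms where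
  of_iso := by
    rintro Z Z' e ⟨p, hp, h⟩
    exact ⟨p, hp, h.of_iso e⟩

theorem Sig.ne_zero {s : S} {n : ℤ} {Z : HeartCat t} (h : W.Sig t s n Z) : ¬ IsZero Z := by
  obtain ⟨hd, hn, p, i, hp, hi, hpi⟩ := h
  intro hZ
  refine io_ne_zero (W := W) s n ?_
  rw [← hpi]
  change (p ≫ i).hom = 0
  rw [hZ.eq_of_src i 0, comp_zero]
  rfl

namespace Assoc

variable (ht : W.Assoc t)

include ht

theorem exists_sig (s : S) (n : ℤ) : ∃ Z, W.Sig t s n Z := by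
  let φ : ht.delH s n ⟶ ht.nabH s n := ObjectProperty.homMk (W.io s n)
  refine ⟨Abelian.image φ, ht.del_heart s n, ht.nab_heart s n, Abelian.factorThruImage φ,
    Abelian.image.ι φ, inferInstance, inferInstance, ?_⟩
  change (Abelian.factorThruImage φ ≫ Abelian.image.ι φ).hom = _
  rw [Abelian.image.fac]
  rfl

/-- A nonzero object of the heart receives a nonzero morphism from a standard object. -/
theorem exists_del_hom (N : HeartCat t) (hN : ¬ IsZero N) :
    ∃ (s : S) (n : ℤ) (f : W.del s n ⟶ N.obj), f ≠ 0 := by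
  by_contra! h
  have : t.IsGE (N.obj⟦(1 : ℤ)⟧) 0 := (ht.isGE_iff _).2 fun s n d hd => by
    have h₁ : Orth ((W.del s n)⟦d - 1⟧) N.obj := by
      by_cases hd' : d = 1
      · subst hd'
        exact Orth.of_iso (X := W.del s n) (h s n) (shiftZeroIso _).symm (Iso.refl _)
      · exact (ht.isGE_iff _).1 inferInstance s n (d - 1) (by lia)
    exact (h₁.shift 1).of_iso (shiftAddIso _ _ _ _ (by lia)) (Iso.refl _)
  have : t.IsGE N.obj 1 := t.isGE_of_shift N.obj 1 1 0
  exact hN ((heart_isZero_iff N).2 (t.isZero N.obj 0 1))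

theorem sig_simple {s : S} {n : ℤ} {Z : HeartCat t} (h : W.Sig t s n Z) : Simple Z := by
  have hZ := h.ne_zero
  obtain ⟨hd, hn, p, i, hp, hi, hpi⟩ := h
  constructor
  intro N j hj
  constructor
  · intro hj' h0
    refine hZ ((IsZero.iff_id_eq_zero _).2 ?_)
    exact (IsIso.inv_hom_id j).symm.trans ((congrArg (inv j ≫ ·) h0).trans comp_zero)
  · intro hj0
    have hN : ¬ IsZero N := fun h => hj0 (h.eq_of_src _ _)
    obtain ⟨u, m, f, hf⟩ := ht.exists_del_hom N hN
    let f' : ht.delH u m ⟶ N := ObjectProperty.homMk f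
    have hf' : f' ≫ j ≫ i ≠ 0 := by
      intro h0
      have : f' = 0 := by
        rw [← cancel_mono (j ≫ i), h0, zero_comp]
      exact hf (congrArg (fun a => a.hom) this)
    by_cases hus : (u, m) = (s, n)
    · obtain ⟨rfl, rfl⟩ := Prod.mk.inj hus
      obtain ⟨e, he⟩ := exists_iso_comp_io u m (f' ≫ j ≫ i).hom
        (fun h => hf' (ObjectProperty.hom_ext _ h))
      let e' : (⟨_, hd⟩ : HeartCat t) ⟶ ⟨_, hd⟩ := ObjectProperty.homMk e.inv
      have hp' : e' ≫ f' ≫ j = p := by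
        rw [← cancel_mono i]
        refine ObjectProperty.hom_ext _ ?_
        change (e.inv ≫ f ≫ j.hom) ≫ i.hom = p.hom ≫ i.hom
        have he' : f ≫ j.hom ≫ i.hom = e.hom ≫ W.io u m := he
        rw [Category.assoc, Category.assoc, he', hpi, e.inv_hom_id_assoc]
      have : Epi ((e' ≫ f') ≫ j) := by rw [Category.assoc, hp']; exact hp
      have : Epi j := epi_of_epi (e' ≫ f') j
      exact isIso_of_mono_of_epi j
    · exact (hf' (ObjectProperty.hom_ext _ (orth_del_nab_zero hus _))).elim

/-- The Serre subcategory generated by the simple objects of index in `Ξ` consists of the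
objects filtered by these. -/
theorem serreHull_iff (Xi : Set (S × ℤ)) (X : HeartCat t) :
    serreHull (W.sigs t Xi) X ↔ HasFiltration (W.sigs t Xi) X := by
  have hs : ∀ Z, W.sigs t Xi Z → Simple Z := fun Z ⟨p, _, hp⟩ => ht.sig_simple hp
  constructor
  · intro hX
    refine hX (fun Y => HasFiltration (W.sigs t Xi) Y) ?_ ?_
    · exact
      { exists_zero := ⟨0, isZero_zero _, .zero _ (isZero_zero _)⟩
        prop_of_mono := fun f _ h => h.of_mono hs f
        prop_of_epi := fun f _ h => h.of_epi hs f
        prop_X₂_of_shortExact := fun {K} hK h₁ h₃ => by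
          obtain ⟨δ, hT⟩ := heart_tri_of_shortExact hK
          rw [hasFiltration_iff_extW] at h₁ h₃ ⊢
          exact extW_extensionProduct _ _ ⟨_, _, _, _, _, hT, h₁, h₃⟩ }
    · intro Z hZ
      rw [hasFiltration_iff_extW]
      exact le_extW _ _ ⟨Z.property, hZ⟩
  · intro h Q hQ hP
    induction h with
    | zero X hX => exact Q.prop_of_isZero hX
    | step K hK h₁ h₃ ih => exact Q.prop_X₂_of_shortExact hK ih (hP _ h₃)

/-- The kernel and the cokernel of `io` lie in the lower part. -/
theorem sig_tri {s : S} {n : ℤ} {Z : HeartCat t} (h : W.Sig t s n Z) :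
    ∃ (K Q : HeartCat t) (k : K ⟶ ht.delH s n) (p : ht.delH s n ⟶ Z) (i : Z ⟶ ht.nabH s n)
      (q : ht.nabH s n ⟶ Q) (δ₁ : Z.obj ⟶ K.obj⟦(1 : ℤ)⟧) (δ₂ : Q.obj ⟶ Z.obj⟦(1 : ℤ)⟧),
      Triangle.mk k.hom p.hom δ₁ ∈ distTriang D ∧ Triangle.mk i.hom q.hom δ₂ ∈ distTriang D ∧
      W.DF (Set.Iio s) K.obj ∧ W.DF (Set.Iio s) Q.obj := by
  obtain ⟨hd, hn, p, i, hp, hi, hpi⟩ := h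
  obtain ⟨K, k, δ₁, h₁⟩ := heart_exists_tri_of_epi p
  obtain ⟨Q, q, δ₂, h₂⟩ := heart_exists_tri_of_mono i
  obtain ⟨C, g, a, hT, hC⟩ := W.exists_cone s n
  obtain ⟨hK, hQ⟩ := ht.DF_ker_coker ((W.finite_Iic s).subset Set.Iio_subset_Iic_self)
    (isLowerSet_Iio s) h₁ h₂ hpi hT hC
  exact ⟨K, Q, k, p, i, q, δ₁, δ₂, h₁, h₂, hK, hQ⟩

theorem sig_mem_DF {F : Set S} (hF : IsLowerSet F) {s : S} (hs : s ∈ F) {n : ℤ}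
    {Z : HeartCat t} (h : W.Sig t s n Z) : W.DF F Z.obj := by
  obtain ⟨K, Q, k, p, i, q, δ₁, δ₂, h₁, h₂, hK, hQ⟩ := ht.sig_tri h
  refine (W.DF F).ext_of_isTriangulatedClosed₃ _ h₁ ?_ ?_
  · exact W.DF_mono (fun u hu => hF (le_of_lt hu) hs) _ hK
  · exact (W.DF F).prop_of_iso (shiftZeroIso _) (W.del_mem_DF hF hs n 0)

theorem serre_le_DF {F : Set S} (hF : IsLowerSet F) {X : HeartCat t}
    (hX : serreHull (W.sigs t {p | p.1 ∈ F}) X) : W.DF F X.obj := by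
  rw [ht.serreHull_iff, hasFiltration_iff_extW] at hX
  refine extW_le (Q := W.DF F) ?_ _ hX
  rintro Z ⟨hZ, p, hp, h⟩
  exact ht.sig_mem_DF hF hp h

end Assoc

end StdSystem

end

section SerreShift

variable {D : Type*} [Category* D] [Preadditive D] [HasZeroObject D] [HasShift D ℤ]
  [∀ n : ℤ, (shiftFunctor D n).Additive] [Pretriangulated D] [IsTriangulated D]
  {t : TStructure D}

local notation P " ∗ " Q => ObjectProperty.extensionProduct P Q

/-- The cone of a morphism of the heart is an extension of its cokernel by the shifted kernel. -/
theorem heart_cone_tri {X Y : HeartCat t} (φ : X ⟶ Y) {C : D} {a : Y.obj ⟶ C}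
    {b : C ⟶ X.obj⟦(1 : ℤ)⟧} (hT : Triangle.mk φ.hom a b ∈ distTriang D) :
    ∃ (u : (kernel φ).obj⟦(1 : ℤ)⟧ ⟶ C) (v : C ⟶ (cokernel φ).obj)
      (w : (cokernel φ).obj ⟶ (kernel φ).obj⟦(1 : ℤ)⟧⟦(1 : ℤ)⟧),
      Triangle.mk u v w ∈ distTriang D := by
  have hK : (ShortComplex.mk (kernel.ι φ) (Abelian.factorThruImage φ) (by
      rw [← cancel_mono (Abelian.image.ι φ)]; simp)).ShortExact :=
    { exact := ShortComplex.exact_of_f_is_kernel _ (KernelFork.IsLimit.ofι' _ _ fun k hk =>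
        ⟨kernel.lift φ k (by rw [← Abelian.image.fac φ, reassoc_of% hk, zero_comp]), by simp⟩) }
  have hQ : (ShortComplex.mk (Abelian.image.ι φ) (cokernel.π φ) (kernel.condition _)).ShortExact :=
    { exact := ShortComplex.exact_kernel _ }
  obtain ⟨δ₁, h₁⟩ := heart_tri_of_shortExact hK
  obtain ⟨δ₂, h₂⟩ := heart_tri_of_shortExact hQ
  have hφ : (Abelian.factorThruImage φ).hom ≫ (Abelian.image.ι φ).hom = φ.hom :=
    congrArg (fun f => f.hom) (Abelian.image.fac φ)
  exact ⟨_, _, _, (someOctahedron hφ (tri_rot h₁) h₂ hT).mem⟩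

variable (Q : ObjectProperty (HeartCat t)) [Q.IsSerreClass]

/-- The shifts by integers in `I` of objects of `Q`. -/
abbrev shiftsOf (I : Set ℤ) : ObjectProperty D :=
  familyProp (fun p : Q.FullSubcategory × ℤ => p.1.obj.obj⟦p.2⟧) {p | p.2 ∈ I}

variable {Q} in
theorem shiftsOf_mem {I : Set ℤ} {b : HeartCat t} (hb : Q b) {i : ℤ} (hi : i ∈ I) :
    shiftsOf Q I (b.obj⟦i⟧) :=
  familyProp_mem (fun p : Q.FullSubcategory × ℤ => p.1.obj.obj⟦p.2⟧)
    (i := (⟨b, hb⟩, i)) hi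

theorem shiftsOf_swap {I J : Set ℤ} (hIJ : ∀ i ∈ I, ∀ j ∈ J, j < i) :
    (shiftsOf Q J ∗ shiftsOf Q I) ≤ (shiftsOf Q I ∗ shiftsOf Q J) := by
  rintro X ⟨A, B, f, g, h, hT, hA, hB⟩
  rcases hA with hA | ⟨⟨⟨b', hb'⟩, j⟩, hj, ⟨e'⟩⟩
  · exact ObjectProperty.le_extensionProduct_left _ _ (extensionProduct_isZero_left hT hB hA)
  rcases hB with hB | ⟨⟨⟨b, hb⟩, i⟩, hi, ⟨e⟩⟩
  · exact ObjectProperty.le_extensionProduct_right _ _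
      (extensionProduct_isZero_right (P := shiftsOf Q J) hT
        (.inr ⟨(⟨b', hb'⟩, j), hj, ⟨e'⟩⟩) hB)
  change B ≅ b.obj⟦i⟧ at e
  change A ≅ b'.obj⟦j⟧ at e'
  have hij' := hIJ i hi j hj
  by_cases hij : j + 1 = i
  · obtain ⟨w, hT₁⟩ := tri_shift hT (-i)
    have hT₂ := tri_rot (tri_rot hT₁)
    let eB : B⟦-i⟧ ≅ b.obj := ((shiftFunctor D (-i)).mapIso e).trans
      ((shiftAddIso _ _ _ 0 (by lia)).trans (shiftZeroIso _))
    let eA : A⟦-i⟧⟦(1 : ℤ)⟧ ≅ b'.obj := ((shiftFunctor D (1 : ℤ)).mapIso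
      ((shiftFunctor D (-i)).mapIso e')).trans (((shiftFunctor D (1 : ℤ)).mapIso
        (shiftAddIso _ _ _ (-1) (by lia))).trans
          ((shiftAddIso _ _ _ 0 (by lia)).trans (shiftZeroIso _)))
    have hT₃ := tri_iso₂ (tri_iso₁ hT₂ eB) eA
    obtain ⟨u, v, w', hT₄⟩ := heart_cone_tri (X := b) (Y := b')
      (ObjectProperty.homMk _) hT₃
    obtain ⟨z, hT₅⟩ := tri_shift hT₄ j
    have eX : X⟦-i⟧⟦(1 : ℤ)⟧⟦j⟧ ≅ X := (shiftAddIso _ _ _ i (by lia)).trans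
      ((shiftAddIso _ _ _ 0 (by lia)).trans (shiftZeroIso _))
    refine ObjectProperty.prop_of_iso _ eX ⟨_, _, _, _, _, hT₅, ?_, ?_⟩
    · exact ObjectProperty.prop_of_iso _ (shiftAddIso _ _ _ i (by lia)).symm
        (shiftsOf_mem (Q.prop_of_mono (kernel.ι _) hb) hi)
    · exact shiftsOf_mem (Q.prop_of_epi (cokernel.π _) hb') hj
  · obtain rfl : h = 0 := by
      refine Orth.of_iso (X := b.obj⟦i⟧) (Y := b'.obj⟦j + 1⟧) ?_ e.symm
        ((shiftAddIso _ _ _ _ rfl).symm.trans ((shiftFunctor D (1 : ℤ)).mapIso e'.symm)) h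
      intro f
      have := t.isLE_shift b.obj 0 i (-i)
      have := t.isGE_shift b'.obj 0 (j + 1) (-(j + 1))
      exact t.zero f (-i) (-(j + 1))
    obtain ⟨u, v, hT'⟩ := tri_split hT
    exact ⟨_, _, _, _, _, hT', .inr ⟨(⟨b, hb⟩, i), hi, ⟨e⟩⟩, .inr ⟨(⟨b', hb'⟩, j), hj, ⟨e'⟩⟩⟩

theorem shiftsOf_isLE {I : Set ℤ} {k : ℤ} (hI : ∀ i ∈ I, -k ≤ i) {X : D}
    (hX : ExtW (shiftsOf Q I) X) : t.IsLE X k := by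
  induction hX with
  | zero X hX => exact t.isLE_of_isZero hX k
  | step f g δ hT hA hB ih =>
    refine t.isLE₂ _ hT k ih ?_
    rcases hB with hB | ⟨⟨b, i⟩, hi, ⟨e⟩⟩
    · exact t.isLE_of_isZero hB k
    · have := t.isLE_shift b.obj.obj 0 i (-i)
      have := hI i hi
      have := t.isLE_of_le (b.obj.obj⟦i⟧) (-i) k
      exact t.isLE_of_iso e.symm k

theorem shiftsOf_isGE {I : Set ℤ} {k : ℤ} (hI : ∀ i ∈ I, i ≤ -k) {X : D}
    (hX : ExtW (shiftsOf Q I) X) : t.IsGE X k := by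
  induction hX with
  | zero X hX => exact t.isGE_of_isZero hX k
  | step f g δ hT hA hB ih =>
    refine t.isGE₂ _ hT k ih ?_
    rcases hB with hB | ⟨⟨b, i⟩, hi, ⟨e⟩⟩
    · exact t.isGE_of_isZero hB k
    · have := t.isGE_shift b.obj.obj 0 i (-i)
      have := hI i hi
      have := t.isGE_of_ge (b.obj.obj⟦i⟧) k (-i)
      exact t.isGE_of_iso e.symm k

theorem extW_shiftsOf_sort {I J K : Set ℤ} (hIJ : ∀ i ∈ I, ∀ j ∈ J, j < i) (hK : K ⊆ I ∪ J) :
    extW (shiftsOf Q K) ≤ (extW (shiftsOf Q I) ∗ extW (shiftsOf Q J)) := by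
  refine (extW_mono ?_).trans (extW_sup_le (shiftsOf_swap Q hIJ))
  rintro Y (hY | ⟨p, hp, e⟩)
  · exact .inl (.inl hY)
  · rcases hK hp with h | h
    · exact .inl (.inr ⟨p, h, e⟩)
    · exact .inr (.inr ⟨p, h, e⟩)

/-- An object of the heart that is an iterated extension of shifts of objects of a Serre
subcategory belongs to that subcategory. -/
theorem serre_of_extW_shiftsOf {X : HeartCat t} (hX : ExtW (shiftsOf Q Set.univ) X.obj) :
    Q X := by
  obtain ⟨A, B, f, g, h, hT, hA, hB⟩ := extW_shiftsOf_sort Q (I := {i | 1 ≤ i}) (J := {i | i < 1})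
    (fun i hi j hj => lt_of_lt_of_le hj hi) (fun i _ => le_or_gt 1 i) _ hX
  have hA' : t.IsLE A (-1) := shiftsOf_isLE Q (fun i hi => by simpa using hi) hA
  have hB' : t.IsGE B 0 := shiftsOf_isGE Q (fun i hi => by
    have : i < 1 := hi
    lia) hB
  obtain ⟨u, v, hT'⟩ := tri_invRot hT
  have hAge : t.IsGE A 0 := t.isGE₂ _ hT' 0 (by
    have := t.isGE_shift B 0 (-1) 1
    exact t.isGE_of_ge (B⟦(-1 : ℤ)⟧) 0 1) (inferInstanceAs (t.IsGE X.obj 0))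
  have hX' : ExtW (shiftsOf Q {i | i < 1}) X.obj :=
    extensionProduct_isZero_left (P := extW (shiftsOf Q {i | i < 1})) hT hB (t.isZero A (-1) 0)
  clear hT hT' hA hB hA' hB' hAge
  obtain ⟨A, B, f, g, h, hT, hA, hB⟩ := extW_shiftsOf_sort Q (I := {0}) (J := {i | i < 0})
    (fun i hi j hj => hi ▸ hj) (fun i (hi : i < 1) => by
      rcases (show i ≤ 0 by lia).lt_or_eq with h | h
      · exact .inr h
      · exact .inl h) _ hX'
  have hA' : t.IsLE A 0 := shiftsOf_isLE Q (fun i hi => by simp [show i = 0 from hi]) hA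
  have hB' : t.IsGE B 1 := shiftsOf_isGE Q (fun i hi => by
    have : i < 0 := hi
    lia) hB
  have hBle : t.IsLE B 0 := t.isLE₂ _ (tri_rot hT) 0 (inferInstanceAs (t.IsLE X.obj 0)) (by
    have := t.isLE_shift A 0 1 (-1)
    exact t.isLE_of_le (A⟦(1 : ℤ)⟧) (-1) 0)
  have hX₂ : ExtW (shiftsOf Q {0}) X.obj :=
    extensionProduct_isZero_right (P := extW (shiftsOf Q {0})) hT hA (t.isZero B 0 1)
  refine (extW_serre Q ?_ hX₂).choose_spec
  rintro Y (hY | ⟨⟨⟨b, hb⟩, i⟩, hi, ⟨e⟩⟩)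
  · exact ⟨t.heart.prop_of_isZero hY, Q.prop_of_isZero ((heart_isZero_iff _).2 hY)⟩
  · obtain rfl : i = 0 := hi
    have e' : b.obj ≅ Y := (e.trans (shiftZeroIso _)).symm
    have hY : t.heart Y := t.heart.prop_of_iso e' b.property
    exact ⟨hY, Q.prop_of_iso (t.heart.isoMk (X := b) (Y := ⟨Y, hY⟩) e') hb⟩

end SerreShift

section

variable {D : Type*} [Category* D] [Preadditive D] [HasZeroObject D] [HasShift D ℤ]
  [∀ n : ℤ, (shiftFunctor D n).Additive] [Pretriangulated D] [IsTriangulated D]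
  {S : Type*} [PartialOrder S] {W : StdSystem D S} {t : TStructure D}

namespace StdSystem.Assoc

variable (ht : W.Assoc t)

include ht

theorem serreHull_sigs_mono {Xi Xi' : Set (S × ℤ)} (h : Xi ⊆ Xi') {X : HeartCat t}
    (hX : serreHull (W.sigs t Xi) X) : serreHull (W.sigs t Xi') X :=
  hX _ inferInstance fun Z ⟨p, hp, hZ⟩ Q hQ hle => hle _ ⟨p, h hp, hZ⟩

theorem serre_of_DF {F : Set S} (hF : F.Finite) (hF' : IsLowerSet F) {X : HeartCat t}
    (hX : W.DF F X.obj) : serreHull (W.sigs t {p | p.1 ∈ F}) X := by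
  refine finite_lowerSet_induction (motive := fun F => ∀ X : HeartCat t, W.DF F X.obj →
    serreHull (W.sigs t {p | p.1 ∈ F}) X) ?_ ?_ F hF hF' X hX
  · intro X hX
    refine ObjectProperty.prop_of_isZero _ ((heart_isZero_iff X).2 ?_)
    rw [IsZero.iff_id_eq_zero]
    refine ExtW.orth_left hX ?_ _
    rintro A (hA | ⟨p, hp, -⟩)
    · exact .of_isZero_left hA
    · exact hp.elim
  · intro F s hF hF' hs hmax ih X hX
    have key : ∀ X : HeartCat t, W.DF (F \ {s}) X.obj → serreHull (W.sigs t {p | p.1 ∈ F}) X :=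
      fun X hX => ht.serreHull_sigs_mono (fun p hp => hp.1) (ih X hX)
    have hnab : ∀ u ∈ F, ∀ n, serreHull (W.sigs t {p | p.1 ∈ F}) (ht.nabH u n) := by
      intro u hu n
      by_cases hus : u = s
      · subst hus
        obtain ⟨Z, hZ⟩ := ht.exists_sig u n
        obtain ⟨K, Q, k, p, i, q, δ₁, δ₂, h₁, h₂, hK, hQ⟩ := ht.sig_tri hZ
        exact serre_ext_of_tri _ h₂ (fun Q hQ hP => hP _ ⟨(u, n), hs, hZ⟩)
          (key Q (W.DF_mono (Iio_subset_diff hF' hs) _ hQ))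
      · exact key _ (W.nab_mem_DF' (F := F \ {s}) ⟨hu, hus⟩ n)
    refine serre_of_extW_shiftsOf _ (extW_mono (familyProp_le fun p hp => ?_) _ hX)
    exact shiftsOf_mem (b := ht.nabH p.1 p.2.1) (hnab _ hp _) (Set.mem_univ _)

theorem serre_univ (X : HeartCat t) : serreHull (W.sigs t Set.univ) X := by
  obtain ⟨F, hF, hF', hX⟩ := W.exists_finite_DF X.obj
  exact ht.serreHull_sigs_mono (Set.subset_univ _) (ht.serre_of_DF hF hF' hX)

end StdSystem.Assoc

end

section Eff

variable {D : Type*} [Category* D] [Preadditive D] [HasZeroObject D] [HasShift D ℤ]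
  [∀ n : ℤ, (shiftFunctor D n).Additive]

theorem shiftAddIso_naturality {X Y : D} (f : X ⟶ Y) (a b c : ℤ) (h : a + b = c) :
    f⟦a⟧'⟦b⟧' ≫ (shiftAddIso Y a b c h).hom = (shiftAddIso X a b c h).hom ≫ f⟦c⟧' :=
  (shiftFunctorAdd' D a b c h).inv.naturality f

theorem exists_unshift {K Y : D} {d d' : ℤ} (h : d' + 1 = d) (ψ : K⟦(1 : ℤ)⟧ ⟶ Y⟦d⟧) :
    ∃ g : K ⟶ Y⟦d'⟧, ψ = g⟦(1 : ℤ)⟧' ≫ (shiftAddIso Y d' 1 d h).hom := by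
  obtain ⟨g, hg⟩ := (shiftFunctor D (1 : ℤ)).map_surjective (ψ ≫ (shiftAddIso Y d' 1 d h).inv)
  exact ⟨g, by simp [hg]⟩

variable [Pretriangulated D]

/-- A morphism of degree `d` that dies after the first morphism of a triangle is controlled by a
morphism of degree `d - 1`. -/
theorem exists_connecting {A X C : D} {j : A ⟶ X} {c : X ⟶ C} {δ : C ⟶ A⟦(1 : ℤ)⟧}
    (hT : Triangle.mk j c δ ∈ distTriang D) {d d' : ℤ} (hd : d' + 1 = d) {Y : D}
    (f : Y ⟶ A⟦d⟧) (hf : f ≫ j⟦d⟧' = 0) :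
    ∃ ψ : Y ⟶ C⟦d'⟧, ∀ (Y' : D) (p : Y' ⟶ Y), p ≫ ψ = 0 → p ≫ f = 0 := by
  obtain ⟨w, hT'⟩ := tri_shift hT d'
  obtain ⟨ψ, hψ⟩ := tri_lift₁ hT' (f ≫ (shiftAddIso _ _ _ _ hd).inv) (by
    rw [← cancel_mono (shiftAddIso _ _ _ _ hd).hom, Category.assoc, Category.assoc,
      shiftAddIso_naturality, Iso.inv_hom_id_assoc, hf, zero_comp])
  refine ⟨ψ, fun Y' p hp => ?_⟩
  rw [← cancel_mono (shiftAddIso _ _ _ _ hd).inv, Category.assoc, hψ, ← Category.assoc, hp,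
    zero_comp, zero_comp]

variable [IsTriangulated D] {t : TStructure D}

variable (Q : ObjectProperty (HeartCat t))

/-- Morphisms of degree `d` from `X` to objects of `Q` are effaced by epimorphisms in `Q`. -/
def EpiEff (d : ℤ) (X : HeartCat t) : Prop :=
  ∀ (Y : HeartCat t) (f : X.obj ⟶ Y.obj⟦d⟧), Q Y →
    ∃ (X' : HeartCat t) (p : X' ⟶ X), Q X' ∧ Epi p ∧ p.hom ≫ f = 0

/-- Morphisms of degree `d` from `X` to objects of `Q` are effaced by monomorphisms in `Q`. -/
def MonoEff (d : ℤ) (X : HeartCat t) : Prop :=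
  ∀ (Y : HeartCat t) (f : X.obj ⟶ Y.obj⟦d⟧), Q Y →
    ∃ (Y' : HeartCat t) (j : Y ⟶ Y'), Q Y' ∧ Mono j ∧ f ≫ j.hom⟦d⟧' = 0

variable {Q} [Q.IsSerreClass]

/-- A morphism of degree one defines an extension in the heart. -/
theorem heart_extension {X Y : HeartCat t} (f : X.obj ⟶ Y.obj⟦(1 : ℤ)⟧) (hX : Q X) (hY : Q Y) :
    ∃ (E : HeartCat t) (j : Y ⟶ E) (p : E ⟶ X), Q E ∧
      Triangle.mk j.hom p.hom f ∈ distTriang D := by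
  obtain ⟨Z, a, b, hT⟩ := distinguished_cocone_triangle₂ f
  have hZ : t.heart Z := heart_ext hT Y.property X.property
  exact ⟨⟨Z, hZ⟩, ObjectProperty.homMk a, ObjectProperty.homMk b,
    serre_ext_of_tri Q (X := ⟨Z, hZ⟩) (f := ObjectProperty.homMk a) (g := ObjectProperty.homMk b)
      hT hY hX, hT⟩

theorem epiEff_one {X : HeartCat t} (hX : Q X) : EpiEff Q 1 X := by
  intro Y f hY
  obtain ⟨E, j, p, hE, hT⟩ := heart_extension f hX hY
  exact ⟨E, p, hE, heart_epi_of_tri hT, tri_comp₂₃ hT⟩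

theorem monoEff_one {X : HeartCat t} (hX : Q X) : MonoEff Q 1 X := by
  intro Y f hY
  obtain ⟨E, j, p, hE, hT⟩ := heart_extension f hX hY
  exact ⟨E, j, hE, heart_mono_of_tri hT, tri_comp₃₁ hT⟩

theorem serre_ker_of_tri {A X B : HeartCat t} {f : A ⟶ X} {g : X ⟶ B}
    {δ : B.obj ⟶ A.obj⟦(1 : ℤ)⟧} (hT : Triangle.mk f.hom g.hom δ ∈ distTriang D) (hX : Q X) :
    Q A := by
  have := heart_mono_of_tri hT
  exact Q.prop_of_mono f hX

theorem serre_coker_of_tri {A X B : HeartCat t} {f : A ⟶ X} {g : X ⟶ B}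
    {δ : B.obj ⟶ A.obj⟦(1 : ℤ)⟧} (hT : Triangle.mk f.hom g.hom δ ∈ distTriang D) (hX : Q X) :
    Q B := by
  have := heart_epi_of_tri hT
  exact Q.prop_of_epi g hX

/-- A morphism of degree `d` that factors through a connecting morphism is effaced by a
monomorphism when morphisms of degree `d - 1` are. -/
theorem monoEff_connecting {K Y : HeartCat t} {X : D} {d d' : ℤ} (hd : d' + 1 = d)
    (hK : MonoEff Q d' K) (hY : Q Y) (δ : X ⟶ K.obj⟦(1 : ℤ)⟧) (ψ : K.obj⟦(1 : ℤ)⟧ ⟶ Y.obj⟦d⟧) :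
    ∃ (Y' : HeartCat t) (j : Y ⟶ Y'), Q Y' ∧ Mono j ∧ (δ ≫ ψ) ≫ j.hom⟦d⟧' = 0 := by
  obtain ⟨g, rfl⟩ := exists_unshift hd ψ
  obtain ⟨Y', j, hY', hj, h⟩ := hK Y g hY
  refine ⟨Y', j, hY', hj, ?_⟩
  rw [Category.assoc, Category.assoc, ← shiftAddIso_naturality, ← Functor.map_comp_assoc, h]
  simp

theorem monoEff_of_epiEff {d d' : ℤ} (hd : d' + 1 = d) (h' : ∀ X, Q X → MonoEff Q d' X)
    {X : HeartCat t} (h : EpiEff Q d X) : MonoEff Q d X := by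
  intro Y f hY
  obtain ⟨X', p, hX', hp, hpf⟩ := h Y f hY
  obtain ⟨K, k, δ, hT⟩ := heart_exists_tri_of_epi p
  obtain ⟨ψ, rfl⟩ := tri_desc₃ hT f hpf
  exact monoEff_connecting hd (h' K (serre_ker_of_tri hT hX')) hY δ ψ

theorem epiEff_of_monoEff {d d' : ℤ} (hd : d' + 1 = d)
    {X : HeartCat t} (h' : EpiEff Q d' X) (h : MonoEff Q d X) : EpiEff Q d X := by
  intro Y f hY
  obtain ⟨Y', j, hY', hj, hjf⟩ := h Y f hY
  obtain ⟨C, c, δ, hT⟩ := heart_exists_tri_of_mono j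
  obtain ⟨ψ, hψ⟩ := exists_connecting hT hd f hjf
  obtain ⟨X', p, hX', hp, hpψ⟩ := h' C ψ (serre_coker_of_tri hT hY')
  exact ⟨X', p, hX', hp, hψ _ _ hpψ⟩

theorem monoEff_ext {d : ℤ} {A X B : HeartCat t} {a : A ⟶ X} {b : X ⟶ B}
    {δ : B.obj ⟶ A.obj⟦(1 : ℤ)⟧} (hT : Triangle.mk a.hom b.hom δ ∈ distTriang D)
    (hA : MonoEff Q d A) (hB : MonoEff Q d B) : MonoEff Q d X := by
  intro Y f hY
  obtain ⟨Y', j, hY', hj, hjf⟩ := hA Y (a.hom ≫ f) hY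
  rw [Category.assoc] at hjf
  obtain ⟨ψ, hψ⟩ := tri_desc hT _ hjf
  obtain ⟨Y₂, j', hY₂, hj', hjψ⟩ := hB Y' ψ hY'
  refine ⟨Y₂, j ≫ j', hY₂, mono_comp _ _, ?_⟩
  have : (j ≫ j').hom⟦d⟧' = j.hom⟦d⟧' ≫ j'.hom⟦d⟧' := Functor.map_comp _ _ _
  rw [this, ← Category.assoc, hψ, Category.assoc, hjψ, comp_zero]

theorem monoEff_quotient {d d' : ℤ} (hd : d' + 1 = d) {A X B : HeartCat t} {a : A ⟶ X}
    {b : X ⟶ B} {δ : B.obj ⟶ A.obj⟦(1 : ℤ)⟧} (hT : Triangle.mk a.hom b.hom δ ∈ distTriang D)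
    (hA : MonoEff Q d' A) (hX : MonoEff Q d X) : MonoEff Q d B := by
  intro Y f hY
  obtain ⟨Y', j, hY', hj, hjf⟩ := hX Y (b.hom ≫ f) hY
  rw [Category.assoc] at hjf
  obtain ⟨ψ, hψ⟩ := tri_desc₃ hT _ hjf
  obtain ⟨Y₂, j', hY₂, hj', hjψ⟩ := monoEff_connecting hd hA hY' δ ψ
  refine ⟨Y₂, j ≫ j', hY₂, mono_comp _ _, ?_⟩
  have : (j ≫ j').hom⟦d⟧' = j.hom⟦d⟧' ≫ j'.hom⟦d⟧' := Functor.map_comp _ _ _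
  rw [this, ← Category.assoc, hψ, hjψ]

/-- Effaceability follows from effaceability for a class of objects of which the objects
of a filtering class are quotients. -/
theorem epiEff_of_generators {P : ObjectProperty (HeartCat t)}
    (hQ : ∀ X, Q X → HasFiltration P X)
    (hP : ∀ Z, P Z → ∃ (X : HeartCat t) (p : X ⟶ Z), Q X ∧ Epi p ∧ ∀ d, 0 < d → EpiEff Q d X)
    (d : ℤ) (hd : 0 < d) (X : HeartCat t) (hX : Q X) : EpiEff Q d X := by
  obtain ⟨n, rfl⟩ : ∃ n : ℕ, d = n + 1 := ⟨(d - 1).toNat, by lia⟩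
  suffices ∀ X, Q X → EpiEff Q ((n : ℤ) + 1) X ∧ MonoEff Q ((n : ℤ) + 1) X from (this X hX).1
  clear hX hd X
  induction n with
  | zero =>
    intro X hX
    exact ⟨epiEff_one hX, monoEff_one hX⟩
  | succ n ih =>
    have hn : (n : ℤ) + 1 + 1 = ((n + 1 : ℕ) : ℤ) + 1 := by lia
    have hM : ∀ X, Q X → MonoEff Q (((n + 1 : ℕ) : ℤ) + 1) X := by
      intro X hX
      induction hQ X hX with
      | zero X hX' =>
        intro Y f hY
        exact ⟨Y, 𝟙 Y, hY, inferInstance,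
          ((heart_isZero_iff X).1 hX').eq_of_src _ _⟩
      | step K hK h₁ h₃ ih' =>
        have := hK.mono_f
        have := hK.epi_g
        obtain ⟨δ, hT⟩ := heart_tri_of_shortExact hK
        refine monoEff_ext hT (ih' (Q.prop_of_mono K.f hX)) ?_
        obtain ⟨X', p, hX', hp, hd⟩ := hP _ h₃
        obtain ⟨A, a, δ', hT'⟩ := heart_exists_tri_of_epi p
        exact monoEff_quotient hn hT' (ih A (serre_ker_of_tri hT' hX')).2
          (monoEff_of_epiEff hn (fun X hX => (ih X hX).2) (hd _ (by lia)))
    intro X hX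
    exact ⟨epiEff_of_monoEff hn (ih X hX).1 (hM X hX), hM X hX⟩

end Eff

section

variable {D : Type*} [Category* D] [Preadditive D] [HasZeroObject D] [HasShift D ℤ]
  [∀ n : ℤ, (shiftFunctor D n).Additive] [Pretriangulated D] [IsTriangulated D]
  {S : Type*} [PartialOrder S] {W : StdSystem D S} {t : TStructure D}

namespace StdSystem

local notation P " ∗ " Q => ObjectProperty.extensionProduct P Q

variable (W)

/-- Iterated extensions of standard objects of index `s` and weight in `I`. -/
abbrev delW (s : S) (I : Set ℤ) : ObjectProperty D := extW (familyProp (W.del s) I)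

/-- Iterated extensions of costandard objects of index `s` and weight in `I`. -/
abbrev nabW (s : S) (I : Set ℤ) : ObjectProperty D := extW (familyProp (W.nab s) I)

variable {W}

theorem DF_orth_nabW {F : Set S} {s : S} (hs : ∀ u ∈ F, ¬ s ≤ u) {I : Set ℤ} {C Z : D}
    (hC : W.DF F C) (hZ : W.nabW s I Z) (i : ℤ) : Orth C (Z⟦i⟧) := by
  refine Orth.shift_right (c := -i) (ExtW.orth_right hZ ?_) i (by lia)
  rintro A (hA | ⟨n, -, ⟨e⟩⟩)
  · exact .of_isZero_right hA
  · exact (W.DF_orth_nab ((W.DF F).le_shift (-i) _ hC) hs n 0).of_iso (Iso.refl _)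
      ((shiftZeroIso _).trans e.symm)

theorem delW_orth_DF {F : Set S} {s : S} (hs : s ∉ F) {I : Set ℤ} {M G : D}
    (hM : W.delW s I M) (hG : W.DF F G) : Orth M G := by
  refine ExtW.orth_left hM ?_
  rintro A (hA | ⟨n, -, ⟨e⟩⟩)
  · exact .of_isZero_left hA
  · exact (W.del_orth_DF' hG hs n).of_iso e.symm (Iso.refl _)

theorem delW_orth_del {s : S} {I : Set ℤ} {m : ℤ} (hm : m ∉ I) {M : D} (hM : W.delW s I M) :
    Orth M (W.del s m) := by
  refine ExtW.orth_left hM ?_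
  rintro A (hA | ⟨n, hn, ⟨e⟩⟩)
  · exact .of_isZero_left hA
  · exact (del_zero (W := W) (s := s) (n := n) (m := m) (fun h => hm (h ▸ hn))).of_iso e.symm
      (Iso.refl _)

theorem delW_orth_nabW {s : S} {I J : Set ℤ} (hIJ : ∀ i ∈ I, ∀ j ∈ J, i < j) {M Z : D}
    (hM : W.delW s I M) (hZ : W.nabW s J Z) {d : ℤ} (hd : 0 ≤ d) : Orth M (Z⟦d⟧) := by
  refine ExtW.orth_left hM ?_
  rintro A (hA | ⟨n, hn, ⟨e⟩⟩)
  · exact .of_isZero_left hA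
  refine Orth.of_iso (Y := Z⟦d⟧) ?_ e.symm (Iso.refl _)
  refine Orth.shift_right (c := -d) (ExtW.orth_right hZ ?_) d (by lia)
  rintro B (hB | ⟨m, hm, ⟨e'⟩⟩)
  · exact .of_isZero_right hB
  refine Orth.of_iso (Y := W.nab s m) (Orth.shift_left (c := d) ?_ (-d) (by lia)) (Iso.refl _)
    e'.symm
  have hnm := hIJ n hn m hm
  rcases hd.lt_or_eq with h | h
  · exact W.orth_del_nab_of_orth (W.mixed s n m d h hnm.le)
  · subst h
    exact (orth_del_nab_zero (fun h => hnm.ne (Prod.mk.inj h).2)).of_iso (Iso.refl _)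
      (shiftZeroIso _).symm

/-- Sorting by weights. -/
theorem delW_sort {s : S} {I J K : Set ℤ} (hIJ : ∀ i ∈ I, ∀ j ∈ J, i ≤ j) (hK : K ⊆ I ∪ J) :
    W.delW s K ≤ (W.delW s I ∗ W.delW s J) := by
  refine (extW_mono ((familyProp_mono _ hK).trans (familyProp_union _ _ _))).trans
    (extW_sup_le (familyProp_swap ?_))
  intro i hi j hj f
  exact .inl (orth_del_of_orth_nab (W.mixed s i j 1 one_pos (hIJ i hi j hj)) f)

/-- The cocone of a nonzero morphism from an iterated extension of standard objects to a standard
object is again such an iterated extension. -/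
theorem delW_cocone {s : S} {I : Set ℤ} {m : ℤ} {M : D} (hM : W.delW s I M)
    (h : M ⟶ W.del s m) (hh : h ≠ 0) :
    ∃ (N : D) (k : N ⟶ M) (δ : W.del s m ⟶ N⟦(1 : ℤ)⟧),
      Triangle.mk k h δ ∈ distTriang D ∧ W.delW s I N := by
  induction hM with
  | zero M hM => exact (hh (hM.eq_of_src _ _)).elim
  | @step A M B f g δ hT hA hB ih =>
    by_cases hfh : f ≫ h = 0
    · obtain ⟨h₁, rfl⟩ := tri_desc hT h hfh
      have h₁0 : h₁ ≠ 0 := fun h0 => hh (by rw [h0, comp_zero])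
      have : IsIso h₁ := by
        rcases hB with hB | ⟨n, hn, ⟨e⟩⟩
        · exact (h₁0 (hB.eq_of_src _ _)).elim
        · have h₂ : e.inv ≫ h₁ ≠ 0 := fun h0 => h₁0 (by
            rw [← cancel_epi e.inv, h0, comp_zero])
          obtain rfl : n = m := by
            by_contra hnm
            exact h₂ (del_zero hnm _)
          have := del_isIso s n _ h₂
          exact IsIso.of_isIso_comp_left e.inv h₁
      exact ⟨_, _, _, tri_iso₃ hT (asIso h₁), hA⟩
    · obtain ⟨N, k, δ', hT', hN⟩ := ih (f ≫ h) hfh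
      obtain ⟨C, v, w, hT₂⟩ := distinguished_cocone_triangle h
      have O := someOctahedron rfl hT hT₂ (tri_rot hT')
      obtain ⟨z, hO⟩ := tri_shift (tri_rot O.mem) (-1)
      obtain ⟨u', v', hT₃⟩ := tri_invRot hT₂
      refine ⟨_, _, _, hT₃, ?_⟩
      refine extW_extensionProduct _ _ ⟨_, _, _, _, _, hO, ?_, ?_⟩
      · exact (W.delW s I).prop_of_iso
          ((shiftAddIso N 1 (-1) 0 (by lia)).trans (shiftZeroIso _)).symm hN
      · exact (W.delW s I).prop_of_iso
          ((shiftAddIso B 1 (-1) 0 (by lia)).trans (shiftZeroIso _)).symm (le_extW _ _ hB)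

variable (W) in
/-- Effaceability of the morphisms of positive degree between costandard objects of the same
index, by morphisms from iterated extensions of standard objects. -/
def CostandardEff : Prop :=
  ∀ (s : S) (m d : ℤ) (Z : D) (g : W.nab s m ⟶ Z⟦d⟧), 0 < d → W.nabW s Set.univ Z →
    ∃ (M : D) (h : M ⟶ W.nab s m), W.delW s Set.univ M ∧ h ≠ 0 ∧ h ≫ g = 0

theorem CostandardEff.exists_delW (H : W.CostandardEff) {s : S} {I : Set ℤ}
    (hI : I.OrdConnected) {m d : ℤ} (hm : m ∈ I) (hd : 0 < d) {Z : D} (hZ : W.nabW s I Z)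
    (f : W.del s m ⟶ Z⟦d⟧) :
    ∃ (M : D) (h : M ⟶ W.del s m), W.delW s I M ∧ h ≠ 0 ∧ h ≫ f = 0 := by
  obtain ⟨C, c, k, hT, hC⟩ := W.exists_cone s m
  obtain ⟨a, b, hT'⟩ := tri_invRot hT
  obtain ⟨g, rfl⟩ := tri_desc hT' f (DF_orth_nabW (F := Set.Iio s) (fun u hu => not_le_of_gt hu)
    ((W.DF _).le_shift (-1) _ hC) hZ d _)
  obtain ⟨M, h, hM, hh, hhg⟩ := H s m d Z g hd (extW_mono (familyProp_mono _ (Set.subset_univ _)) _ hZ)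
  obtain ⟨h', rfl⟩ := exists_lift_io
    (fun C hC => delW_orth_DF (F := Set.Iio s) (fun h => lt_irrefl s h) hM hC) h
  rw [Category.assoc] at hhg
  generalize W.io s m ≫ g = f at hhg ⊢
  have hh' : h' ≠ 0 := fun h0 => hh (by rw [h0, zero_comp])
  clear hh
  obtain ⟨L, R, a, b, δ, hT₁, hL, hR⟩ := delW_sort (W := W) (s := s) (I := {n | n ∉ I ∧ n < m})
    (J := {n | n ∈ I ∨ m < n})
    (by
      rintro i ⟨hi, him⟩ j (hj | hj)
      · by_contra! hji
        exact hi (hI.out hj hm ⟨hji.le, him.le⟩)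
      · exact (him.trans hj).le)
    (by
      intro n _
      by_cases h : n ∈ I
      · exact .inr (.inl h)
      · rcases lt_trichotomy n m with h' | h' | h'
        · exact .inl ⟨h, h'⟩
        · exact (h (h' ▸ hm)).elim
        · exact .inr (.inr h')) _ hM
  obtain ⟨h₁, rfl⟩ := tri_desc hT₁ h' (delW_orth_del (fun h => h.1 hm) hL _)
  have hh₁ : h₁ ≠ 0 := fun h0 => hh' (by rw [h0, comp_zero])
  have hf₁ : h₁ ≫ f = 0 := by
    rw [Category.assoc] at hhg
    obtain ⟨ψ, hψ⟩ := tri_desc₃ hT₁ _ hhg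
    have : Orth (L⟦(1 : ℤ)⟧) (Z⟦d⟧) := by
      refine (delW_orth_nabW (J := I) ?_ hL hZ (d := d - 1) (by lia)).shift_shift 1 d (by lia)
      rintro i ⟨hi, him⟩ j hj
      by_contra! hji
      exact hi (hI.out hj hm ⟨hji, him.le⟩)
    rw [hψ, this ψ, comp_zero]
  obtain ⟨M', U, a', b', δ', hT₂, hM', hU⟩ := delW_sort (W := W) (s := s) (I := I)
    (J := {n | n ∉ I ∧ m < n})
    (by
      rintro i hi j ⟨hj, hmj⟩
      by_contra! hji
      exact hj (hI.out hm hi ⟨hmj.le, hji.le⟩))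
    (by
      rintro n hn
      by_cases h : n ∈ I
      · exact .inl h
      · exact .inr ⟨h, hn.resolve_left h⟩) _ hR
  refine ⟨M', a' ≫ h₁, hM', fun h0 => ?_, by rw [Category.assoc, hf₁, comp_zero]⟩
  obtain ⟨h₂, rfl⟩ := tri_desc hT₂ h₁ h0
  exact hh₁ (by rw [delW_orth_del (fun h => h.1 hm) hU h₂, comp_zero])

namespace Assoc

variable (ht : W.Assoc t)

include ht

theorem nabW_serre {Q : ObjectProperty (HeartCat t)} [Q.IsSerreClass] {s : S} {I : Set ℤ}
    (hQ : ∀ n ∈ I, Q (ht.nabH s n)) {Z : D} (hZ : W.nabW s I Z) : heartProp Q Z := by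
  refine extW_serre Q ?_ hZ
  rintro Y (hY | ⟨n, hn, ⟨e⟩⟩)
  · exact ⟨t.heart.prop_of_isZero hY, Q.prop_of_isZero ((heart_isZero_iff _).2 hY)⟩
  · have hY : t.heart Y := t.heart.prop_of_iso e.symm (ht.nab_heart s n)
    exact ⟨hY, Q.prop_of_iso (t.heart.isoMk (X := ht.nabH s n) (Y := ⟨Y, hY⟩) e.symm) (hQ n hn)⟩

theorem delW_serre {Q : ObjectProperty (HeartCat t)} [Q.IsSerreClass] {s : S} {I : Set ℤ}
    (hQ : ∀ n ∈ I, Q (ht.delH s n)) {Z : D} (hZ : W.delW s I Z) : heartProp Q Z := by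
  refine extW_serre Q ?_ hZ
  rintro Y (hY | ⟨n, hn, ⟨e⟩⟩)
  · exact ⟨t.heart.prop_of_isZero hY, Q.prop_of_isZero ((heart_isZero_iff _).2 hY)⟩
  · have hY : t.heart Y := t.heart.prop_of_iso e.symm (ht.del_heart s n)
    exact ⟨hY, Q.prop_of_iso (t.heart.isoMk (X := ht.delH s n) (Y := ⟨Y, hY⟩) e.symm) (hQ n hn)⟩

/-- Standard objects of maximal index have effaceable morphisms. -/
theorem del_epiEff (H : W.CostandardEff) {Q : ObjectProperty (HeartCat t)} [Q.IsSerreClass]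
    {F : Set S} {s : S} (hs : s ∉ F) {I : Set ℤ} (hI : I.OrdConnected)
    (hdel : ∀ n ∈ I, Q (ht.delH s n))
    (hQ : ∀ Y, Q Y → (W.DF F ∗ W.nabW s I) Y.obj) {m : ℤ} (hm : m ∈ I) {d : ℤ} (hd : 0 < d) :
    EpiEff Q d (ht.delH s m) := by
  intro Y f hY
  obtain ⟨G, Z, a, b, c, hT, hG, hZ⟩ := hQ Y hY
  obtain ⟨M, h, hM, hh, hhf⟩ := H.exists_delW hI hm hd hZ (f ≫ b⟦d⟧')
  obtain ⟨N, k, δ, hT', hN⟩ := delW_cocone hM h hh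
  obtain ⟨hM', hQM⟩ := ht.delW_serre hdel hM
  obtain ⟨hN', hQN⟩ := ht.delW_serre hdel hN
  let h' : (⟨M, hM'⟩ : HeartCat t) ⟶ ht.delH s m := ObjectProperty.homMk h
  let k' : (⟨N, hN'⟩ : HeartCat t) ⟶ ⟨M, hM'⟩ := ObjectProperty.homMk k
  refine ⟨_, h', hQM, heart_epi_of_tri (f := k') (g := h') (δ := δ) hT', ?_⟩
  change h ≫ f = 0
  obtain ⟨w, hT₂⟩ := tri_shift hT d
  obtain ⟨ψ, hψ⟩ := tri_lift hT₂ (h ≫ f) (by rw [Category.assoc, hhf])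
  rw [hψ, delW_orth_DF hs hM ((W.DF F).le_shift d _ hG) ψ, zero_comp]

/-- Objects of the lower part have effaceable morphisms, if this holds inside the lower part. -/
theorem DF_epiEff {Q Q' : ObjectProperty (HeartCat t)} [Q.IsSerreClass] [Q'.IsSerreClass]
    {F : Set S} (hF : F.Finite) (hF' : IsLowerSet F) {s : S} (hs : ∀ u ∈ F, ¬ s ≤ u)
    {I : Set ℤ} (hQ' : ∀ X, Q' X ↔ Q X ∧ W.DF F X.obj)
    (hE : ∀ (d : ℤ), 0 < d → ∀ X, Q' X → EpiEff Q' d X) (hnab : ∀ n ∈ I, Q (ht.nabH s n))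
    (hQ : ∀ Y, Q Y → (W.DF F ∗ W.nabW s I) Y.obj) {X : HeartCat t} (hX : Q' X) {d : ℤ}
    (hd : 0 < d) : EpiEff Q d X := by
  by_cases hd1 : d = 1
  · subst hd1
    exact epiEff_one ((hQ' X).1 hX).1
  intro Y f hY
  obtain ⟨G, Z, a, b, c, hT, hG, hZ⟩ := hQ Y hY
  obtain ⟨hZ', hQZ⟩ := ht.nabW_serre hnab hZ
  let φ : Y ⟶ ⟨Z, hZ'⟩ := ObjectProperty.homMk b
  obtain ⟨K, k, δ₁, h₁⟩ := heart_exists_tri_of_epi (Abelian.factorThruImage φ)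
  obtain ⟨C, q, δ₂, h₂⟩ := heart_exists_tri_of_mono (Abelian.image.ι φ)
  have hφ : (Abelian.factorThruImage φ).hom ≫ (Abelian.image.ι φ).hom = b :=
    congrArg (fun f => f.hom) (Abelian.image.fac φ)
  obtain ⟨hK, hC⟩ := ht.DF_ker_coker hF hF' h₁ h₂ hφ (tri_rot hT) ((W.DF F).le_shift 1 _ hG)
  have hK' : Q' K := (hQ' K).2 ⟨serre_ker_of_tri h₁ hY, hK⟩
  have hC' : Q' C := (hQ' C).2 ⟨serre_coker_of_tri h₂ hQZ, hC⟩
  obtain ⟨ψ, hψ⟩ := exists_connecting h₂ (d := d) (d' := d - 1) (by lia)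
    (f ≫ (Abelian.factorThruImage φ).hom⟦d⟧') (by
      rw [Category.assoc, ← Functor.map_comp, hφ]
      exact DF_orth_nabW hs ((hQ' X).1 hX).2 hZ d _)
  obtain ⟨X₁, p₁, hX₁, hp₁, hpψ⟩ := hE (d - 1) (by lia) X hX C ψ hC'
  have h₃ := hψ _ _ hpψ
  obtain ⟨w, hT₂⟩ := tri_shift h₁ d
  obtain ⟨f', hf'⟩ := tri_lift hT₂ (p₁.hom ≫ f) (by rw [Category.assoc]; exact h₃)
  obtain ⟨X₂, p₂, hX₂, hp₂, hpf⟩ := hE d hd X₁ hX₁ K f' hK'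
  refine ⟨X₂, p₂ ≫ p₁, ((hQ' X₂).1 hX₂).1, epi_comp _ _, ?_⟩
  change (p₂.hom ≫ p₁.hom) ≫ f = 0
  rw [Category.assoc, hf', ← Category.assoc, hpf, zero_comp]

theorem sig_index_mem {F : Set S} {s : S} {n : ℤ} {Z : HeartCat t} (h : W.Sig t s n Z)
    (hZ : W.DF F Z.obj) : s ∈ F := by
  by_contra hs
  have h0 := h.ne_zero
  obtain ⟨hd, hn, p, i, hp, hi, hpi⟩ := h
  have : p = 0 := ObjectProperty.hom_ext _ (W.del_orth_DF' hZ hs n _)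
  exact h0 (IsZero.of_epi_eq_zero p this)

theorem serre_inter_iff {F : Set S} (hF : F.Finite) (hF' : IsLowerSet F) (Xi : Set (S × ℤ))
    (X : HeartCat t) : serreHull (W.sigs t {p | p ∈ Xi ∧ p.1 ∈ F}) X ↔
      serreHull (W.sigs t Xi) X ∧ W.DF F X.obj := by
  constructor
  · intro h
    exact ⟨ht.serreHull_sigs_mono (fun p hp => hp.1) h,
      ht.serre_le_DF hF' (ht.serreHull_sigs_mono (fun p hp => hp.2) h)⟩
  · rintro ⟨h, hX⟩
    replace hX := ht.serre_of_DF hF hF' hX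
    rw [ht.serreHull_iff] at h
    induction h with
    | zero X h => exact ObjectProperty.prop_of_isZero _ h
    | step K hK h₁ h₃ ih =>
      have := hK.mono_f
      have := hK.epi_g
      refine ObjectProperty.prop_X₂_of_shortExact _ hK
        (ih (ObjectProperty.prop_of_mono _ K.f hX)) ?_
      obtain ⟨p, hp, hpK⟩ := h₃
      exact fun Q hQ hle => hle _ ⟨p, ⟨hp, ht.sig_index_mem hpK
        (ht.serre_le_DF hF' (ObjectProperty.prop_of_epi _ K.g hX))⟩, hpK⟩

theorem serre_le_nabW {F : Set S} (hF : IsLowerSet F) {s : S} (hs : s ∈ F)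
    (hmax : ∀ u ∈ F, ¬ s < u) {Xi : Set (S × ℤ)} {Y : HeartCat t}
    (hY : serreHull (W.sigs t {p | p ∈ Xi ∧ p.1 ∈ F}) Y) :
    (W.DF (F \ {s}) ∗ W.nabW s {n | (s, n) ∈ Xi}) Y.obj := by
  rw [ht.serreHull_iff, hasFiltration_iff_extW] at hY
  have hle : heartProp (W.sigs t {p | p ∈ Xi ∧ p.1 ∈ F}) ≤
      extW (W.DF (F \ {s}) ⊔ familyProp (W.nabS s) {p | (s, p.1) ∈ Xi ∧ p.2 = 0}) := by
    rintro Z ⟨hZ, ⟨u, n⟩, ⟨hu, huF⟩, h⟩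
    by_cases hus : u = s
    · subst hus
      obtain ⟨K, Q, k, p, i, q, δ₁, δ₂, h₁, h₂, hK, hQ⟩ := ht.sig_tri h
      obtain ⟨v, w, hT⟩ := tri_invRot h₂
      refine extensionProduct_le_extW_sup _ _ _ ⟨_, _, _, _, _, hT, ?_, ?_⟩
      · exact W.DF_mono (Iio_subset_diff hF hs) _ ((W.DF _).le_shift (-1) _ hQ)
      · exact .inr ⟨(n, 0), ⟨hu, rfl⟩, ⟨(shiftZeroIso _).symm⟩⟩
    · exact le_extW _ _ (.inl (ht.sig_mem_DF (isLowerSet_diff_maximal hF hmax) ⟨huF, hus⟩ h))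
  have := W.extW_DF_nabS (not_le_of_maximal hmax) _ _ (extW_le_extW hle _ hY)
  refine extensionProduct_mono le_rfl (extW_mono ?_) _ this
  rintro Z (hZ | ⟨⟨n, i⟩, ⟨hn, hi⟩, ⟨e⟩⟩)
  · exact .inl hZ
  · obtain rfl : i = 0 := hi
    exact .inr ⟨n, hn, ⟨e.trans (shiftZeroIso _)⟩⟩

theorem epiEff_of_finite (H : W.CostandardEff) {Xi : Set (S × ℤ)}
    (hnab : ∀ p ∈ Xi, serreHull (W.sigs t Xi) (ht.nabH p.1 p.2))
    (hdel : ∀ p ∈ Xi, serreHull (W.sigs t Xi) (ht.delH p.1 p.2))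
    (hint : ∀ s, {n : ℤ | (s, n) ∈ Xi}.OrdConnected) (F : Set S) (hF : F.Finite)
    (hF' : IsLowerSet F) (d : ℤ) (hd : 0 < d) (X : HeartCat t)
    (hX : serreHull (W.sigs t {p | p ∈ Xi ∧ p.1 ∈ F}) X) :
    EpiEff (serreHull (W.sigs t {p | p ∈ Xi ∧ p.1 ∈ F})) d X := by
  refine finite_lowerSet_induction (motive := fun F => ∀ d : ℤ, 0 < d → ∀ X : HeartCat t,
    serreHull (W.sigs t {p | p ∈ Xi ∧ p.1 ∈ F}) X →
    EpiEff (serreHull (W.sigs t {p | p ∈ Xi ∧ p.1 ∈ F})) d X) ?_ ?_ F hF hF' d hd X hX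
  · intro d hd X hX Y f hY
    refine ⟨X, 𝟙 X, hX, inferInstance, ?_⟩
    have : W.DF ∅ X.obj := ((ht.serre_inter_iff Set.finite_empty isLowerSet_empty Xi X).1 hX).2
    refine ExtW.orth_left this ?_ _
    rintro A (hA | ⟨p, hp, -⟩)
    · exact .of_isZero_left hA
    · exact hp.elim
  · intro F s hF hF' hs hmax ih
    have hG : (F \ {s}).Finite := hF.subset Set.sdiff_subset
    have hG' : IsLowerSet (F \ {s}) := isLowerSet_diff_maximal hF' hmax
    have hIff := fun X => ht.serre_inter_iff hF hF' Xi X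
    have hIff' : ∀ X, serreHull (W.sigs t {p | p ∈ Xi ∧ p.1 ∈ F \ {s}}) X ↔
        serreHull (W.sigs t {p | p ∈ Xi ∧ p.1 ∈ F}) X ∧ W.DF (F \ {s}) X.obj := by
      intro X
      rw [ht.serre_inter_iff hG hG' Xi X, hIff X]
      exact ⟨fun h => ⟨⟨h.1, W.DF_mono Set.sdiff_subset _ h.2⟩, h.2⟩, fun h => ⟨h.1.1, h.2⟩⟩
    have hdec := fun (Y : HeartCat t) hY => ht.serre_le_nabW (Xi := Xi) (Y := Y) hF' hs hmax hY
    have hnab' : ∀ n ∈ {n | (s, n) ∈ Xi},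
        serreHull (W.sigs t {p | p ∈ Xi ∧ p.1 ∈ F}) (ht.nabH s n) := fun n hn =>
      (hIff _).2 ⟨hnab (s, n) hn, W.nab_mem_DF' hs n⟩
    have hdel' : ∀ n ∈ {n | (s, n) ∈ Xi},
        serreHull (W.sigs t {p | p ∈ Xi ∧ p.1 ∈ F}) (ht.delH s n) := fun n hn =>
      (hIff _).2 ⟨hdel (s, n) hn,
        (W.DF F).prop_of_iso (shiftZeroIso _) (W.del_mem_DF hF' hs n 0)⟩
    intro d hd X hX
    refine epiEff_of_generators (P := W.sigs t {p | p ∈ Xi ∧ p.1 ∈ F})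
      (fun X hX => (ht.serreHull_iff _ X).1 hX) ?_ d hd X hX
    rintro Z ⟨⟨u, n⟩, ⟨hu, huF⟩, hZ⟩
    by_cases hus : u = s
    · subst hus
      obtain ⟨K, Q, k, p, i, q, δ₁, δ₂, h₁, h₂, hK, hQ⟩ := ht.sig_tri hZ
      exact ⟨ht.delH u n, p, hdel' n hu, heart_epi_of_tri h₁, fun d hd =>
        ht.del_epiEff H (F := F \ {u}) (fun h => h.2 rfl) (hint u) hdel' hdec hu hd⟩
    · have hZ' : serreHull (W.sigs t {p | p ∈ Xi ∧ p.1 ∈ F \ {s}}) Z :=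
        fun Q hQ hle => hle _ ⟨(u, n), ⟨hu, huF, hus⟩, hZ⟩
      exact ⟨Z, 𝟙 Z, ((hIff' Z).1 hZ').1, inferInstance, fun d hd =>
        ht.DF_epiEff hG hG' (not_le_of_maximal hmax) hIff' ih hnab' hdec hZ' hd⟩

/-- Effaceability of the morphisms of positive degree in the Serre subcategory attached to a
convex set. -/
theorem epiEff_of_convex (H : W.CostandardEff) {Xi : Set (S × ℤ)}
    (hnab : ∀ p ∈ Xi, serreHull (W.sigs t Xi) (ht.nabH p.1 p.2))
    (hdel : ∀ p ∈ Xi, serreHull (W.sigs t Xi) (ht.delH p.1 p.2))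
    (hint : ∀ s, {n : ℤ | (s, n) ∈ Xi}.OrdConnected) (d : ℤ) (hd : 0 < d) (X : HeartCat t)
    (hX : serreHull (W.sigs t Xi) X) : EpiEff (serreHull (W.sigs t Xi)) d X := by
  intro Y f hY
  obtain ⟨F, hF, hF', hXF⟩ := W.exists_finite_DF X.obj
  obtain ⟨G, hG, hG', hYG⟩ := W.exists_finite_DF Y.obj
  have hFG := hF.union hG
  have hFG' := hF'.union hG'
  obtain ⟨X', p, hX', hp, hpf⟩ := ht.epiEff_of_finite H hnab hdel hint (F ∪ G) hFG hFG' d hd X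
    ((ht.serre_inter_iff hFG hFG' Xi X).2 ⟨hX, W.DF_mono Set.subset_union_left _ hXF⟩) Y f
    ((ht.serre_inter_iff hFG hFG' Xi Y).2 ⟨hY, W.DF_mono Set.subset_union_right _ hYG⟩)
  exact ⟨X', p, ((ht.serre_inter_iff hFG hFG' Xi X').1 hX').1, hp, hpf⟩

/-- The objects of the Serre subcategory generated by the simple objects of index at most `s` are
extensions of objects of the lower part by iterated extensions of standard objects. -/
theorem serre_le_delW {s : S} {Y : HeartCat t}
    (hY : serreHull (W.sigs t {p | p.1 ≤ s}) Y) :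
    (W.delW s Set.univ ∗ W.DF (Set.Iio s)) Y.obj := by
  rw [ht.serreHull_iff, hasFiltration_iff_extW] at hY
  have hle : heartProp (W.sigs t {p | p.1 ≤ s}) ≤
      extW (familyProp (W.delS s) {p | p.2 = 0} ⊔ W.DF (Set.Iio s)) := by
    rintro Z ⟨hZ, ⟨u, n⟩, hu, h⟩
    by_cases hus : u = s
    · subst hus
      obtain ⟨K, Q, k, p, i, q, δ₁, δ₂, h₁, h₂, hK, hQ⟩ := ht.sig_tri h
      refine extensionProduct_le_extW_sup _ _ _ ⟨_, _, _, _, _, tri_rot h₁, ?_, ?_⟩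
      · exact .inr ⟨(n, 0), rfl, ⟨(shiftZeroIso _).symm⟩⟩
      · exact (W.DF _).le_shift 1 _ hK
    · exact le_extW _ _ (.inr (ht.sig_mem_DF (isLowerSet_Iio s) (lt_of_le_of_ne hu hus) h))
  have := W.extW_DF_delS (F := Set.Iio s) (fun h => lt_irrefl s h) _ _ (extW_le_extW hle _ hY)
  refine extensionProduct_mono (extW_mono ?_) le_rfl _ this
  rintro Z (hZ | ⟨⟨n, i⟩, hi, ⟨e⟩⟩)
  · exact .inl hZ
  · obtain rfl : i = 0 := hi
    exact .inr ⟨n, trivial, ⟨e.trans (shiftZeroIso _)⟩⟩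

theorem exists_delW_of_epi {s : S} {m : ℤ} {Y : HeartCat t} (h : Y ⟶ ht.nabH s m) [Epi h]
    (hY : serreHull (W.sigs t {p | p.1 ≤ s}) Y) :
    ∃ (M : D) (a : M ⟶ Y.obj), W.delW s Set.univ M ∧ a ≫ h.hom ≠ 0 := by
  obtain ⟨M, G, a, b, c, hT, hM, hG⟩ := ht.serre_le_delW hY
  refine ⟨M, a, hM, fun h0 => ?_⟩
  obtain ⟨ψ, hψ⟩ := tri_desc hT h.hom h0
  have hψ0 : ψ = 0 := (DF_Iio_orth_nab hG m 0).of_iso (Iso.refl _) (shiftZeroIso _) ψ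
  rw [hψ0, comp_zero] at hψ
  have : h = 0 := ObjectProperty.hom_ext _ hψ
  exact W.nab_not_isZero s m ((heart_isZero_iff (ht.nabH s m)).1 (IsZero.of_epi_eq_zero h this))

end Assoc

end StdSystem

end

section DerivedEff

variable {B : Type*} [Category* B] [Abelian B]

/-- Morphisms of complexes to a single complex, restricted to cycles. -/
theorem exists_epi_single {K : CochainComplex B ℤ} {X : B}
    (s : K ⟶ (HomologicalComplex.single B (ComplexShape.up ℤ) 0).obj X) [QuasiIso s] :
    ∃ (Z : B) (p : Z ⟶ X) (i : (HomologicalComplex.single B (ComplexShape.up ℤ) 0).obj Z ⟶ K),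
      Epi p ∧ i ≫ s = (HomologicalComplex.single B (ComplexShape.up ℤ) 0).map p := by
  refine ⟨K.cycles 0, K.homologyπ 0 ≫ HomologicalComplex.homologyMap s 0 ≫
    (HomologicalComplex.singleObjHomologySelfIso _ _ _).hom,
    HomologicalComplex.mkHomFromSingle (K.iCycles 0) (fun k _ => K.iCycles_d 0 k), ?_, ?_⟩
  · exact epi_comp _ _
  · apply HomologicalComplex.from_single_hom_ext
    rw [HomologicalComplex.comp_f, HomologicalComplex.mkHomFromSingle_f,
      HomologicalComplex.single_map_f_self]
    rw [HomologicalComplex.homologyπ_naturality_assoc,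
      HomologicalComplex.homologyπ_singleObjHomologySelfIso_hom,
      HomologicalComplex.singleObjCyclesSelfIso_hom]
    simp

variable [HasDerivedCategory B]

open DerivedCategory

theorem derived_effaceable {X Y : B} {d : ℤ} (hd : 0 < d)
    (f : (singleFunctor B 0).obj X ⟶ ((singleFunctor B 0).obj Y)⟦d⟧) :
    ∃ (X' : B) (p : X' ⟶ X), Epi p ∧ (singleFunctor B 0).map p ≫ f = 0 := by
  let e : ((singleFunctor B 0).obj Y)⟦d⟧ ≅ (singleFunctor B (-d)).obj Y :=
    ((singleFunctors B).shiftIso d (-d) 0 (by lia)).app Y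
  let f' : Q.obj ((HomologicalComplex.single B (ComplexShape.up ℤ) 0).obj X) ⟶
    Q.obj ((HomologicalComplex.single B (ComplexShape.up ℤ) (-d)).obj Y) := f ≫ e.hom
  obtain ⟨K, s, hs, g, hg⟩ := right_fac f'
  have : QuasiIso s := (isIso_Q_map_iff_quasiIso _ _).1 hs
  obtain ⟨Z, p, i, hp, hi⟩ := exists_epi_single s
  refine ⟨Z, p, hp, ?_⟩
  have hig : i ≫ g = 0 := by
    apply HomologicalComplex.from_single_hom_ext
    exact (HomologicalComplex.isZero_single_obj_X _ _ _ _ (by lia)).eq_of_tgt _ _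
  rw [← cancel_mono e.hom, zero_comp, Category.assoc]
  change Q.map ((HomologicalComplex.single B (ComplexShape.up ℤ) 0).map p) ≫ f' = 0
  rw [hg, ← hi, Functor.map_comp, Category.assoc, IsIso.hom_inv_id_assoc, ← Functor.map_comp, hig,
    Functor.map_zero]

theorem fullSubcategory_tri {C : Type*} [Category* C] [Preadditive C] [HasZeroObject C]
    [HasShift C ℤ] [∀ n : ℤ, (shiftFunctor C n).Additive] [Pretriangulated C]
    (P : ObjectProperty C) [P.IsTriangulated] {A X Y : P.FullSubcategory} (f : A ⟶ X) (g : X ⟶ Y)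
    (h : Y.obj ⟶ A.obj⟦(1 : ℤ)⟧) (hT : Triangle.mk f.hom g.hom h ∈ distTriang C) :
    ∃ h' : Y ⟶ A⟦(1 : ℤ)⟧, Triangle.mk f g h' ∈ distTriang P.FullSubcategory := by
  refine ⟨P.fullyFaithfulι.preimage (h ≫ (P.ι.commShiftIso (1 : ℤ)).inv.app A), ?_⟩
  refine isomorphic_distinguished _ hT _
    (Triangle.isoMk _ _ (Iso.refl _) (Iso.refl _) (Iso.refl _) ?_ ?_ ?_)
  · exact (Category.comp_id _).trans (Category.id_comp _).symm
  · exact (Category.comp_id _).trans (Category.id_comp _).symm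
  · change (P.ι.map (P.fullyFaithfulι.preimage (h ≫ (P.ι.commShiftIso (1 : ℤ)).inv.app A)) ≫
      (P.ι.commShiftIso (1 : ℤ)).hom.app A) ≫ (𝟙 _)⟦(1 : ℤ)⟧' = 𝟙 _ ≫ h
    rw [Functor.FullyFaithful.map_preimage, CategoryTheory.Functor.map_id]
    refine (Category.comp_id _).trans ((Category.assoc _ _ _).trans ?_)
    rw [Iso.inv_hom_id_app, Category.id_comp]
    exact Category.comp_id _

theorem singleBounded_tri {K : ShortComplex B} (hK : K.ShortExact) :
    ∃ δ, Triangle.mk ((singleBounded B).map K.f) ((singleBounded B).map K.g) δ ∈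
      distTriang (DerivedCategory.Bounded B) :=
  fullSubcategory_tri _ ((singleBounded B).map K.f) ((singleBounded B).map K.g) _
    hK.singleTriangle_distinguished

theorem singleBounded_tri_of_epi {X Y : B} (p : X ⟶ Y) [Epi p] :
    ∃ (K : B) (k : K ⟶ X) (δ : (singleBounded B).obj Y ⟶ ((singleBounded B).obj K)⟦(1 : ℤ)⟧),
      Triangle.mk ((singleBounded B).map k) ((singleBounded B).map p) δ ∈
        distTriang (DerivedCategory.Bounded B) := by
  have hK : (ShortComplex.mk (kernel.ι p) p (kernel.condition p)).ShortExact :=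
    { exact := ShortComplex.exact_kernel p }
  obtain ⟨δ, hT⟩ := singleBounded_tri hK
  exact ⟨_, _, δ, hT⟩

theorem singleBounded_effaceable {X Y : B} {d : ℤ} (hd : 0 < d)
    (f : (singleBounded B).obj X ⟶ ((singleBounded B).obj Y)⟦d⟧) :
    ∃ (X' : B) (p : X' ⟶ X), Epi p ∧ (singleBounded B).map p ≫ f = 0 := by
  let P := (DerivedCategory.TStructure.t (C := B)).bounded
  obtain ⟨X', p, hp, h⟩ := derived_effaceable (X := X) (Y := Y) hd
    (P.ι.map f ≫ (P.ι.commShiftIso d).hom.app _)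
  refine ⟨X', p, hp, P.ι.map_injective ?_⟩
  rw [← cancel_mono ((P.ι.commShiftIso d).hom.app _), Functor.map_comp, Functor.map_zero,
    zero_comp, Category.assoc]
  exact h

theorem singleBounded_orth {X Y : B} {d : ℤ} (hd : d < 0) :
    Orth ((singleBounded B).obj X) (((singleBounded B).obj Y)⟦d⟧) := by
  intro f
  let P := (DerivedCategory.TStructure.t (C := B)).bounded
  apply P.ι.map_injective
  rw [← cancel_mono ((P.ι.commShiftIso d).hom.app _), Functor.map_zero, zero_comp]
  have h₁ : TStructure.t.IsLE ((singleFunctor B 0).obj X) 0 := inferInstance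
  have h₂ : TStructure.t.IsGE (((singleFunctor B 0).obj Y)⟦d⟧) (-d) :=
    TStructure.t.isGE_shift ((singleFunctor B 0).obj Y) 0 d (-d)
  exact TStructure.t.zero (X := (singleFunctor B 0).obj X)
    (Y := ((singleFunctor B 0).obj Y)⟦d⟧) _ 0 (-d)

instance singleBounded_full : (singleBounded B).Full where
  map_surjective f := by
    obtain ⟨g, hg⟩ := (singleFunctor B 0).map_surjective f.hom
    exact ⟨g, ObjectProperty.hom_ext _ hg⟩

variable (B) in
/-- The shifts of the single complexes, in the bounded derived category. -/
abbrev singleShifts : ObjectProperty (DerivedCategory.Bounded B) :=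
  familyProp (fun p : B × ℤ => ((singleBounded B).obj p.1)⟦p.2⟧) Set.univ

theorem singleShifts_of_isGE_of_isLE (X : DerivedCategory.Bounded B) (n : ℤ)
    (h₁ : X.obj.IsGE n) (h₂ : X.obj.IsLE n) : singleShifts B X := by
  let P := (DerivedCategory.TStructure.t (C := B)).bounded
  obtain ⟨Y, ⟨e⟩⟩ := exists_iso_singleFunctor_obj_of_isGE_of_isLE X.obj n
  let e' : ((singleFunctor B 0).obj Y)⟦-n⟧ ≅ (singleFunctor B n).obj Y :=
    ((singleFunctors B).shiftIso (-n) n 0 (by lia)).app Y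
  exact .inr ⟨(Y, -n), trivial, ⟨P.fullyFaithfulι.preimageIso
    ((e.trans e'.symm).trans ((P.ι.commShiftIso (-n)).app ((singleBounded B).obj Y)).symm)⟩⟩

theorem bounded_extW_aux (n : ℕ) (a : ℤ) (X : DerivedCategory.Bounded B)
    (h₁ : X.obj.IsGE a) (h₂ : X.obj.IsLE (a + n)) : ExtW (singleShifts B) X := by
  induction n generalizing a X with
  | zero =>
    exact le_extW _ _ (singleShifts_of_isGE_of_isLE X a h₁ (by simpa using h₂))
  | succ n ih =>
    obtain ⟨A, Z, hA, hZ, f, g, h, hT⟩ := TStructure.t.exists_triangle X.obj a (a + 1) rfl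
    have hA' : A.IsLE a := ⟨hA⟩
    have hZ' : Z.IsGE (a + 1) := ⟨hZ⟩
    have hA₂ : A.IsGE a := by
      obtain ⟨u, v, hT'⟩ := tri_invRot hT
      refine TStructure.t.isGE₂ _ hT' a ?_ h₁
      have := TStructure.t.isGE_shift Z (a + 1) (-1) (a + 2)
      exact TStructure.t.isGE_of_ge (Z⟦(-1 : ℤ)⟧) a (a + 2)
    have hZ₂ : Z.IsLE (a + 1 + n) := by
      refine TStructure.t.isLE₂ _ (tri_rot hT) _ ?_ ?_
      · rw [show a + 1 + n = a + ((n + 1 : ℕ) : ℤ) by lia]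
        exact h₂
      · have := TStructure.t.isLE_shift A a 1 (a - 1)
        exact TStructure.t.isLE_of_le (A⟦(1 : ℤ)⟧) (a - 1) (a + 1 + n)
    let A₀ : DerivedCategory.Bounded B := ⟨A, ⟨a, hA₂⟩, ⟨a, hA'⟩⟩
    let Z₀ : DerivedCategory.Bounded B := ⟨Z, ⟨_, hZ'⟩, ⟨_, hZ₂⟩⟩
    obtain ⟨h', hT'⟩ := fullSubcategory_tri _ (A := A₀) (X := X) (Y := Z₀)
      (ObjectProperty.homMk f) (ObjectProperty.homMk g) h hT
    exact (extW (singleShifts B)).ext_of_isTriangulatedClosed₂ _ hT'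
      (le_extW _ _ (singleShifts_of_isGE_of_isLE A₀ a hA₂ hA')) (ih (a + 1) Z₀ hZ' hZ₂)

/-- The bounded derived category is generated by the single complexes. -/
theorem bounded_extW (X : DerivedCategory.Bounded B) : ExtW (singleShifts B) X := by
  obtain ⟨⟨a, ha⟩, ⟨b, hb⟩⟩ := X.property
  exact bounded_extW_aux (b - a).toNat a X ha (TStructure.t.isLE_of_le X.obj b _ (by lia))

end DerivedEff

section BijOn

variable {C D : Type*} [Category* C] [Preadditive C] [HasZeroObject C] [HasShift C ℤ]
  [∀ n : ℤ, (shiftFunctor C n).Additive] [Pretriangulated C]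
  [Category* D] [Preadditive D] [HasZeroObject D] [HasShift D ℤ]
  [∀ n : ℤ, (shiftFunctor D n).Additive] [Pretriangulated D]
  (R : C ⥤ D)

/-- The functor `R` is bijective on the morphisms from `P` to `Q`. -/
def BijOn (P Q : C) : Prop := Function.Bijective fun f : P ⟶ Q => R.map f

variable {R}

theorem BijOn.eq_zero [R.Additive] {P Q : C} (h : BijOn R P Q) {f : P ⟶ Q} (hf : R.map f = 0) :
    f = 0 :=
  h.1 (hf.trans (R.map_zero _ _).symm)

theorem bijOn_of [R.Additive] {P Q : C} (h₁ : ∀ f : P ⟶ Q, R.map f = 0 → f = 0)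
    (h₂ : ∀ f : R.obj P ⟶ R.obj Q, ∃ g, R.map g = f) : BijOn R P Q := by
  refine ⟨fun f g hfg => ?_, h₂⟩
  rw [← sub_eq_zero]
  refine h₁ _ ?_
  rw [R.map_sub, sub_eq_zero]
  exact hfg

theorem BijOn.of_iso {P P' Q Q' : C} (h : BijOn R P Q) (e : P ≅ P') (e' : Q ≅ Q') :
    BijOn R P' Q' := by
  constructor
  · intro f g hfg
    have : e.hom ≫ f ≫ e'.inv = e.hom ≫ g ≫ e'.inv := h.1 (by
      change R.map f = R.map g at hfg
      simp [hfg])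
    simpa using this
  · intro f
    obtain ⟨g, hg⟩ := h.2 (R.map e.hom ≫ f ≫ R.map e'.inv)
    refine ⟨e.inv ≫ g ≫ e'.hom, ?_⟩
    change R.map g = _ at hg
    change R.map (e.inv ≫ g ≫ e'.hom) = f
    rw [R.map_comp, R.map_comp, hg]
    simp [← R.map_comp, ← R.map_comp_assoc]

theorem BijOn.of_orth [R.Additive] {P Q : C} (h : Orth P Q) (h' : Orth (R.obj P) (R.obj Q)) :
    BijOn R P Q :=
  bijOn_of (fun f _ => h f) fun f => ⟨0, by rw [R.map_zero, h' f]⟩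

variable [R.CommShift ℤ]

theorem BijOn.shift {P Q : C} (h : BijOn R P Q) (n : ℤ) : BijOn R (P⟦n⟧) (Q⟦n⟧) := by
  have key : ∀ f : P ⟶ Q, R.map (f⟦n⟧') = (R.commShiftIso n).hom.app P ≫ (R.map f)⟦n⟧' ≫
      (R.commShiftIso n).inv.app Q := fun f => by simp
  constructor
  · intro f g hfg
    obtain ⟨f, rfl⟩ := (shiftFunctor C n).map_surjective f
    obtain ⟨g, rfl⟩ := (shiftFunctor C n).map_surjective g
    change R.map _ = R.map _ at hfg
    rw [key, key, cancel_epi, cancel_mono] at hfg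
    rw [h.1 ((shiftFunctor D n).map_injective hfg)]
  · intro f
    obtain ⟨g, hg⟩ := (shiftFunctor D n).map_surjective
      ((R.commShiftIso n).inv.app P ≫ f ≫ (R.commShiftIso n).hom.app Q)
    obtain ⟨g', rfl⟩ := h.2 g
    refine ⟨g'⟦n⟧', ?_⟩
    change R.map (g'⟦n⟧') = f
    have hg : (R.map g')⟦n⟧' = _ := hg
    rw [key, hg]
    simp

theorem BijOn.shift_shift {P Q : C} {a b c : ℤ} (h : BijOn R P (Q⟦c⟧)) (hc : c + a = b) :
    BijOn R (P⟦a⟧) (Q⟦b⟧) :=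
  (h.shift a).of_iso (Iso.refl _) (shiftAddIso _ _ _ _ hc)

variable [R.IsTriangulated] {A X B : C} {f : A ⟶ X} {g : X ⟶ B} {h : B ⟶ A⟦(1 : ℤ)⟧}

theorem map_desc (hT : Triangle.mk f g h ∈ distTriang C) {Y : D} (φ : R.obj X ⟶ Y)
    (hφ : R.map f ≫ φ = 0) : ∃ ψ : R.obj B ⟶ Y, φ = R.map g ≫ ψ :=
  Triangle.yoneda_exact₂ _ (R.map_distinguished _ hT) φ hφ

theorem map_lift (hT : Triangle.mk f g h ∈ distTriang C) {Y : D} (φ : Y ⟶ R.obj X)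
    (hφ : φ ≫ R.map g = 0) : ∃ ψ : Y ⟶ R.obj A, φ = ψ ≫ R.map f :=
  Triangle.coyoneda_exact₂ _ (R.map_distinguished _ hT) φ hφ

theorem BijOn.ext_left (hT : Triangle.mk f g h ∈ distTriang C) {Q : C} (hA : BijOn R A Q)
    (hB : BijOn R B Q) (hA' : BijOn R (A⟦(1 : ℤ)⟧) Q) (hB' : BijOn R (B⟦(-1 : ℤ)⟧) Q) :
    BijOn R X Q := by
  refine bijOn_of (fun φ hφ => ?_) fun φ => ?_
  · obtain ⟨ψ, rfl⟩ := tri_desc hT φ (hA.eq_zero (by rw [R.map_comp, hφ, comp_zero]))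
    rw [R.map_comp] at hφ
    obtain ⟨χ, hχ⟩ := map_desc (tri_rot hT) _ hφ
    obtain ⟨χ, rfl⟩ := hA'.2 χ
    obtain rfl : ψ = h ≫ χ := hB.1 (by
      change R.map ψ = R.map (h ≫ χ)
      rw [hχ, R.map_comp])
    rw [← Category.assoc, tri_comp₂₃ hT, zero_comp]
  · obtain ⟨u, hu⟩ := hA.2 (R.map f ≫ φ)
    change R.map u = _ at hu
    obtain ⟨a, b, hT'⟩ := tri_invRot hT
    obtain ⟨v, rfl⟩ := tri_desc hT' u (hB'.eq_zero (by
      rw [R.map_comp, hu, ← R.map_comp_assoc, tri_comp₁₂ hT', R.map_zero, zero_comp]))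
    obtain ⟨w, hw⟩ := map_desc hT (φ - R.map v) (by
      rw [Preadditive.comp_sub, ← hu, R.map_comp, sub_self])
    obtain ⟨w, rfl⟩ := hB.2 w
    refine ⟨v + g ≫ w, ?_⟩
    rw [R.map_add, R.map_comp]
    exact (eq_add_of_sub_eq' hw).symm

theorem BijOn.ext_right (hT : Triangle.mk f g h ∈ distTriang C) {P : C} (hA : BijOn R P A)
    (hB : BijOn R P B) (hA' : BijOn R P (A⟦(1 : ℤ)⟧)) (hB' : BijOn R P (B⟦(-1 : ℤ)⟧)) :
    BijOn R P X := by
  refine bijOn_of (fun φ hφ => ?_) fun φ => ?_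
  · obtain ⟨ψ, rfl⟩ := tri_lift hT φ (hB.eq_zero (by rw [R.map_comp, hφ, zero_comp]))
    rw [R.map_comp] at hφ
    obtain ⟨a, b, hT'⟩ := tri_invRot hT
    obtain ⟨χ, hχ⟩ := map_lift hT' _ hφ
    obtain ⟨χ, rfl⟩ := hB'.2 χ
    obtain rfl : ψ = χ ≫ a := hA.1 (by
      change R.map ψ = R.map (χ ≫ a)
      rw [hχ, R.map_comp])
    rw [Category.assoc, tri_comp₁₂ hT', comp_zero]
  · obtain ⟨u, hu⟩ := hB.2 (φ ≫ R.map g)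
    change R.map u = _ at hu
    obtain ⟨v, rfl⟩ := tri_lift₃ hT u (hA'.eq_zero (by
      rw [R.map_comp, hu, Category.assoc, ← R.map_comp, tri_comp₂₃ hT, R.map_zero, comp_zero]))
    obtain ⟨w, hw⟩ := map_lift hT (φ - R.map v) (by
      rw [Preadditive.sub_comp, ← hu, R.map_comp, sub_self])
    obtain ⟨w, rfl⟩ := hA.2 w
    refine ⟨v + w ≫ f, ?_⟩
    rw [R.map_add, R.map_comp]
    exact (eq_add_of_sub_eq' hw).symm

theorem bijOn_of_extW_left {P : ObjectProperty C} {X Q : C} (hX : ExtW P X)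
    (hP : ∀ A, P A → ∀ i : ℤ, BijOn R (A⟦i⟧) Q) (i : ℤ) : BijOn R (X⟦i⟧) Q := by
  induction hX generalizing i with
  | zero X hX =>
    have hX' := (shiftFunctor C i).map_isZero hX
    exact .of_orth (.of_isZero_left hX') (.of_isZero_left (R.map_isZero hX'))
  | step f g h hT hA hB ih =>
    obtain ⟨w, hT'⟩ := tri_shift hT i
    exact .ext_left hT' (ih i) (hP _ hB i)
      ((ih (i + 1)).of_iso (shiftAddIso _ _ _ _ rfl).symm (Iso.refl _))
      ((hP _ hB (i + -1)).of_iso (shiftAddIso _ _ _ _ rfl).symm (Iso.refl _))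

theorem bijOn_of_extW_right {P : ObjectProperty C} {X Q : C} (hX : ExtW P X)
    (hP : ∀ A, P A → ∀ i : ℤ, BijOn R Q (A⟦i⟧)) (i : ℤ) : BijOn R Q (X⟦i⟧) := by
  induction hX generalizing i with
  | zero X hX =>
    have hX' := (shiftFunctor C i).map_isZero hX
    exact .of_orth (.of_isZero_right hX') (.of_isZero_right (R.map_isZero hX'))
  | step f g h hT hA hB ih =>
    obtain ⟨w, hT'⟩ := tri_shift hT i
    exact .ext_right hT' (ih i) (hP _ hB i)
      ((ih (i + 1)).of_iso (Iso.refl _) (shiftAddIso _ _ _ _ rfl).symm)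
      ((hP _ hB (i + -1)).of_iso (Iso.refl _) (shiftAddIso _ _ _ _ rfl).symm)

end BijOn

section Realize

variable {B D : Type*} [Category* B] [Abelian B] [HasDerivedCategory B]
  [Category* D] [Preadditive D] [HasZeroObject D] [HasShift D ℤ]
  [∀ n : ℤ, (shiftFunctor D n).Additive] [Pretriangulated D]
  {R : DerivedCategory.Bounded B ⥤ D} [R.CommShift ℤ] [R.IsTriangulated] {F : B ⥤ D}
  (r : singleBounded B ⋙ R ≅ F)

include r

/-- The comparison of `R` on shifts of single complexes with `F`. -/
theorem exists_realize_shift_iso (Y : B) (d : ℤ) :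
    Nonempty (R.obj (((singleBounded B).obj Y)⟦d⟧) ≅ (F.obj Y)⟦d⟧) :=
  ⟨((R.commShiftIso d).app _).trans ((shiftFunctor D d).mapIso (r.app Y))⟩

theorem bijOn_single_zero [F.Full] [F.Faithful] (X Y : B) :
    BijOn R ((singleBounded B).obj X) ((singleBounded B).obj Y) := by
  have hr : ∀ f : X ⟶ Y, R.map ((singleBounded B).map f) =
      r.hom.app X ≫ F.map f ≫ r.inv.app Y := fun f => (NatIso.naturality_2 r f).symm
  constructor
  · intro f g hfg
    obtain ⟨f, rfl⟩ := (singleBounded B).map_surjective f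
    obtain ⟨g, rfl⟩ := (singleBounded B).map_surjective g
    change R.map _ = R.map _ at hfg
    rw [hr, hr, cancel_epi, cancel_mono] at hfg
    rw [F.map_injective hfg]
  · intro f
    obtain ⟨g, hg⟩ := F.map_surjective (r.inv.app X ≫ f ≫ r.hom.app Y)
    refine ⟨(singleBounded B).map g, ?_⟩
    change R.map _ = _
    rw [hr, hg]
    simp

theorem bijOn_single_nat [F.Full] [F.Faithful]
    (heff : ∀ (X Y : B) (d : ℤ) (f : F.obj X ⟶ (F.obj Y)⟦d⟧), 0 < d →
      ∃ (X' : B) (p : X' ⟶ X), Epi p ∧ F.map p ≫ f = 0) (n : ℕ) (X Y : B) :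
    BijOn R ((singleBounded B).obj X) (((singleBounded B).obj Y)⟦(n : ℤ)⟧) := by
  induction n generalizing X with
  | zero => exact (bijOn_single_zero r X Y).of_iso (Iso.refl _) (shiftZeroIso _).symm
  | succ n ih =>
    have ih' : ∀ K : B, BijOn R (((singleBounded B).obj K)⟦(1 : ℤ)⟧)
        (((singleBounded B).obj Y)⟦((n + 1 : ℕ) : ℤ)⟧) := fun K =>
      (ih K).shift_shift (by lia)
    refine bijOn_of (fun f hf => ?_) fun f => ?_
    · obtain ⟨X', p, hp, hpf⟩ := singleBounded_effaceable (by lia) f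
      obtain ⟨K, k, δ, hT⟩ := singleBounded_tri_of_epi p
      obtain ⟨ψ, rfl⟩ := tri_desc₃ hT f hpf
      rw [R.map_comp] at hf
      obtain ⟨χ, hχ⟩ := map_desc (tri_rot (tri_rot hT)) _ hf
      obtain ⟨χ, rfl⟩ := (ih' X').2 χ
      have : ψ = (-((singleBounded B).map k)⟦(1 : ℤ)⟧') ≫ χ := (ih' _).1 (by
        change R.map ψ = R.map (_ ≫ χ)
        rw [hχ, R.map_comp])
      rw [this, ← Category.assoc, Preadditive.comp_neg, tri_comp₃₁ hT, neg_zero, zero_comp]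
    · obtain ⟨e⟩ := exists_realize_shift_iso r Y ((n + 1 : ℕ) : ℤ)
      obtain ⟨X', p, hp, hpf⟩ := heff X Y ((n + 1 : ℕ) : ℤ) (r.inv.app X ≫ f ≫ e.hom) (by lia)
      have hpf' : R.map ((singleBounded B).map p) ≫ f = 0 := by
        have := r.inv.naturality_assoc p (f ≫ e.hom)
        rw [hpf] at this
        rw [← cancel_mono e.hom, ← cancel_epi (r.inv.app X'), Category.assoc, zero_comp, comp_zero]
        exact this.symm
      obtain ⟨K, k, δ, hT⟩ := singleBounded_tri_of_epi p
      obtain ⟨ψ, hψ⟩ := map_desc (tri_rot hT) f hpf'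
      obtain ⟨ψ, rfl⟩ := (ih' _).2 ψ
      exact ⟨δ ≫ ψ, by rw [R.map_comp]; exact hψ.symm⟩

/-- A triangulated functor on the bounded derived category that extends a fully faithful functor
is fully faithful, if the morphisms of negative degree vanish and the morphisms of positive degree
are effaceable. -/
theorem bijOn_bounded [F.Full] [F.Faithful]
    (hneg : ∀ (X Y : B) (d : ℤ), d < 0 → Orth (F.obj X) ((F.obj Y)⟦d⟧))
    (heff : ∀ (X Y : B) (d : ℤ) (f : F.obj X ⟶ (F.obj Y)⟦d⟧), 0 < d →
      ∃ (X' : B) (p : X' ⟶ X), Epi p ∧ F.map p ≫ f = 0) (P Q : DerivedCategory.Bounded B) :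
    BijOn R P Q := by
  have h₁ : ∀ (X Y : B) (d : ℤ),
      BijOn R ((singleBounded B).obj X) (((singleBounded B).obj Y)⟦d⟧) := by
    intro X Y d
    rcases le_or_gt 0 d with hd | hd
    · lift d to ℕ using hd
      exact bijOn_single_nat r heff d X Y
    · obtain ⟨e⟩ := exists_realize_shift_iso r Y d
      exact .of_orth (singleBounded_orth hd) ((hneg X Y d hd).of_iso (r.app X).symm e.symm)
  have h₂ : ∀ (P : DerivedCategory.Bounded B) (Y : B) (d : ℤ),
      BijOn R P (((singleBounded B).obj Y)⟦d⟧) := by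
    intro P Y d
    refine (bijOn_of_extW_left (bounded_extW P) ?_ 0).of_iso (shiftZeroIso _) (Iso.refl _)
    rintro A (hA | ⟨⟨X, j⟩, -, ⟨e⟩⟩) i
    · have hA' := (shiftFunctor (DerivedCategory.Bounded B) i).map_isZero hA
      exact .of_orth (.of_isZero_left hA') (.of_isZero_left (R.map_isZero hA'))
    · refine (((h₁ X Y (d - i - j)).shift_shift (a := j) (b := d - i) (by lia)).shift_shift
        (a := i) (by lia)).of_iso ((shiftFunctor _ i).mapIso e.symm) (Iso.refl _)
  refine (bijOn_of_extW_right (bounded_extW Q) ?_ 0).of_iso (Iso.refl _) (shiftZeroIso _)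
  rintro A (hA | ⟨⟨X, j⟩, -, ⟨e⟩⟩) i
  · have hA' := (shiftFunctor (DerivedCategory.Bounded B) i).map_isZero hA
    exact .of_orth (.of_isZero_right hA') (.of_isZero_right (R.map_isZero hA'))
  · exact (h₂ P X (j + i)).of_iso (Iso.refl _)
      ((shiftAddIso _ _ _ _ rfl).symm.trans ((shiftFunctor _ i).mapIso e.symm))

end Realize

section Twist

variable {D : Type*} [Category* D]

theorem pow_succ_iso (e : D ≌ D) (n : ℤ) :
    Nonempty (e.functor ⋙ (e ^ n).functor ≅ (e ^ (n + 1)).functor) := by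
  rcases n with n | n
  · cases n with
    | zero => exact ⟨e.functor.rightUnitor⟩
    | succ n => exact ⟨Iso.refl _⟩
  · cases n with
    | zero => exact ⟨e.unitIso.symm⟩
    | succ n =>
      refine ⟨?_⟩
      change e.functor ⋙ e.inverse ⋙ (e.symm.powNat (n + 1)).functor ≅
        (e.symm.powNat (n + 1)).functor
      exact (Functor.associator _ _ _).symm.trans
        ((Functor.isoWhiskerRight e.unitIso.symm _).trans (Functor.leftUnitor _))

theorem pow_add_iso (e : D ≌ D) (n m : ℤ) :
    Nonempty ((e ^ n).functor ⋙ (e ^ m).functor ≅ (e ^ (n + m)).functor) := by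
  induction n using Int.induction_on with
  | zero =>
    rw [zero_add]
    exact ⟨Functor.leftUnitor _⟩
  | succ n ih =>
    obtain ⟨i⟩ := ih
    obtain ⟨a⟩ := pow_succ_iso e n
    obtain ⟨b⟩ := pow_succ_iso e (n + m)
    rw [show (n : ℤ) + 1 + m = n + m + 1 by lia]
    exact ⟨(Functor.isoWhiskerRight a.symm _).trans ((Functor.associator _ _ _).trans
      ((Functor.isoWhiskerLeft _ i).trans b))⟩
  | pred n ih =>
    obtain ⟨i⟩ := ih
    obtain ⟨a⟩ := pow_succ_iso e (-n - 1)
    obtain ⟨b⟩ := pow_succ_iso e (-n - 1 + m)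
    rw [show -(n : ℤ) - 1 + 1 = -n by lia] at a
    rw [show -(n : ℤ) - 1 + m + 1 = -n + m by lia] at b
    have c : e.functor ⋙ (e ^ (-(n : ℤ) - 1)).functor ⋙ (e ^ m).functor ≅
        e.functor ⋙ (e ^ (-(n : ℤ) - 1 + m)).functor :=
      (Functor.associator _ _ _).symm.trans
        ((Functor.isoWhiskerRight a _).trans (i.trans b.symm))
    exact ⟨(e.invFunIdAssoc _).symm.trans ((Functor.isoWhiskerLeft _ c).trans
      (e.invFunIdAssoc _))⟩

variable [Preadditive D] [HasZeroObject D] [HasShift D ℤ]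
  [∀ n : ℤ, (shiftFunctor D n).Additive] [Pretriangulated D]

/-- The functor `F` can be made a triangulated functor. -/
def AdmitsTriangulated (F : D ⥤ D) : Prop := ∃ _ : F.CommShift ℤ, F.IsTriangulated

theorem admitsTriangulated_id : AdmitsTriangulated (𝟭 D) := ⟨inferInstance, inferInstance⟩

theorem AdmitsTriangulated.comp {F G : D ⥤ D} (hF : AdmitsTriangulated F)
    (hG : AdmitsTriangulated G) : AdmitsTriangulated (F ⋙ G) := by
  obtain ⟨_, _⟩ := hF
  obtain ⟨_, _⟩ := hG
  exact ⟨inferInstance, inferInstance⟩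

theorem admitsTriangulated_inverse (e : D ≌ D) (h : AdmitsTriangulated e.functor) :
    AdmitsTriangulated e.inverse := by
  obtain ⟨_, h⟩ := h
  let := e.commShiftInverse ℤ
  have := e.commShift_of_functor ℤ
  have := Equivalence.IsTriangulated.mk' e h
  exact ⟨inferInstance, inferInstance⟩

theorem admitsTriangulated_powNat (e : D ≌ D) (h : AdmitsTriangulated e.functor) (n : ℕ) :
    AdmitsTriangulated (e.powNat n).functor := by
  induction n with
  | zero => exact admitsTriangulated_id
  | succ n ih =>
    cases n with
    | zero => exact h
    | succ n => exact h.comp ih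

theorem admitsTriangulated_pow (e : D ≌ D) (h : AdmitsTriangulated e.functor) (n : ℤ) :
    AdmitsTriangulated (e ^ n).functor := by
  rcases n with n | n
  · exact admitsTriangulated_powNat e h n
  · exact admitsTriangulated_powNat e.symm (admitsTriangulated_inverse e h) (n + 1)

theorem AdmitsTriangulated.shift_iso {F : D ⥤ D} (h : AdmitsTriangulated F) (X : D) (i : ℤ) :
    Nonempty (F.obj (X⟦i⟧) ≅ (F.obj X)⟦i⟧) := by
  obtain ⟨_, _⟩ := h
  exact ⟨(F.commShiftIso i).app X⟩

theorem AdmitsTriangulated.tri {F : D ⥤ D} (h : AdmitsTriangulated F) {A X B : D} {f : A ⟶ X}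
    {g : X ⟶ B} {k : B ⟶ A⟦(1 : ℤ)⟧} (hT : Triangle.mk f g k ∈ distTriang D) :
    ∃ k' : F.obj B ⟶ (F.obj A)⟦(1 : ℤ)⟧,
      Triangle.mk (F.map f) (F.map g) k' ∈ distTriang D := by
  obtain ⟨_, _⟩ := h
  exact ⟨_, F.map_distinguished _ hT⟩

theorem AdmitsTriangulated.map_isZero {F : D ⥤ D} (h : AdmitsTriangulated F) {X : D}
    (hX : IsZero X) : IsZero (F.obj X) := by
  obtain ⟨_, _⟩ := h
  exact F.map_isZero hX

theorem AdmitsTriangulated.map_zero {F : D ⥤ D} (h : AdmitsTriangulated F) {X Y : D} :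
    F.map (0 : X ⟶ Y) = 0 := by
  obtain ⟨_, _⟩ := h
  exact F.map_zero _ _

theorem AdmitsTriangulated.extW [IsTriangulated D] {F : D ⥤ D} (h : AdmitsTriangulated F)
    {P Q : ObjectProperty D} (hPQ : ∀ A, P A → ExtW Q (F.obj A)) {X : D} (hX : ExtW P X) :
    ExtW Q (F.obj X) := by
  induction hX with
  | zero X hX => exact .zero _ (h.map_isZero hX)
  | step f g k hT hA hB ih =>
    obtain ⟨k', hT'⟩ := h.tri hT
    exact extW_extensionProduct _ _ ⟨_, _, _, _, _, hT', ih, hPQ _ hB⟩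

theorem AdmitsTriangulated.orth {F : D ⥤ D} [F.Full] (h : AdmitsTriangulated F) {X Y : D}
    (hXY : Orth X Y) : Orth (F.obj X) (F.obj Y) := by
  intro f
  obtain ⟨g, rfl⟩ := F.map_surjective f
  rw [hXY g, h.map_zero]

end Twist

section Build

variable {k : Type*} [Field k]
  {D : Type*} [Category* D] [Preadditive D] [Linear k D] [HasZeroObject D] [HasShift D ℤ]
  [∀ n : ℤ, (shiftFunctor D n).Additive] [Pretriangulated D] [IsTriangulated D]
  (T : TateTwist k D) {S : Type*} [PartialOrder S]

theorem TateTwist.tw_tri (n : ℤ) : AdmitsTriangulated (T.tw n) :=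
  admitsTriangulated_pow _ ⟨T.commShift, T.isTriangulated⟩ n

theorem TateTwist.tw_tw (n m l : ℤ) (h : n + m = l) (X : D) :
    Nonempty ((T.tw m).obj ((T.tw n).obj X) ≅ (T.tw l).obj X) := by
  subst h
  obtain ⟨i⟩ := pow_add_iso T.equiv n m
  exact ⟨i.app X⟩

theorem TateTwist.orth_tw {X Y : D} {i : ℤ} (n m : ℤ) (h : HomVanish T X Y i (m - n)) :
    Orth ((T.tw n).obj X) (((T.tw m).obj Y)⟦i⟧) := by
  obtain ⟨a⟩ := (T.tw_tri n).shift_iso ((T.tw (m - n)).obj Y) i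
  obtain ⟨b⟩ := T.tw_tw (m - n) n m (by lia) Y
  exact ((T.tw_tri n).orth h).of_iso (Iso.refl _) (a.trans ((shiftFunctor D i).mapIso b))

/-- Twists preserve the iterated extensions of shifts of twists. -/
theorem TateTwist.extW_tw (X : S → D) (F : Set S) (n : ℤ) {Y : D}
    (hY : ExtW (familyProp (fun p : S × ℤ × ℤ => ((T.tw p.2.1).obj (X p.1))⟦p.2.2⟧)
      {p | p.1 ∈ F}) Y) :
    ExtW (familyProp (fun p : S × ℤ × ℤ => ((T.tw p.2.1).obj (X p.1))⟦p.2.2⟧)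
      {p | p.1 ∈ F}) ((T.tw n).obj Y) := by
  refine (T.tw_tri n).extW ?_ hY
  rintro A (hA | ⟨⟨s, m, i⟩, hs, ⟨e⟩⟩)
  · exact .zero _ ((T.tw_tri n).map_isZero hA)
  · obtain ⟨a⟩ := (T.tw_tri n).shift_iso ((T.tw m).obj (X s)) i
    obtain ⟨b⟩ := T.tw_tw m n (m + n) rfl (X s)
    exact le_extW _ _ (.inr ⟨⟨s, m + n, i⟩, hs, ⟨((T.tw n).mapIso e).trans
      (a.trans ((shiftFunctor D i).mapIso b))⟩⟩)

theorem TateTwist.extW_tw_single (X : D) (n : ℤ) {Y : D}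
    (hY : ExtW (familyProp (fun m => (T.tw m).obj X) Set.univ) Y) :
    ExtW (familyProp (fun m => (T.tw m).obj X) Set.univ) ((T.tw n).obj Y) := by
  refine (T.tw_tri n).extW ?_ hY
  rintro A (hA | ⟨m, -, ⟨e⟩⟩)
  · exact .zero _ ((T.tw_tri n).map_isZero hA)
  · obtain ⟨b⟩ := T.tw_tw m n (m + n) rfl X
    exact le_extW _ _ (.inr ⟨m + n, trivial, ⟨((T.tw n).mapIso e).trans b⟩⟩)

theorem triangHull_le_extW {P : ObjectProperty D} (X : S → D) (F : Set S)
    (hP : ∀ Y, P Y → ∃ s ∈ F, ∃ n : ℤ, Y = (T.tw n).obj (X s)) {Y : D} (hY : triangHull P Y) :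
    ExtW (familyProp (fun p : S × ℤ × ℤ => ((T.tw p.2.1).obj (X p.1))⟦p.2.2⟧)
      {p | p.1 ∈ F}) Y := by
  have := familyProp_shift (fun s n => (T.tw n).obj (X s)) F
  refine hY (extW (familyProp (fun p : S × ℤ × ℤ => ((T.tw p.2.1).obj (X p.1))⟦p.2.2⟧)
      {p | p.1 ∈ F})) inferInstance inferInstance ?_
  intro Z hZ
  obtain ⟨s, hs, n, rfl⟩ := hP Z hZ
  exact le_extW _ _ (.inr ⟨⟨s, n, 0⟩, hs, ⟨(shiftZeroIso _).symm⟩⟩)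

theorem eq_zero_or_isIso_of_finrank {X : D} (h : Module.finrank k (X ⟶ X) = 1) (f : X ⟶ X) :
    f = 0 ∨ IsIso f := by
  by_cases h1 : (𝟙 X : X ⟶ X) = 0
  · left
    rw [← Category.id_comp f, h1, zero_comp]
  · obtain ⟨c, rfl⟩ := (finrank_eq_one_iff_of_nonzero' _ h1).1 h f
    by_cases hc : c = 0
    · exact .inl (by rw [hc, zero_smul])
    · right
      exact ⟨c⁻¹ • 𝟙 X, by simp [smul_smul, hc], by simp [smul_smul, hc]⟩

variable {T}

/-- The system of twists of a quasi-exceptional set and of its dual. -/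
def stdSystem (hS : ∀ s : S, (Set.Iic s).Finite) (E : DualPair D S)
    (hqe : IsQuasiExceptional T E.nabla) (hdual : IsDual T E) (hab : IsAbelianesque T E) :
    StdSystem D S where
  nab s n := (T.tw n).obj (E.nabla s)
  del s n := (T.tw n).obj (E.delta s)
  io s n := (T.tw n).map (E.iota s)
  finite_Iic := hS
  order s u h n m i := T.orth_tw n m (hqe.order s u h i _)
  nab_neg s u n m i hi := T.orth_tw n m (hab.nabla s u i hi _)
  del_neg s u n m i hi := T.orth_tw n m (hab.delta s u i hi _)
  nab_zero s n m h := by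
    refine (T.orth_tw (i := 0) n m ?_).of_iso (Iso.refl _) (shiftZeroIso _)
    exact Orth.of_iso (hqe.self_zero_twist s (m - n) (by lia)) (Iso.refl _) (shiftZeroIso _).symm
  nab_isIso s n f := by
    obtain ⟨g, rfl⟩ := (T.tw n).map_surjective f
    rcases eq_zero_or_isIso_of_finrank (hqe.self_zero s) g with rfl | hg
    · exact .inl (T.tw_tri n).map_zero
    · exact .inr inferInstance
  nab_not_isZero s n h := by
    have h0 : IsZero (E.nabla s) := by
      rw [IsZero.iff_id_eq_zero]
      apply (T.tw n).map_injective
      exact h.eq_of_src _ _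
    have : Subsingleton (E.nabla s ⟶ E.nabla s) := ⟨fun f g => h0.eq_of_src f g⟩
    have := hqe.self_zero s
    rw [Module.finrank_zero_of_subsingleton] at this
    exact zero_ne_one this
  mixed s n m i hi h := T.orth_tw n m (hqe.mixed s i hi _ (by lia))
  del_vanish s u h n m i := T.orth_tw n m (hdual.vanish s u h i _)
  cone s n := by
    obtain ⟨C, g, h, hT, hC⟩ := hdual.cone s
    obtain ⟨k', hT'⟩ := (T.tw_tri n).tri hT
    refine ⟨_, _, _, hT', T.extW_tw E.nabla (Set.Iio s) n
      (triangHull_le_extW T E.nabla (Set.Iio s) ?_ hC)⟩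
    rintro Y ⟨u, m, hu, rfl⟩
    exact ⟨u, hu, m, rfl⟩
  generate X := by
    refine triangHull_le_extW T E.nabla Set.univ
      (P := fun X => ∃ (s : S) (n : ℤ), X = (T.tw n).obj (E.nabla s)) ?_ ?_
    · rintro Y ⟨u, m, rfl⟩
      exact ⟨u, trivial, m, rfl⟩
    · rw [hqe.generate]
      trivial

variable (hS : ∀ s : S, (Set.Iic s).Finite) {E : DualPair D S}
    (hqe : IsQuasiExceptional T E.nabla) (hdual : IsDual T E) (hab : IsAbelianesque T E)

theorem assoc_of_isAssociated {t : TStructure D} (ht : IsAssociated T E t) :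
    (stdSystem hS E hqe hdual hab).Assoc t where
  le_zero := ht.le_zero
  ge_zero := ht.ge_zero

include hS hqe hdual hab

theorem exists_isAssociated : ∃ t : TStructure D, IsAssociated T E t := by
  refine ⟨(stdSystem hS E hqe hdual hab).tStructure, ⟨fun X => ?_, fun X => ?_⟩⟩
  · change (∀ (s : S) (m d : ℤ), d < -0 → _) ↔ _
    rw [neg_zero]
    rfl
  · change (∀ (s : S) (m d : ℤ), -0 < d → _) ↔ _
    rw [neg_zero]
    rfl

theorem costandardEff_of_isEffaceable {t : TStructure D} (ht : IsAssociated T E t)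
    (heff : IsEffaceable T E t) : (stdSystem hS E hqe hdual hab).CostandardEff := by
  intro s m d Z g hd hZ
  have ht' := assoc_of_isAssociated hS hqe hdual hab ht
  have hZ' := T.extW_tw_single (E.nabla s) (-m) hZ
  obtain ⟨b⟩ := T.tw_tw (-m) m 0 (by lia) Z
  obtain ⟨a⟩ := (T.tw_tri m).shift_iso ((T.tw (-m)).obj Z) d
  let θ : (T.tw m).obj (((T.tw (-m)).obj Z)⟦d⟧) ≅ Z⟦d⟧ :=
    a.trans ((shiftFunctor D d).mapIso b)
  obtain ⟨g₀, hg₀⟩ := (T.tw m).map_surjective (X := E.nabla s) (g ≫ θ.inv)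
  have hP : familyProp (fun m => (T.tw m).obj (E.nabla s)) Set.univ ≤
      extW (heartProp (t := t)
        fun X => ∃ n : ℤ, Nonempty (X.obj ≅ (T.tw n).obj (E.nabla s))) := by
    refine familyProp_le fun n _ => le_extW _ _ ⟨ht'.nab_heart s n, n, ⟨Iso.refl _⟩⟩
  have hZ₁ := extW_le_extW hP _ hZ'
  have hZh : t.heart ((T.tw (-m)).obj Z) := extW_heart (fun Y hY => hY.choose) _ hZ₁
  obtain ⟨Y, h, hY, hh, hhg⟩ := heff.costandard s (ht'.nab_heart s 0) ⟨_, hZh⟩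
    ((hasFiltration_iff_extW _ _).2 hZ₁) d hd g₀
  let h' : Y ⟶ ht'.nabH s 0 := h
  have : Epi h' := hh
  obtain ⟨M, c, hM, hc⟩ := ht'.exists_delW_of_epi h' hY
  refine ⟨(T.tw m).obj M, (T.tw m).map (c ≫ h.hom), T.extW_tw_single (E.delta s) m hM,
    fun h0 => hc ((T.tw m).map_injective (h0.trans (T.tw_tri m).map_zero.symm)), ?_⟩
  have h0 : (T.tw m).map (c ≫ h.hom) ≫ (T.tw m).map g₀ = 0 := by
    rw [← Functor.map_comp, Category.assoc, hhg, comp_zero, (T.tw_tri m).map_zero]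
  rw [← (Iso.eq_comp_inv θ).1 hg₀]
  exact (Category.assoc _ _ _).symm.trans ((congrArg (· ≫ θ.hom) h0).trans zero_comp)

/-- Realization functors of the Serre subcategories of convex index sets are fully faithful. -/
theorem full_faithful_of_convex {t : TStructure D} (ht : IsAssociated T E t)
    (heff : IsEffaceable T E t) {Xi : Set (S × ℤ)} (hXi : IsConvex T E t Xi)
    [HasDerivedCategory (SerreXiCat T E t Xi)]
    (R : RealizationFunctor (serreXiInclusion T E t Xi)) :
    R.functor.Full ∧ R.functor.Faithful := by
  have ht' := assoc_of_isAssociated hS hqe hdual hab ht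
  have H := costandardEff_of_isEffaceable hS hqe hdual hab ht heff
  let := R.commShift
  have := R.isTriangulated
  have key := bijOn_bounded R.restrictIso
    (fun X Y d hd f => heart_hom_shift_neg t (X := X.obj) (Y := Y.obj) f hd)
    (fun X Y d f hd => by
      obtain ⟨X', p, hX', hp, hpf⟩ := ht'.epiEff_of_convex H (Xi := Xi)
        (fun q hq => (hXi.nabla_mem q.1 q.2 hq).choose_spec)
        (fun q hq => (hXi.delta_mem q.1 q.2 hq).choose_spec) hXi.interval d hd X.obj X.property
        Y.obj f Y.property
      let p' : (⟨X', hX'⟩ : SerreXiCat T E t Xi) ⟶ X := ObjectProperty.homMk p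
      have : Epi ((serreXi T E t Xi).ι.map p') := hp
      exact ⟨_, p', (serreXi T E t Xi).ι.epi_of_epi_map this, hpf⟩)
  exact ⟨⟨fun {P Q} => (key P Q).2⟩, ⟨fun {P Q} _ _ h => (key P Q).1 h⟩⟩

/-- Realization functors of the heart are equivalences. -/
theorem isEquivalence_of_realization {t : TStructure D} (ht : IsAssociated T E t)
    (heff : IsEffaceable T E t) [HasDerivedCategory (HeartCat t)]
    (R : RealizationFunctor t.heart.ι) : R.functor.IsEquivalence := by
  have ht' := assoc_of_isAssociated hS hqe hdual hab ht
  have H := costandardEff_of_isEffaceable hS hqe hdual hab ht heff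
  let := R.commShift
  have := R.isTriangulated
  have key := bijOn_bounded R.restrictIso
    (fun X Y d hd f => heart_hom_shift_neg t (X := X) (Y := Y) f hd)
    (fun X Y d f hd => by
      obtain ⟨X', p, hX', hp, hpf⟩ := ht'.epiEff_of_convex H (Xi := Set.univ)
        (fun q _ => ht'.serre_univ _) (fun q _ => ht'.serre_univ _)
        (fun s => Set.ordConnected_univ) d hd X (ht'.serre_univ X) Y f (ht'.serre_univ Y)
      exact ⟨X', p, hp, hpf⟩)
  have : R.functor.Full := ⟨fun {P Q} => (key P Q).2⟩
  have : R.functor.Faithful := ⟨fun {P Q} _ _ h => (key P Q).1 h⟩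
  have : R.functor.EssSurj := ⟨fun Y => by
    have hY : triangHull (fun X => ∃ (s : S) (n : ℤ), X = (T.tw n).obj (E.nabla s)) Y := by
      rw [hqe.generate]
      trivial
    refine hY R.functor.essImage inferInstance inferInstance ?_
    rintro _ ⟨s, n, rfl⟩
    exact ⟨_, ⟨R.restrictIso.app (ht'.nabH s n)⟩⟩⟩
  exact {}

end Build

end QuasiExc

end

theorem mainTheorem3 {k : Type*} [Field k] [IsAlgClosed k]
    {D : Type*} [Category* D] [Preadditive D] [Linear k D] [HasZeroObject D] [HasShift D ℤ]
    [∀ n : ℤ, (shiftFunctor D n).Additive] [∀ n : ℤ, (shiftFunctor D n).Linear k]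
    [Pretriangulated D] [IsTriangulated D] (T : QuasiExc.TateTwist k D)
    {S : Type*} [PartialOrder S] (hS : ∀ s : S, (Set.Iic s).Finite)
    (E : QuasiExc.DualPair D S) (hqe : QuasiExc.IsQuasiExceptional T E.nabla)
    (hdual : QuasiExc.IsDual T E) (hab : QuasiExc.IsAbelianesque T E) :
    (∃ t : TStructure D, QuasiExc.IsAssociated T E t) ∧
    ∀ t : TStructure D, QuasiExc.IsAssociated T E t → QuasiExc.IsEffaceable T E t →
      (∀ Xi : Set (S × ℤ), QuasiExc.IsConvex T E t Xi →
        ∀ [HasDerivedCategory (QuasiExc.SerreXiCat T E t Xi)]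
          (R : QuasiExc.RealizationFunctor (QuasiExc.serreXiInclusion T E t Xi)),
          R.functor.Full ∧ R.functor.Faithful) ∧
      ∀ [HasDerivedCategory (QuasiExc.HeartCat t)]
        (R : QuasiExc.RealizationFunctor t.heart.ι), R.functor.IsEquivalence := by
  exact ⟨QuasiExc.exists_isAssociated hS hqe hdual hab, fun t ht heff =>
    ⟨fun Xi hXi _ R => QuasiExc.full_faithful_of_convex hS hqe hdual hab ht heff hXi R,
      fun R => QuasiExc.isEquivalence_of_realization hS hqe hdual hab ht heff R⟩⟩
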